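/- **Setting.** Let $L_1,L_2:\mathbb R^m\times\mathbb R^d\to\mathbb R$, written $L_i(\lambda,w)$, where - $L_1$ is twice continuously differentiable, $\ell_{10}$-Lipschitz in $w$ for each $\lambda$, and $\nabla L_1$ is $\ell_{11}$-Lipschitz; - $L_2$ is twice differentiable, $\nabla L_2$ is $\ell_{21}$-Lipschitz, $\nabla^2L_2$ is $\ell_{22}$-Lipschitz, and $L_2(\lambda,\cdot)$ is $\mu_2$-strongly convex for each $\lambda$, $\mu_2>0$. Put $w_*(\lambda)=\arg\min_wL_2(\lambda,w)$, $\mathcal L(\lambda)=L_1(\lambda,w_*(\lambda))$, and $\kappa=\max\{\ell_{10},\ell_{11},\ell_{21},\ell_{22}\}/\mu_2$. For $\alpha>0$ put $\Gamma^\alpha(\lambda)=\min_w\max_u\{L_1(\lambda,w)+\alpha(L_2(\lambda,w)-L_2(\lambda,u))\}$. Let $\ell_\Gamma$ be the least constant, independent of $\alpha$, that is a Lipschitz constant of $\nabla\Gamma^\alpha$ for every $\alpha>2\ell_{11}/\mu_2$. **Stochastic gradients.** The losses $L_1(\cdot;D)$ and $L_2(\cdot;D)$ on a minibatch $D$ of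 $B\ge1$ validation (respectively training) examples are averages of differentiable per-example losses. For $D$ drawn from the respective minibatch law, $\nabla L_i(\lambda,w;D)$ is at every point $(\lambda,w)$ an unbiased estimator of $\nabla L_i(\lambda,w)$ with variance at most $\sigma_i^2/B$. **Algorithm (ScaleBiO).** The coordinates of $\mathbb R^d$ are partitioned into $J\ge1$ blocks, for $u$ and for $w$. Write $\Pi^u_j,\Pi^w_j$ for the operators that keep the coordinates in block $j$ and set the others to $0$. Start from deterministic $(\lambda_0,u_0,w_0)$. For $k=0,\dots,K-1$ draw a training minibatch $D^k_{tr}$, a validation minibatch $D^k_{val}$, and uniform block indices $j_k,r_k\in\{1,\dots,J\}$, all independent of each other and across iterations, and set $$u_{k+1}=u_k-\alpha\eta_u\,\Pi^u_{j_k}\nabla_wL_2(\lambda_k,u_k;D_{tr}^k),$$ $$w_{k+1}=w_k-\eta_w\,\Pi^w_{r_k}\big(\nabla_wL_1(\lambda_k,w_k;D_{val}^k)+\alpha\nabla_wL_2(\lambda_k,w_k;D_{tr}^k)\big),$$ $$\lambda_{k+1}=\lambda_k-\eta_\lambda\Big(\nabla_\lambda L_1(\lambda_k,w_k;D_{val}^k)+\alpha\big(\nabla_\lambda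 L_2(\lambda_k,w_k;D_{tr}^k)-\nabla_\lambda L_2(\lambda_k,u_k;D_{tr}^k)\big)\Big),$$ with $\alpha=K^{1/7}$, $\eta_u=\eta_w=\eta_0K^{-4/7}$, $\eta_\lambda=\eta_0^\lambda K^{-5/7}$. Let $\tilde\lambda$ be chosen uniformly from $\lambda_1,\dots,\lambda_K$, independently of the run. **Theorem.** Assume $\eta_0,\eta_0^\lambda>0$, $\;8\ell_\Gamma\eta_0^\lambda\le1$, $\;\eta_0\le8J/\mu_2$, $\;\eta_0/\eta_0^\lambda\ge6\sqrt2\,\kappa^2J$. Assume also that $\mathcal L$ is bounded below, with $\mathcal L(\lambda_0)-\inf\mathcal L\le\Delta$, and that $\|u_0-w_*(\lambda_0)\|\le\rho$ and $\|w_0-w_*(\lambda_0)\|\le\rho$. Then there are constants $C,C'$, depending only on $\ell_{10},\ell_{11},\ell_{21},\ell_{22},\mu_2,\sigma_1,\sigma_2,B,J,\eta_0,\eta_0^\lambda,\Delta,\rho$, such that for every $K\ge1$ the function $\mathcal L$ is differentiable, $\|\nabla\mathcal L(\tilde\lambda)\|^2$ is integrable, and 1. if $\alpha=K^{1/7}\ge\ell_{11}/\mu_2$,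 then $\mathbb E\big[\|\nabla\mathcal L(\tilde\lambda)\|^2\big]\le C\,K^{-2/7}$; 2. for every $\varepsilon\in(0,1]$, if $K\ge C'\varepsilon^{-7}$, then $K^{1/7}\ge\ell_{11}/\mu_2$ and $\mathbb E\big[\|\nabla\mathcal L(\tilde\lambda)\|^2\big]\le\varepsilon^2$. That is, with a fixed batch size, $O(\varepsilon^{-7})$ iterations suffice for an $\varepsilon$-stationary point. -/

import Mathlib

open MeasureTheory ProbabilityTheory
open scoped NNReal Gradient

noncomputable section

/-- Euclidean space of dimension `n`. -/
abbrev Vec (n : ℕ) : Type := EuclideanSpace ℝ (Fin n)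

/-- The Euclidean space of pairs `(lam, w)`, with coordinates indexed by the disjoint union. -/
abbrev Joint (m d : ℕ) : Type := EuclideanSpace ℝ (Fin m ⊕ Fin d)

/-- The pair `(lam, w)` as a point of the joint Euclidean space. -/
def pair {m d : ℕ} (lam : Vec m) (w : Vec d) : Joint m d := WithLp.toLp 2 (Sum.elim lam w)

/-- The `lam`-component of a vector of the joint space. -/
def lamPart {m d : ℕ} (z : Joint m d) : Vec m := WithLp.toLp 2 fun i => z (Sum.inl i)

/-- The `w`-component of a vector of the joint space. -/
def wPart {m d : ℕ} (z : Joint m d) : Vec d := WithLp.toLp 2 fun i => z (Sum.inr i)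

/-! ### The bilevel problem and its penalty reformulation -/

/-- The lower-level solution `w_*(lam) = argmin_w L₂(lam, w)`. -/
def lowerArgmin {m d : ℕ} (L₂ : Joint m d → ℝ) (lam : Vec m) : Vec d :=
  Classical.epsilon fun w => ∀ v, L₂ (pair lam w) ≤ L₂ (pair lam v)

/-- The bilevel objective `𝓛(lam) = L₁(lam, w_*(lam))`. -/
def bilevelObjective {m d : ℕ} (L₁ L₂ : Joint m d → ℝ) (lam : Vec m) : ℝ :=
  L₁ (pair lam (lowerArgmin L₂ lam))

/-- `𝓛^α(lam, w, u) = L₁(lam, w) + α (L₂(lam, w) - L₂(lam, u))`. -/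
def penaltyObjective {m d : ℕ} (L₁ L₂ : Joint m d → ℝ) (α : ℝ)
    (lam : Vec m) (w u : Vec d) : ℝ :=
  L₁ (pair lam w) + α * (L₂ (pair lam w) - L₂ (pair lam u))

/-- `Φ^α(lam, w) = max_u 𝓛^α(lam, w, u)`. -/
def penaltyMax {m d : ℕ} (L₁ L₂ : Joint m d → ℝ) (α : ℝ) (lam : Vec m) (w : Vec d) : ℝ :=
  ⨆ u, penaltyObjective L₁ L₂ α lam w u

/-- `Γ^α(lam) = min_w Φ^α(lam, w)`. -/
def penaltyMinMax {m d : ℕ} (L₁ L₂ : Joint m d → ℝ) (α : ℝ) (lam : Vec m) : ℝ :=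
  ⨅ w, penaltyMax L₁ L₂ α lam w

/-- The smoothness parameter `ℓ_Γ`, independent of `α`: the least constant that is a Lipschitz
constant of `∇Γ^α` for every `α > α₀`. -/
def penaltySmoothness {m d : ℕ} (L₁ L₂ : Joint m d → ℝ) (α₀ : ℝ) : ℝ :=
  sInf {l : ℝ | 0 ≤ l ∧ ∀ α : ℝ, α₀ < α → ∀ x y : Vec m,
    ‖∇ (penaltyMinMax L₁ L₂ α) x - ∇ (penaltyMinMax L₁ L₂ α) y‖ ≤ l * ‖x - y‖}

/-- The condition number `κ = max {ℓ₁₀, ℓ₁₁, ℓ₂₁, ℓ₂₂} / μ₂`. -/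
def conditionNumber (l₁₀ l₁₁ l₂₁ l₂₂ : ℝ≥0) (μ₂ : ℝ) : ℝ :=
  max (max (l₁₀ : ℝ) l₁₁) (max (l₂₁ : ℝ) l₂₂) / μ₂

/-- The regularity assumptions on the upper- and lower-level objectives. -/
structure BilevelRegularity {m d : ℕ} (L₁ L₂ : Joint m d → ℝ)
    (l₁₀ l₁₁ l₂₁ l₂₂ : ℝ≥0) (μ₂ : ℝ) : Prop where
  upper_contDiff : ContDiff ℝ 2 L₁
  upper_lipschitz : ∀ lam : Vec m, LipschitzWith l₁₀ fun w : Vec d => L₁ (pair lam w)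
  upper_gradient_lipschitz : LipschitzWith l₁₁ (∇ L₁)
  lower_differentiable : Differentiable ℝ L₂
  lower_gradient_lipschitz : LipschitzWith l₂₁ (∇ L₂)
  lower_gradient_differentiable : Differentiable ℝ (∇ L₂)
  lower_hessian_lipschitz : LipschitzWith l₂₂ (fderiv ℝ (∇ L₂))
  lower_strongConvex : ∀ lam : Vec m,
    StrongConvexOn Set.univ μ₂ fun w : Vec d => L₂ (pair lam w)

/-! ### Stochastic gradients from minibatches -/

/-- The loss on a minibatch `D` of `B` examples: the average of the losses of its examples. -/
def batchLoss {m d B : ℕ} {S : Type*} (f : Joint m d → S → ℝ) (D : Fin B → S)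
    (z : Joint m d) : ℝ :=
  (∑ b, f z (D b)) / B

/-- When the minibatch `D` has law `ν`, the gradient of the loss on `D` is an unbiased estimator
of `∇L` whose variance is at most `σ² / B`, at every point. -/
structure IsMinibatchGradient {m d B : ℕ} {S : Type*} [MeasurableSpace S]
    (L : Joint m d → ℝ) (f : Joint m d → S → ℝ) (ν : Measure (Fin B → S)) (σ : ℝ) : Prop where
  differentiable : ∀ a : S, Differentiable ℝ fun z => f z a
  measurable : Measurable fun p : Joint m d × (Fin B → S) => ∇ (batchLoss f p.2) p.1
  memLp : ∀ z, MemLp (fun D => ∇ (batchLoss f D) z - ∇ L z) 2 ν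
  unbiased : ∀ z, ∫ D, ∇ (batchLoss f D) z ∂ν = ∇ L z
  variance_le : ∀ z, ∫ D, ‖∇ (batchLoss f D) z - ∇ L z‖ ^ 2 ∂ν ≤ σ ^ 2 / B

/-! ### The algorithm -/

/-- The part `U_j U_jᵀ g` of `g` in the `j`-th block of coordinates. The blocks are given by
the map `blk` that sends a coordinate to the block containing it. -/
def blockPart {d J : ℕ} (blk : Fin d → Fin J) (j : Fin J) (g : Vec d) : Vec d :=
  WithLp.toLp 2 fun i => if blk i = j then g i else 0

/-- The variables `(lam, u, w)` of the algorithm. -/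
structure Iterate (m d : ℕ) where
  lam : Vec m
  u : Vec d
  w : Vec d

/-- One iteration, with minibatches `Dtr`, `Dval` and selected blocks `j` (for `u`) and `r`
(for `w`). Here `f₁`, `f₂` are the upper- and lower-level losses of one example. -/
def scaleBiOStep {m d J B : ℕ} {Sval Str : Type*}
    (f₁ : Joint m d → Sval → ℝ) (f₂ : Joint m d → Str → ℝ) (blkU blkW : Fin d → Fin J)
    (α ηu ηw ηlam : ℝ) (Dtr : Fin B → Str) (Dval : Fin B → Sval) (j r : Fin J)
    (s : Iterate m d) : Iterate m d where
  u := s.u - (α * ηu) • blockPart blkU j (wPart (∇ (batchLoss f₂ Dtr) (pair s.lam s.u)))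
  w := s.w - ηw • blockPart blkW r
    (wPart (∇ (batchLoss f₁ Dval) (pair s.lam s.w)) +
      α • wPart (∇ (batchLoss f₂ Dtr) (pair s.lam s.w)))
  lam := s.lam - ηlam •
    (lamPart (∇ (batchLoss f₁ Dval) (pair s.lam s.w)) +
      α • (lamPart (∇ (batchLoss f₂ Dtr) (pair s.lam s.w)) -
        lamPart (∇ (batchLoss f₂ Dtr) (pair s.lam s.u))))

/-- The iterates `(lam_k, u_k, w_k)` for given sequences of minibatches and blocks. -/
def scaleBiO {m d J B : ℕ} {Sval Str : Type*}
    (f₁ : Joint m d → Sval → ℝ) (f₂ : Joint m d → Str → ℝ) (blkU blkW : Fin d → Fin J)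
    (α ηu ηw ηlam : ℝ) (init : Iterate m d)
    (Dtr : ℕ → Fin B → Str) (Dval : ℕ → Fin B → Sval) (j r : ℕ → Fin J) : ℕ → Iterate m d
  | 0 => init
  | k + 1 => scaleBiOStep f₁ f₂ blkU blkW α ηu ηw ηlam (Dtr k) (Dval k) (j k) (r k)
      (scaleBiO f₁ f₂ blkU blkW α ηu ηw ηlam init Dtr Dval j r k)

/-- The randomness of a run with `K` iterations: at each iteration the two minibatches (with laws
`νtr`, `νval`) and the two uniformly distributed block indices are independent of each other and
of those of all other iterations; the output index `N` is uniform on `{1, …, K}` and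
independent of all of them. -/
structure ScaleBiORandomness {Ω Sval Str : Type*} [MeasurableSpace Ω] [MeasurableSpace Sval]
    [MeasurableSpace Str] {B J : ℕ} (P : Measure Ω) (K : ℕ)
    (νtr : Measure (Fin B → Str)) (νval : Measure (Fin B → Sval))
    (Dtr : ℕ → Ω → Fin B → Str) (Dval : ℕ → Ω → Fin B → Sval) (j r : ℕ → Ω → Fin J)
    (N : Ω → ℕ) : Prop where
  measurable_Dtr : ∀ k, Measurable (Dtr k)
  measurable_Dval : ∀ k, Measurable (Dval k)
  measurable_j : ∀ k, Measurable (j k)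
  measurable_r : ∀ k, Measurable (r k)
  measurable_N : Measurable N
  law : ∀ k, P.map (fun ω => (Dtr k ω, Dval k ω, j k ω, r k ω)) =
    νtr.prod (νval.prod ((uniformOn Set.univ).prod (uniformOn Set.univ)))
  indep : iIndepFun (fun k ω => (Dtr k ω, Dval k ω, j k ω, r k ω)) P
  law_N : P.map N = uniformOn (Set.Icc 1 K)
  indep_N : IndepFun N (fun ω k => (Dtr k ω, Dval k ω, j k ω, r k ω)) P

/-- The random output `lam_N` of a run with `K` iterations and parameters
`α = K^{1/7}`, `η_u = η_w = η₀ / K^{4/7}`, `η_lam = η₀^lam / K^{5/7}`. -/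
def scaleBiOOutput {Ω Sval Str : Type*} {m d J B : ℕ}
    (f₁ : Joint m d → Sval → ℝ) (f₂ : Joint m d → Str → ℝ) (blkU blkW : Fin d → Fin J)
    (η₀ ηlam₀ : ℝ) (K : ℕ) (init : Iterate m d)
    (Dtr : ℕ → Ω → Fin B → Str) (Dval : ℕ → Ω → Fin B → Sval) (j r : ℕ → Ω → Fin J)
    (N : Ω → ℕ) (ω : Ω) : Vec m :=
  (scaleBiO f₁ f₂ blkU blkW ((K : ℝ) ^ (1 / 7 : ℝ))
    (η₀ / (K : ℝ) ^ (4 / 7 : ℝ)) (η₀ / (K : ℝ) ^ (4 / 7 : ℝ)) (ηlam₀ / (K : ℝ) ^ (5 / 7 : ℝ))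
    init (fun k => Dtr k ω) (fun k => Dval k ω) (fun k => j k ω) (fun k => r k ω) (N ω)).lam

end

/-!
# Convergence of ScaleBiO at the rate `K ^ (-2/7)`

Write `s = K ^ (-1/7)`, so that the penalty is `α = 1 / s`. The step sizes of `u` and `w` along
`∇_w L₂` are of order `s ^ 3`, that of `lam` is of order `s ^ 5`. So `z = (u, w)` is a fast variable
that tracks the target `(w_*(lam), w_*(lam))`: its error `q` contracts at rate `s ^ 3` per step,
while the noise and the gradient of `L₁` in `w` keep `q` at the order `s`. The slow variable `lam`
makes steps of size `s ^ 5` along `-∇𝓛` that are perturbed by the deviation of `z` from its target.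
The perturbation is amplified by `α`, hence of order `s ^ 4 * q`. This is the order of the step
itself, so that it cannot be treated as an arbitrary error.

What helps is the structure of the perturbation. Let `P lam` be the adjoint of the derivative
of `w_*`, so that `∇𝓛 = ∇_lam L₁ + P ∇_w L₁` at `(lam, w_*(lam))`. By implicit differentiation the
derivative in `w` of `∇_lam L₂ + P ∇_w L₂` vanishes at `w_*(lam)`
(`BilevelRegularity.correctedGradient_linear_part_eq_zero`). The part of the perturbation that is
linear in the deviation is therefore `-P` applied to a multiple of the mean increment of `w - u`,
and it disappears when the slow variable is replaced by `lam + β P (w - u)` for the right `β`, of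
order `s`. Clipping `w - u` to the unit ball keeps the shift of order `s` (`shifted`). The choice
of `β` uses that the selected blocks contain on average the fraction `1 / J` of the gradient in
both copies. What remains of the perturbation is of second order: `s ^ 4` times the Huber function of
`q` (`BilevelRegularity.norm_mean_add_le`, `SlowFastStep.norm_integral_shifted_sub_add_le`).

The Lyapunov function (`lyapunov`) is the sum of `𝓛` at the shifted point, of
`C₁ s ‖∇𝓛(lam)‖ huber q` and of `C₂ s² q²`. The product term compensates the remaining perturbation
of the descent, and its factor `‖∇𝓛‖` makes this possible without a bound on the gradient. With
suitable weights every step decreases the mean of this function by `(b / 2) ‖∇𝓛‖²`, where `b` is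
the step size of `lam`, up to an error of order `s ^ 7 = 1 / K`
(`SlowFastStep.integral_lyapunov_le`). Summation over `K` steps and division by `b K`, of order
`s ^ (-2)`, give the rate `s ^ 2 = K ^ (-2/7)`. This requires `s` to be small; for the finitely many
remaining values of `K` it suffices that one step multiplies the mean energy at most by a constant
(`SlowFastStep.integral_energy_le`), which also yields the integrability of all quantities.
-/

/-! ### Saturating functions -/

/-- A Lipschitz map onto the closed unit ball that is the identity on that ball. -/
noncomputable def clip {Y : Type*} [NormedAddCommGroup Y] [NormedSpace ℝ Y] (v : Y) : Y :=
  (max 1 ‖v‖)⁻¹ • v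

section Clip

variable {Y : Type*} [NormedAddCommGroup Y] [NormedSpace ℝ Y]

lemma clip_eq_self {v : Y} (h : ‖v‖ ≤ 1) : clip v = v := by
  simp [clip, max_eq_left h]

lemma norm_clip_le_one (v : Y) : ‖clip v‖ ≤ 1 := by
  have hm : 0 < max 1 ‖v‖ := lt_of_lt_of_le one_pos (le_max_left _ _)
  rw [clip, norm_smul, norm_inv, Real.norm_of_nonneg hm.le, inv_mul_le_iff₀ hm, mul_one]
  exact le_max_right _ _

lemma norm_clip_le (v : Y) : ‖clip v‖ ≤ ‖v‖ := by
  have hm : 0 < max 1 ‖v‖ := lt_of_lt_of_le one_pos (le_max_left _ _)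
  rw [clip, norm_smul, norm_inv, Real.norm_of_nonneg hm.le, inv_mul_le_iff₀ hm]
  exact le_mul_of_one_le_left (norm_nonneg _) (le_max_left _ _)

lemma norm_clip_sub_clip_le (v w : Y) : ‖clip v - clip w‖ ≤ 2 * ‖v - w‖ := by
  set a := max 1 ‖v‖ with ha
  set b := max 1 ‖w‖ with hb
  have ha1 : 1 ≤ a := le_max_left _ _
  have hb1 : 1 ≤ b := le_max_left _ _
  have ha0 : 0 < a := one_pos.trans_le ha1
  have hb0 : 0 < b := one_pos.trans_le hb1
  have hwb : ‖w‖ ≤ b := le_max_right _ _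
  have hab : |b - a| ≤ ‖v - w‖ := by
    have h1 : |b - a| ≤ |‖w‖ - ‖v‖| := by
      rw [ha, hb]
      have := abs_max_sub_max_le_max (1 : ℝ) ‖w‖ 1 ‖v‖
      simpa using this
    have h2 := abs_norm_sub_norm_le w v
    rw [norm_sub_rev w v] at h2
    exact h1.trans h2
  have hdec : clip v - clip w = a⁻¹ • (v - w) + ((b - a) * (a⁻¹ * b⁻¹)) • w := by
    have : (b - a) * (a⁻¹ * b⁻¹) = a⁻¹ - b⁻¹ := by field_simp
    rw [this]; simp only [clip, ← ha, ← hb]; module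
  have h1 : ‖a⁻¹ • (v - w)‖ ≤ ‖v - w‖ := by
    rw [norm_smul, norm_inv, Real.norm_of_nonneg ha0.le]
    exact mul_le_of_le_one_left (norm_nonneg _) (inv_le_one_of_one_le₀ ha1)
  have h2 : ‖((b - a) * (a⁻¹ * b⁻¹)) • w‖ ≤ ‖v - w‖ := by
    rw [norm_smul, norm_mul, norm_mul, norm_inv, norm_inv, Real.norm_of_nonneg ha0.le,
      Real.norm_of_nonneg hb0.le, Real.norm_eq_abs]
    have h3 : b⁻¹ * ‖w‖ ≤ 1 := by rw [inv_mul_le_iff₀ hb0, mul_one]; exact hwb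
    have h4 : a⁻¹ ≤ 1 := inv_le_one_of_one_le₀ ha1
    calc |b - a| * (a⁻¹ * b⁻¹) * ‖w‖ = |b - a| * (a⁻¹ * (b⁻¹ * ‖w‖)) := by ring
      _ ≤ ‖v - w‖ * (1 * 1) := by gcongr
      _ = ‖v - w‖ := by ring
  rw [hdec]
  linarith [norm_add_le (a⁻¹ • (v - w)) (((b - a) * (a⁻¹ * b⁻¹)) • w)]

lemma continuous_clip : Continuous (clip : Y → Y) := by
  unfold clip
  refine Continuous.smul (Continuous.inv₀ (by fun_prop) fun v => ?_) continuous_id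
  exact (one_pos.trans_le (le_max_left _ _)).ne'

end Clip

/-- The pseudo-Huber function: quadratic near `0`, of linear growth at infinity. -/
noncomputable def huber (q : ℝ) : ℝ := √(1 + q ^ 2) - 1

lemma one_le_sqrt_one_add_sq (q : ℝ) : 1 ≤ √(1 + q ^ 2) :=
  Real.one_le_sqrt.2 (by nlinarith [sq_nonneg q])

lemma sq_sqrt_one_add_sq (q : ℝ) : √(1 + q ^ 2) ^ 2 = 1 + q ^ 2 := Real.sq_sqrt (by positivity)

lemma huber_nonneg (q : ℝ) : 0 ≤ huber q := sub_nonneg.2 (one_le_sqrt_one_add_sq q)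

lemma huber_le_self {q : ℝ} (hq : 0 ≤ q) : huber q ≤ q := by
  have h1 := one_le_sqrt_one_add_sq q
  have h2 := sq_sqrt_one_add_sq q
  unfold huber
  nlinarith

lemma huber_le_sq (q : ℝ) : huber q ≤ q ^ 2 := by
  have h1 := one_le_sqrt_one_add_sq q
  have h2 := sq_sqrt_one_add_sq q
  unfold huber
  nlinarith

lemma continuous_huber : Continuous huber := by unfold huber; fun_prop

/-- The tangent-line bound that expresses the concavity of `huber` as a function of `q ^ 2`. -/
lemma huber_le_tangent (p q : ℝ) :
    huber p ≤ huber q + (p ^ 2 - q ^ 2) / (2 * √(1 + q ^ 2)) := by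
  have h1 := one_le_sqrt_one_add_sq q
  have h2 := sq_sqrt_one_add_sq q
  have h4 := sq_sqrt_one_add_sq p
  have h5 : (p ^ 2 - q ^ 2) / (2 * √(1 + q ^ 2))
      = (√(1 + p ^ 2) ^ 2 - √(1 + q ^ 2) ^ 2) / (2 * √(1 + q ^ 2)) := by
    rw [h2, h4]; ring
  rw [h5, ← sub_le_iff_le_add', le_div_iff₀ (by positivity)]
  unfold huber
  nlinarith [sq_nonneg (√(1 + p ^ 2) - √(1 + q ^ 2))]

lemma huber_le_sq_div_sqrt (q : ℝ) : huber q ≤ q ^ 2 / √(1 + q ^ 2) := by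
  have h1 := one_le_sqrt_one_add_sq q
  have h2 := sq_sqrt_one_add_sq q
  rw [le_div_iff₀ (by positivity)]
  unfold huber
  nlinarith

lemma huber_le_add_abs_sub (p q : ℝ) : huber p ≤ huber q + |p - q| := by
  have h1 := one_le_sqrt_one_add_sq q
  have h2 := sq_sqrt_one_add_sq q
  have h3 := one_le_sqrt_one_add_sq p
  have h4 := sq_sqrt_one_add_sq p
  have hq : |q| ≤ √(1 + q ^ 2) := Real.abs_le_sqrt (by linarith)
  unfold huber
  have : √(1 + p ^ 2) ≤ √(1 + q ^ 2) + |p - q| := by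
    rw [Real.sqrt_le_left (by positivity)]
    have h6 : q * (p - q) ≤ |q| * |p - q| := by rw [← abs_mul]; exact le_abs_self _
    have h7 : |p - q| ^ 2 = (p - q) ^ 2 := sq_abs _
    nlinarith [mul_le_mul_of_nonneg_right hq (abs_nonneg (p - q))]
  linarith

lemma sq_le_three_mul_huber {q : ℝ} (h0 : 0 ≤ q) (h1 : q ≤ 1) : q ^ 2 ≤ 3 * huber q := by
  have h2 := sq_sqrt_one_add_sq q
  have h3 := one_le_sqrt_one_add_sq q
  have : √(1 + q ^ 2) ≤ 2 := by
    rw [Real.sqrt_le_left (by norm_num)]; nlinarith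
  unfold huber
  nlinarith

lemma le_five_mul_huber {M q : ℝ} (hM : 1 ≤ M) (hq : 1 ≤ 2 * M * q) : q ≤ 5 * M * huber q := by
  have hq0 : 0 < q := by
    by_contra h
    nlinarith
  have : 1 + q / (5 * M) ≤ √(1 + q ^ 2) := by
    apply Real.le_sqrt_of_sq_le
    have h1 : q / (5 * M) * (5 * M) = q := by field_simp
    have h2 : 0 < q / (5 * M) := by positivity
    set t := q / (5 * M)
    nlinarith [mul_pos h2 hq0, mul_pos h2 h2, mul_le_mul_of_nonneg_left hM h2.le]
  unfold huber
  have h1 : q / (5 * M) * (5 * M) = q := by field_simp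
  have h2 : 0 < 5 * M := by positivity
  nlinarith

lemma huber_le_huber {p q : ℝ} (hp : 0 ≤ p) (h : p ≤ q) : huber p ≤ huber q := by
  unfold huber
  gcongr

lemma le_three_mul_huber {q : ℝ} (h1 : 1 ≤ q) : q ≤ 3 * huber q := by
  have : 1 + q / 3 ≤ √(1 + q ^ 2) := by
    apply Real.le_sqrt_of_sq_le
    nlinarith
  unfold huber
  linarith

/-! ### One step of a perturbed two-time-scale recursion -/

section OneStep

variable {X Z Y : Type*} [NormedAddCommGroup X] [InnerProductSpace ℝ X]
  [NormedAddCommGroup Z] [InnerProductSpace ℝ Z] [NormedAddCommGroup Y] [NormedSpace ℝ Y]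

/-- The deterministic data of a two-time-scale descent problem. The slow variable `x` is to
minimize `f`, whose gradient is `grad`; the fast variable `z` tracks `target x`. The observable
`D z` vanishes when `z` is on target, and the operators `P x` turn increments of this observable
into corrections of the slow variable. All regularity constants are bounded by `M`. -/
structure SlowFastData (f : X → ℝ) (grad : X → X) (target : X → Z) (P : X → Y →L[ℝ] X)
    (D : Z →L[ℝ] Y) (M : ℝ) : Prop where
  one_le : 1 ≤ M
  continuous : Continuous f
  nonneg : ∀ x, 0 ≤ f x
  descent : ∀ x y, f y ≤ f x + inner ℝ (grad x) (y - x) + M / 2 * ‖y - x‖ ^ 2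
  grad_lipschitz : ∀ x y, ‖grad x - grad y‖ ≤ M * ‖x - y‖
  target_lipschitz : ∀ x y, ‖target x - target y‖ ≤ M * ‖x - y‖
  norm_P_le : ∀ x, ‖P x‖ ≤ M
  P_lipschitz : ∀ x y, ‖P x - P y‖ ≤ M * ‖x - y‖
  norm_D_le : ‖D‖ ≤ M
  D_target : ∀ x, D (target x) = 0

/-- The bounds on a random increment `(Δx, Δz)` at the state `(x, z)`, in terms of a small
parameter `s`: the slow variable moves with step `b` of order `s ^ 5` and noise of order `s ^ 4`,
the fast variable with noise of order `s ^ 3`; `ξ` is the size of the noise. The last field says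
that, up to a small error, the mean increment of `x` is `-b • grad x` minus the image under
`β • P x` of the mean increment of the observable `D z`. -/
structure SlowFastStep {Ω : Type*} [MeasurableSpace Ω] (μ : Measure Ω) (grad : X → X)
    (target : X → Z) (P : X → Y →L[ℝ] X) (D : Z →L[ℝ] Y) (M c s b β : ℝ) (x : X) (z : Z)
    (Δx : Ω → X) (Δz : Ω → Z) (ξ : Ω → ℝ) : Prop where
  aesm_x : AEStronglyMeasurable Δx μ
  aesm_z : AEStronglyMeasurable Δz μ
  aesm_noise : AEStronglyMeasurable ξ μ
  noise_nonneg : ∀ ω, 0 ≤ ξ ω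
  integrable_noise : Integrable (fun ω => ξ ω ^ 2) μ
  noise_le : ∫ ω, ξ ω ^ 2 ∂μ ≤ 1
  slow : ∀ ω, ‖Δx ω + b • grad x‖ ≤ M * s ^ 4 * (‖z - target x‖ + ξ ω)
  fast : ∀ ω, ‖Δz ω‖ ≤ M * s ^ 3 * (‖z - target x‖ + ξ ω)
  drift : inner ℝ (z - target x) (∫ ω, Δz ω ∂μ) ≤
    -(c * s ^ 3 * ‖z - target x‖ ^ 2) + M * s ^ 4 * ‖z - target x‖
  mean : ‖(∫ ω, Δx ω ∂μ) + b • grad x + β • P x (D (∫ ω, Δz ω ∂μ))‖ ≤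
    M * (s ^ 5 * ‖z - target x‖ + s ^ 4 * huber ‖z - target x‖)

/-- The slow variable shifted by the displacement that the present deviation of the fast variable
from its target is expected to cause. -/
noncomputable def shifted (P : X → Y →L[ℝ] X) (D : Z →L[ℝ] Y) (β : ℝ) (x : X) (z : Z) : X :=
  x + β • P x (clip (D z))

variable {f : X → ℝ} {grad : X → X} {target : X → Z} {P : X → Y →L[ℝ] X} {D : Z →L[ℝ] Y}
  {M c s b β : ℝ} {x : X} {z : Z}
  {Ω : Type*} [MeasurableSpace Ω] {μ : Measure Ω} [IsProbabilityMeasure μ]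
  {Δx : Ω → X} {Δz : Ω → Z} {ξ : Ω → ℝ}

namespace SlowFastData

lemma continuous_of_lip {E F : Type*} [NormedAddCommGroup E] [NormedAddCommGroup F]
    {φ : E → F} (h : ∀ x y, ‖φ x - φ y‖ ≤ M * ‖x - y‖) : Continuous φ :=
  (LipschitzWith.of_dist_le' (K := M) fun x y => by
    simpa only [dist_eq_norm] using h x y).continuous

lemma continuous_grad (H : SlowFastData f grad target P D M) : Continuous grad :=
  continuous_of_lip H.grad_lipschitz

lemma continuous_target (H : SlowFastData f grad target P D M) : Continuous target :=
  continuous_of_lip H.target_lipschitz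

lemma continuous_P (H : SlowFastData f grad target P D M) : Continuous P :=
  continuous_of_lip H.P_lipschitz

lemma norm_D_apply_le (H : SlowFastData f grad target P D M) (x : X) (z : Z) :
    ‖D z‖ ≤ M * ‖z - target x‖ := by
  have : D z = D (z - target x) := by rw [map_sub, H.D_target, sub_zero]
  rw [this]
  exact D.le_of_opNorm_le H.norm_D_le _

end SlowFastData

namespace SlowFastStep

lemma integrable_noise' (S : SlowFastStep μ grad target P D M c s b β x z Δx Δz ξ) :
    Integrable ξ μ :=
  ((memLp_two_iff_integrable_sq S.aesm_noise).2 S.integrable_noise).integrable one_le_two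

lemma integral_noise_le (S : SlowFastStep μ grad target P D M c s b β x z Δx Δz ξ) :
    ∫ ω, ξ ω ∂μ ≤ 1 := by
  have h : ∫ ω, ξ ω ∂μ ≤ ∫ ω, (1 / 2 + ξ ω ^ 2 * (1 / 2)) ∂μ :=
    integral_mono S.integrable_noise' ((integrable_const _).add (S.integrable_noise.mul_const _))
      fun ω => by
        show ξ ω ≤ 1 / 2 + ξ ω ^ 2 * (1 / 2)
        nlinarith [sq_nonneg (ξ ω - 1)]
  rw [integral_add (integrable_const _) (S.integrable_noise.mul_const _),
    integral_mul_const] at h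
  have := S.noise_le
  simp at h
  linarith

/-- Integration of a pointwise bound that is a quadratic polynomial in the noise plus a mean
inner product with an integrable increment. -/
lemma integral_le (S : SlowFastStep μ grad target P D M c s b β x z Δx Δz ξ)
    {E : Type*} [NormedAddCommGroup E] [InnerProductSpace ℝ E] [CompleteSpace E]
    {φ : Ω → ℝ} {Δ : Ω → E} {v : E} {A₀ A₁ A₂ : ℝ} (hφ : AEStronglyMeasurable φ μ)
    (hφ0 : ∀ ω, 0 ≤ φ ω) (h1 : 0 ≤ A₁) (h2 : 0 ≤ A₂) (hΔ : Integrable Δ μ)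
    (h : ∀ ω, φ ω ≤ A₀ + A₁ * ξ ω + A₂ * ξ ω ^ 2 + inner ℝ v (Δ ω)) :
    Integrable φ μ ∧ ∫ ω, φ ω ∂μ ≤ A₀ + A₁ + A₂ + inner ℝ v (∫ ω, Δ ω ∂μ) := by
  have i1 : Integrable (fun ω => A₁ * ξ ω) μ := S.integrable_noise'.const_mul _
  have i2 : Integrable (fun ω => A₂ * ξ ω ^ 2) μ := S.integrable_noise.const_mul _
  have i3 : Integrable (fun ω => inner ℝ v (Δ ω)) μ := hΔ.const_inner v
  have i01 : Integrable (fun ω => A₀ + A₁ * ξ ω) μ := (integrable_const _).add i1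
  have i012 : Integrable (fun ω => A₀ + A₁ * ξ ω + A₂ * ξ ω ^ 2) μ := i01.add i2
  have i4 : Integrable (fun ω => A₀ + A₁ * ξ ω + A₂ * ξ ω ^ 2 + inner ℝ v (Δ ω)) μ := i012.add i3
  have hi : Integrable φ μ := i4.mono' hφ (.of_forall fun ω => by
    rw [Real.norm_of_nonneg (hφ0 ω)]; exact h ω)
  refine ⟨hi, (integral_mono hi i4 h).trans ?_⟩
  rw [integral_add i012 i3, integral_add i01 i2, integral_add (integrable_const _) i1,
    integral_const_mul, integral_const_mul, integral_inner hΔ]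
  have e1 := mul_le_mul_of_nonneg_left S.integral_noise_le h1
  have e2 := mul_le_mul_of_nonneg_left S.noise_le h2
  simp
  linarith

lemma integral_le' (S : SlowFastStep μ grad target P D M c s b β x z Δx Δz ξ)
    {φ : Ω → ℝ} {A₀ A₁ A₂ : ℝ} (hφ : AEStronglyMeasurable φ μ)
    (hφ0 : ∀ ω, 0 ≤ φ ω) (h1 : 0 ≤ A₁) (h2 : 0 ≤ A₂)
    (h : ∀ ω, φ ω ≤ A₀ + A₁ * ξ ω + A₂ * ξ ω ^ 2) :
    Integrable φ μ ∧ ∫ ω, φ ω ∂μ ≤ A₀ + A₁ + A₂ := by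
  have := S.integral_le (v := (0 : ℝ)) (Δ := fun _ => (0 : ℝ)) hφ hφ0 h1 h2
    (integrable_const _) (fun ω => by simpa using h ω)
  simpa using this

lemma integrable_x (S : SlowFastStep μ grad target P D M c s b β x z Δx Δz ξ) :
    Integrable Δx μ := by
  refine Integrable.mono' (g := fun ω => M * s ^ 4 * (‖z - target x‖ + ξ ω) + ‖b • grad x‖)
    ((((integrable_const _).add S.integrable_noise').const_mul _).add (integrable_const _))
    S.aesm_x (.of_forall fun ω => ?_)
  have h := norm_sub_le (Δx ω + b • grad x) (b • grad x)
  rw [add_sub_cancel_right] at h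
  linarith [S.slow ω]

lemma integrable_z (S : SlowFastStep μ grad target P D M c s b β x z Δx Δz ξ) :
    Integrable Δz μ :=
  Integrable.mono' (g := fun ω => M * s ^ 3 * (‖z - target x‖ + ξ ω))
    (((integrable_const _).add S.integrable_noise').const_mul _) S.aesm_z (.of_forall S.fast)

end SlowFastStep

end OneStep

section OneStepEstimates

variable {X Z Y : Type*} [NormedAddCommGroup X] [InnerProductSpace ℝ X]
  [NormedAddCommGroup Z] [InnerProductSpace ℝ Z] [NormedAddCommGroup Y] [NormedSpace ℝ Y]
  {f : X → ℝ} {grad : X → X} {target : X → Z} {P : X → Y →L[ℝ] X} {D : Z →L[ℝ] Y}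
  {M c s b β : ℝ} {x : X} {z : Z}
  {Ω : Type*} [MeasurableSpace Ω] {μ : Measure Ω}
  {Δx : Ω → X} {Δz : Ω → Z} {ξ : Ω → ℝ}

namespace SlowFastStep

lemma norm_x_le (S : SlowFastStep μ grad target P D M c s b β x z Δx Δz ξ)
    (hb0 : 0 ≤ b) (hb : b ≤ M * s ^ 5) (ω : Ω) :
    ‖Δx ω‖ ≤ M * s ^ 5 * ‖grad x‖ + M * s ^ 4 * (‖z - target x‖ + ξ ω) := by
  have h := norm_sub_le (Δx ω + b • grad x) (b • grad x)
  rw [add_sub_cancel_right, norm_smul, Real.norm_of_nonneg hb0] at h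
  have := mul_le_mul_of_nonneg_right hb (norm_nonneg (grad x))
  linarith [S.slow ω]

variable [IsProbabilityMeasure μ]

/-- Mean square tracking error when the target is moved by the noisy part of the increment of the
slow variable only. -/
lemma integral_sq_frozen_le [CompleteSpace X] [CompleteSpace Z]
    (H : SlowFastData f grad target P D M)
    (S : SlowFastStep μ grad target P D M c s b β x z Δx Δz ξ)
    (hc0 : 0 < c) (hc1 : c ≤ 1) (hs0 : 0 < s) (hs : 32 * M ^ 4 * s ≤ c) :
    Integrable (fun ω => ‖z + Δz ω - target (x + (Δx ω + b • grad x))‖ ^ 2) μ ∧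
    ∫ ω, ‖z + Δz ω - target (x + (Δx ω + b • grad x))‖ ^ 2 ∂μ ≤
      ‖z - target x‖ ^ 2 - c * s ^ 3 * ‖z - target x‖ ^ 2 + 24 * M ^ 4 / c * s ^ 5 := by
  have hM := H.one_le
  set q := ‖z - target x‖ with hq
  have hq0 : 0 ≤ q := norm_nonneg _
  have hM4 : 1 ≤ M ^ 4 := one_le_pow₀ hM
  have hs1 : s ≤ 1 := by nlinarith
  have key := S.integral_le (E := Z)
    (φ := fun ω => ‖z + Δz ω - target (x + (Δx ω + b • grad x))‖ ^ 2)
    (Δ := Δz) (v := (2 : ℝ) • (z - target x))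
    -- the square is expanded around `z - target x`: the cross term with `Δz` is the drift, the one
    -- with the motion of the target is of order `s ^ 4`, and the square of the increment of `s ^ 6`
    (A₀ := q ^ 2 + 2 * M ^ 2 * s ^ 4 * q ^ 2 + 8 * M ^ 4 * s ^ 6 * q ^ 2)
    (A₁ := 2 * M ^ 2 * s ^ 4 * q) (A₂ := 8 * M ^ 4 * s ^ 6) ?_ (fun ω => by positivity)
    (by positivity) (by positivity) S.integrable_z ?_
  · refine ⟨key.1, key.2.trans ?_⟩
    rw [inner_smul_left]
    have hd := S.drift
    rw [← hq] at hd
    simp only [conj_trivial]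
    have e1 : 2 * M ^ 2 * s ^ 4 * q ^ 2 ≤ c / 16 * (s ^ 3 * q ^ 2) := by
      have : 2 * M ^ 2 * s ≤ c / 16 := by
        have : M ^ 2 ≤ M ^ 4 := pow_le_pow_right₀ hM (by norm_num)
        nlinarith
      calc 2 * M ^ 2 * s ^ 4 * q ^ 2 = 2 * M ^ 2 * s * (s ^ 3 * q ^ 2) := by ring
        _ ≤ _ := by gcongr
    have e2 : 8 * M ^ 4 * s ^ 6 * q ^ 2 ≤ c / 4 * (s ^ 3 * q ^ 2) := by
      have : 8 * M ^ 4 * s ^ 3 ≤ c / 4 := by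
        have : s ^ 3 ≤ s := by
          calc s ^ 3 ≤ s ^ 1 := pow_le_pow_of_le_one hs0.le hs1 (by norm_num)
            _ = s := pow_one s
        nlinarith
      calc 8 * M ^ 4 * s ^ 6 * q ^ 2 = 8 * M ^ 4 * s ^ 3 * (s ^ 3 * q ^ 2) := by ring
        _ ≤ _ := by gcongr
    have e3 : 4 * M ^ 2 * s ^ 4 * q ≤ c / 4 * (s ^ 3 * q ^ 2) + 16 * M ^ 4 / c * s ^ 5 := by
      have h0 : 4 * M ^ 2 * s * q ≤ c / 4 * q ^ 2 + 16 * M ^ 4 / c * s ^ 2 := by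
        have : c / 4 * q ^ 2 + 16 * M ^ 4 / c * s ^ 2 - 4 * M ^ 2 * s * q
            = c / 4 * (q - 8 * M ^ 2 * s / c) ^ 2 := by field_simp; ring
        have h2 : 0 ≤ c / 4 * (q - 8 * M ^ 2 * s / c) ^ 2 := by positivity
        linarith
      calc 4 * M ^ 2 * s ^ 4 * q = s ^ 3 * (4 * M ^ 2 * s * q) := by ring
        _ ≤ s ^ 3 * (c / 4 * q ^ 2 + 16 * M ^ 4 / c * s ^ 2) := by gcongr
        _ = _ := by ring
    have e4 : 2 * (M * s ^ 4 * q) + 2 * M ^ 2 * s ^ 4 * q ≤ 4 * M ^ 2 * s ^ 4 * q := by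
      have : M ≤ M ^ 2 := by nlinarith
      have : 2 * (M * s ^ 4 * q) ≤ 2 * M ^ 2 * s ^ 4 * q := by
        calc 2 * (M * s ^ 4 * q) ≤ 2 * (M ^ 2 * s ^ 4 * q) := by gcongr
          _ = _ := by ring
      linarith
    have e5 : 8 * M ^ 4 * s ^ 6 ≤ 8 * M ^ 4 / c * s ^ 5 := by
      have h1 : 8 * M ^ 4 ≤ 8 * M ^ 4 / c := le_div_self (by positivity) hc0 hc1
      have h2 : s ^ 6 ≤ s ^ 5 := pow_le_pow_of_le_one hs0.le hs1 (by norm_num)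
      gcongr
    have e6 : 0 ≤ s ^ 3 * q ^ 2 := by positivity
    have e7 : 24 * M ^ 4 / c * s ^ 5 = 16 * M ^ 4 / c * s ^ 5 + 8 * M ^ 4 / c * s ^ 5 := by ring
    nlinarith
  · refine AEStronglyMeasurable.pow (AEStronglyMeasurable.norm ?_) 2
    exact (aestronglyMeasurable_const.add S.aesm_z).sub
      (H.continuous_target.comp_aestronglyMeasurable
        (aestronglyMeasurable_const.add (S.aesm_x.add aestronglyMeasurable_const)))
  · intro ω
    have hξ := S.noise_nonneg ω
    set ρ := ‖Δx ω + b • grad x‖ with hρ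
    set y := Δz ω - (target (x + (Δx ω + b • grad x)) - target x) with hy
    have hρ0 : 0 ≤ ρ := norm_nonneg _
    have hρle : ρ ≤ M * s ^ 4 * (q + ξ ω) := S.slow ω
    have hzle : ‖Δz ω‖ ≤ M * s ^ 3 * (q + ξ ω) := S.fast ω
    have ht : ‖target (x + (Δx ω + b • grad x)) - target x‖ ≤ M * ρ := by
      have := H.target_lipschitz (x + (Δx ω + b • grad x)) x
      rwa [add_sub_cancel_left] at this
    have hdec : z + Δz ω - target (x + (Δx ω + b • grad x)) = (z - target x) + y := by
      rw [hy]; abel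
    have hin : inner ℝ (z - target x) y ≤ inner ℝ (z - target x) (Δz ω) + q * (M * ρ) := by
      rw [hy, inner_sub_right]
      have h1 := abs_le.1 (abs_real_inner_le_norm (z - target x)
        (target (x + (Δx ω + b • grad x)) - target x))
      have h2 := mul_le_mul_of_nonneg_left ht hq0
      linarith [h1.1]
    have hyn : ‖y‖ ≤ ‖Δz ω‖ + M * ρ := (norm_sub_le _ _).trans (by linarith)
    have hyn2 : ‖y‖ ^ 2 ≤ 8 * M ^ 4 * s ^ 6 * (q ^ 2 + ξ ω ^ 2) := by
      have h1 : ‖y‖ ≤ 2 * M ^ 2 * s ^ 3 * (q + ξ ω) := by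
        have h2 : M * ρ ≤ M ^ 2 * s ^ 3 * (q + ξ ω) := by
          calc M * ρ ≤ M * (M * s ^ 4 * (q + ξ ω)) := by gcongr
            _ = M ^ 2 * s ^ 4 * (q + ξ ω) := by ring
            _ ≤ M ^ 2 * s ^ 3 * (q + ξ ω) := by
              have : s ^ 4 ≤ s ^ 3 := pow_le_pow_of_le_one hs0.le hs1 (by norm_num)
              gcongr
        have h3 : M * s ^ 3 * (q + ξ ω) ≤ M ^ 2 * s ^ 3 * (q + ξ ω) := by
          have : M ≤ M ^ 2 := by nlinarith
          gcongr
        linarith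
      calc ‖y‖ ^ 2 ≤ (2 * M ^ 2 * s ^ 3 * (q + ξ ω)) ^ 2 := by gcongr
        _ = 4 * M ^ 4 * s ^ 6 * (q + ξ ω) ^ 2 := by ring
        _ ≤ 4 * M ^ 4 * s ^ 6 * (2 * (q ^ 2 + ξ ω ^ 2)) := by gcongr; exact add_sq_le
        _ = _ := by ring
    have h5 : 2 * (q * (M * ρ)) ≤ 2 * M ^ 2 * s ^ 4 * q ^ 2 + 2 * M ^ 2 * s ^ 4 * q * ξ ω := by
      calc 2 * (q * (M * ρ)) ≤ 2 * (q * (M * (M * s ^ 4 * (q + ξ ω)))) := by gcongr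
        _ = _ := by ring
    show ‖z + Δz ω - target (x + (Δx ω + b • grad x))‖ ^ 2 ≤ _
    rw [hdec, norm_add_sq_real, inner_smul_left]
    simp only [conj_trivial]
    nlinarith

/-- The target moves by at most `M * b * ‖grad x‖` because of the mean gradient step. -/
lemma norm_sub_target_le (H : SlowFastData f grad target P D M)
    (hb0 : 0 ≤ b) (hb : b ≤ M * s ^ 5) (y : X) (w : Z) :
    |‖w - target y‖ - ‖w - target (y + b • grad x)‖| ≤ M ^ 2 * s ^ 5 * ‖grad x‖ := by
  have h1 := abs_norm_sub_norm_le (w - target y) (w - target (y + b • grad x))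
  rw [sub_sub_sub_cancel_left] at h1
  have h2 := H.target_lipschitz (y + b • grad x) y
  rw [add_sub_cancel_left, norm_smul, Real.norm_of_nonneg hb0] at h2
  have hM := H.one_le
  calc _ ≤ M * (b * ‖grad x‖) := h1.trans h2
    _ ≤ M * (M * s ^ 5 * ‖grad x‖) := by gcongr
    _ = _ := by ring

/-- The mean square tracking error contracts at rate `c * s ^ 3 / 2`. -/
lemma integral_sq_le [CompleteSpace X] [CompleteSpace Z]
    (H : SlowFastData f grad target P D M)
    (S : SlowFastStep μ grad target P D M c s b β x z Δx Δz ξ)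
    (hc0 : 0 < c) (hc1 : c ≤ 1) (hs0 : 0 < s) (hs : 32 * M ^ 4 * s ≤ c)
    (hb0 : 0 ≤ b) (hb : b ≤ M * s ^ 5) :
    Integrable (fun ω => ‖z + Δz ω - target (x + Δx ω)‖ ^ 2) μ ∧
    ∫ ω, ‖z + Δz ω - target (x + Δx ω)‖ ^ 2 ∂μ ≤
      ‖z - target x‖ ^ 2 - c / 2 * s ^ 3 * ‖z - target x‖ ^ 2 + 48 * M ^ 4 / c * s ^ 5
        + 48 * M ^ 4 / c * s ^ 7 * ‖grad x‖ ^ 2 := by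
  obtain ⟨hi, hle⟩ := S.integral_sq_frozen_le H hc0 hc1 hs0 hs
  have hM := H.one_le
  have hM4 : 1 ≤ M ^ 4 := one_le_pow₀ hM
  have hs1 : s ≤ 1 := by nlinarith
  set q := ‖z - target x‖ with hq
  set g := ‖grad x‖ with hg
  -- half of the contraction pays for the motion of the target caused by the mean gradient step
  set τ := c / 2 * s ^ 3 with hτ
  have hτ0 : 0 < τ := by positivity
  have hτ1 : τ ≤ 1 := by
    have : s ^ 3 ≤ 1 := pow_le_one₀ hs0.le hs1
    nlinarith
  set φ := fun ω => ‖z + Δz ω - target (x + (Δx ω + b • grad x))‖ ^ 2 with hφ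
  have hpt : ∀ ω, ‖z + Δz ω - target (x + Δx ω)‖ ^ 2 ≤
      (1 + τ) * φ ω + 4 * M ^ 4 / c * s ^ 7 * g ^ 2 := by
    intro ω
    have h1 := norm_sub_target_le (x := x) H hb0 hb (x + Δx ω) (z + Δz ω)
    rw [add_assoc] at h1
    set r := ‖z + Δz ω - target (x + (Δx ω + b • grad x))‖ with hr
    have h2 : ‖z + Δz ω - target (x + Δx ω)‖ ≤ r + M ^ 2 * s ^ 5 * g := by
      linarith [(abs_le.1 h1).2]
    set t := M ^ 2 * s ^ 5 * g with ht
    have ht0 : 0 ≤ t := by positivity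
    have hr0 : 0 ≤ r := norm_nonneg _
    have h3 : 2 * r * t ≤ τ * r ^ 2 + t ^ 2 / τ := by
      have : τ * r ^ 2 + t ^ 2 / τ - 2 * r * t = τ * (r - t / τ) ^ 2 := by field_simp; ring
      have h4 : 0 ≤ τ * (r - t / τ) ^ 2 := by positivity
      linarith
    have h4 : t ^ 2 ≤ t ^ 2 / τ := le_div_self (by positivity) hτ0 hτ1
    have h5 : t ^ 2 / τ = 2 * M ^ 4 / c * s ^ 7 * g ^ 2 := by
      rw [ht, hτ]; field_simp
    calc ‖z + Δz ω - target (x + Δx ω)‖ ^ 2 ≤ (r + t) ^ 2 := by gcongr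
      _ = r ^ 2 + 2 * r * t + t ^ 2 := by ring
      _ ≤ (1 + τ) * r ^ 2 + 2 * (t ^ 2 / τ) := by linarith
      _ = _ := by rw [h5]; ring
  have i1 : Integrable (fun ω => (1 + τ) * φ ω + 4 * M ^ 4 / c * s ^ 7 * g ^ 2) μ :=
    (hi.const_mul _).add (integrable_const _)
  have hi' : Integrable (fun ω => ‖z + Δz ω - target (x + Δx ω)‖ ^ 2) μ := by
    refine i1.mono' ?_ (.of_forall fun ω => ?_)
    · exact AEStronglyMeasurable.pow (AEStronglyMeasurable.norm
        ((aestronglyMeasurable_const.add S.aesm_z).sub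
          (H.continuous_target.comp_aestronglyMeasurable
            (aestronglyMeasurable_const.add S.aesm_x)))) 2
    · rw [Real.norm_of_nonneg (by positivity)]; exact hpt ω
  refine ⟨hi', (integral_mono hi' i1 hpt).trans ?_⟩
  rw [integral_add (hi.const_mul _) (integrable_const _), integral_const_mul]
  simp only [integral_const, probReal_univ, one_smul]
  have e1 : (1 + τ) * ∫ ω, φ ω ∂μ ≤
      (1 + τ) * (q ^ 2 - 2 * τ * q ^ 2 + 24 * M ^ 4 / c * s ^ 5) := by
    refine mul_le_mul_of_nonneg_left (hle.trans_eq ?_) (by positivity)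
    rw [hτ]; ring
  have e2 : (1 + τ) * (q ^ 2 - 2 * τ * q ^ 2) ≤ q ^ 2 - τ * q ^ 2 := by
    have : 0 ≤ τ ^ 2 * q ^ 2 := by positivity
    nlinarith
  have e3 : (1 + τ) * (24 * M ^ 4 / c * s ^ 5) ≤ 2 * (24 * M ^ 4 / c * s ^ 5) := by
    gcongr; linarith
  have e4 : 4 * M ^ 4 / c * s ^ 7 * g ^ 2 ≤ 48 * M ^ 4 / c * s ^ 7 * g ^ 2 := by
    gcongr; norm_num
  have e5 : 48 * M ^ 4 / c * s ^ 5 = 2 * (24 * M ^ 4 / c * s ^ 5) := by ring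
  linarith

/-- The Huber tracking error contracts at the same rate. The mean gradient step enters linearly,
because `huber` is Lipschitz; the remaining motion is controlled by its mean square, because
`huber` is a concave function of the square. -/
lemma integral_huber_le [CompleteSpace X] [CompleteSpace Z]
    (H : SlowFastData f grad target P D M)
    (S : SlowFastStep μ grad target P D M c s b β x z Δx Δz ξ)
    (hc0 : 0 < c) (hc1 : c ≤ 1) (hs0 : 0 < s) (hs : 32 * M ^ 4 * s ≤ c)
    (hb0 : 0 ≤ b) (hb : b ≤ M * s ^ 5) :
    Integrable (fun ω => huber ‖z + Δz ω - target (x + Δx ω)‖) μ ∧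
    ∫ ω, huber ‖z + Δz ω - target (x + Δx ω)‖ ∂μ ≤
      huber ‖z - target x‖ - c / 2 * s ^ 3 * huber ‖z - target x‖ + 48 * M ^ 4 / c * s ^ 5
        + 48 * M ^ 4 / c * s ^ 5 * ‖grad x‖ := by
  obtain ⟨hi, hle⟩ := S.integral_sq_frozen_le H hc0 hc1 hs0 hs
  have hM := H.one_le
  set q := ‖z - target x‖ with hq
  set g := ‖grad x‖ with hg
  set φ := fun ω => ‖z + Δz ω - target (x + (Δx ω + b • grad x))‖ ^ 2 with hφ
  have h1S := one_le_sqrt_one_add_sq q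
  set R := √(1 + q ^ 2) with hR
  have hpt : ∀ ω, huber ‖z + Δz ω - target (x + Δx ω)‖ ≤
      (huber q - q ^ 2 / (2 * R) + M ^ 2 * s ^ 5 * g) + (2 * R)⁻¹ * φ ω := by
    intro ω
    have h1 := norm_sub_target_le (x := x) H hb0 hb (x + Δx ω) (z + Δz ω)
    rw [add_assoc] at h1
    have h2 := huber_le_add_abs_sub ‖z + Δz ω - target (x + Δx ω)‖
      ‖z + Δz ω - target (x + (Δx ω + b • grad x))‖
    have h3 := huber_le_tangent ‖z + Δz ω - target (x + (Δx ω + b • grad x))‖ q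
    have h4 : (φ ω - q ^ 2) / (2 * R) = (2 * R)⁻¹ * φ ω - q ^ 2 / (2 * R) := by
      field_simp
    have h5 : (‖z + Δz ω - target (x + (Δx ω + b • grad x))‖ ^ 2 - q ^ 2) / (2 * R) =
      (φ ω - q ^ 2) / (2 * R) := rfl
    linarith
  have i1 : Integrable (fun ω => (huber q - q ^ 2 / (2 * R) + M ^ 2 * s ^ 5 * g)
      + (2 * R)⁻¹ * φ ω) μ := (integrable_const _).add (hi.const_mul _)
  have hi' : Integrable (fun ω => huber ‖z + Δz ω - target (x + Δx ω)‖) μ := by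
    refine i1.mono' ?_ (.of_forall fun ω => ?_)
    · exact continuous_huber.comp_aestronglyMeasurable (AEStronglyMeasurable.norm
        ((aestronglyMeasurable_const.add S.aesm_z).sub
          (H.continuous_target.comp_aestronglyMeasurable
            (aestronglyMeasurable_const.add S.aesm_x))))
    · rw [Real.norm_of_nonneg (huber_nonneg _)]; exact hpt ω
  refine ⟨hi', (integral_mono hi' i1 hpt).trans ?_⟩
  rw [integral_add (integrable_const _) (hi.const_mul _), integral_const_mul]
  simp only [integral_const, probReal_univ, one_smul]
  have e1 : (2 * R)⁻¹ * ∫ ω, φ ω ∂μ ≤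
      (2 * R)⁻¹ * (q ^ 2 - c * s ^ 3 * q ^ 2 + 24 * M ^ 4 / c * s ^ 5) :=
    mul_le_mul_of_nonneg_left hle (by positivity)
  have e2 : (2 * R)⁻¹ * (q ^ 2 - c * s ^ 3 * q ^ 2 + 24 * M ^ 4 / c * s ^ 5) =
      q ^ 2 / (2 * R) - c / 2 * s ^ 3 * (q ^ 2 / R) + (2 * R)⁻¹ * (24 * M ^ 4 / c * s ^ 5) := by
    field_simp
  have e3 : (2 * R)⁻¹ * (24 * M ^ 4 / c * s ^ 5) ≤ 1 * (24 * M ^ 4 / c * s ^ 5) := by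
    gcongr
    exact inv_le_one_of_one_le₀ (by linarith)
  have e4 : c / 2 * s ^ 3 * huber q ≤ c / 2 * s ^ 3 * (q ^ 2 / R) := by
    gcongr; exact huber_le_sq_div_sqrt q
  have e5 : M ^ 2 * s ^ 5 * g ≤ 48 * M ^ 4 / c * s ^ 5 * g := by
    have h1 : M ^ 2 ≤ M ^ 4 := pow_le_pow_right₀ hM (by norm_num)
    have h2 : 48 * M ^ 4 ≤ 48 * M ^ 4 / c := le_div_self (by positivity) hc0 hc1
    have h3 : M ^ 2 ≤ 48 * M ^ 4 / c := by nlinarith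
    gcongr
  have e6 : 1 * (24 * M ^ 4 / c * s ^ 5) ≤ 48 * M ^ 4 / c * s ^ 5 := by
    rw [one_mul]; gcongr; norm_num
  linarith

end SlowFastStep

end OneStepEstimates

section OneStepDescent

variable {X Z Y : Type*} [NormedAddCommGroup X] [InnerProductSpace ℝ X]
  [NormedAddCommGroup Z] [InnerProductSpace ℝ Z] [NormedAddCommGroup Y] [NormedSpace ℝ Y]
  {f : X → ℝ} {grad : X → X} {target : X → Z} {P : X → Y →L[ℝ] X} {D : Z →L[ℝ] Y}
  {M c s b β : ℝ} {x : X} {z : Z}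
  {Ω : Type*} [MeasurableSpace Ω] {μ : Measure Ω} [IsProbabilityMeasure μ]
  {Δx : Ω → X} {Δz : Ω → Z} {ξ : Ω → ℝ}

namespace SlowFastStep

/-- The tracking error after the step, weighted with the length of the slow increment, is of higher
order. This bounds the effect of the change of the weight in the Lyapunov function. -/
lemma integral_norm_mul_huber_le [CompleteSpace X] [CompleteSpace Z]
    (H : SlowFastData f grad target P D M)
    (S : SlowFastStep μ grad target P D M c s b β x z Δx Δz ξ)
    (hs0 : 0 < s) (hs1 : s ≤ 1) (hb0 : 0 ≤ b) (hb : b ≤ M * s ^ 5) :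
    Integrable (fun ω => ‖Δx ω‖ * huber ‖z + Δz ω - target (x + Δx ω)‖) μ ∧
    ∫ ω, ‖Δx ω‖ * huber ‖z + Δz ω - target (x + Δx ω)‖ ∂μ ≤
      10 * M ^ 3 * (s ^ 5 * ‖grad x‖ * ‖z - target x‖ + s ^ 4 * ‖z - target x‖ ^ 2
        + s ^ 9 * ‖grad x‖ ^ 2 + s ^ 7) := by
  have hM := H.one_le
  set q := ‖z - target x‖ with hq
  set g := ‖grad x‖ with hg
  have hq0 : 0 ≤ q := norm_nonneg _
  have hg0 : 0 ≤ g := norm_nonneg _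
  have hh0 := huber_nonneg q
  have hhq := huber_le_self hq0
  have hhQ := huber_le_sq q
  have key := S.integral_le'
    (φ := fun ω => ‖Δx ω‖ * huber ‖z + Δz ω - target (x + Δx ω)‖)
    (A₀ := M * s ^ 5 * g * huber q + M * s ^ 4 * q * huber q + M ^ 3 * (3 * s ^ 9 * g ^ 2)
      + 8 * M ^ 3 * s ^ 7 * q ^ 2)
    (A₁ := M * s ^ 4 * huber q) (A₂ := 8 * M ^ 3 * s ^ 7) ?_
    (fun ω => mul_nonneg (norm_nonneg _) (huber_nonneg _)) (by positivity) (by positivity) ?_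
  · refine ⟨key.1, key.2.trans ?_⟩
    have hM3 : M ≤ M ^ 3 := by
      calc M = M ^ 1 := (pow_one M).symm
        _ ≤ M ^ 3 := pow_le_pow_right₀ hM (by norm_num)
    have e1 : M * s ^ 5 * g * huber q ≤ M ^ 3 * (s ^ 5 * g * q) := by
      calc M * s ^ 5 * g * huber q = M * (s ^ 5 * g * huber q) := by ring
        _ ≤ _ := by gcongr
    have e2 : M * s ^ 4 * q * huber q ≤ M ^ 3 * (s ^ 4 * q ^ 2) := by
      calc M * s ^ 4 * q * huber q ≤ M * s ^ 4 * q * q := by gcongr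
        _ = M * (s ^ 4 * q ^ 2) := by ring
        _ ≤ _ := by gcongr
    have e3 : M * s ^ 4 * huber q ≤ M ^ 3 * (s ^ 4 * q ^ 2) := by
      calc M * s ^ 4 * huber q ≤ M * s ^ 4 * q ^ 2 := by gcongr
        _ = M * (s ^ 4 * q ^ 2) := by ring
        _ ≤ _ := by gcongr
    have e4 : 8 * M ^ 3 * s ^ 7 * q ^ 2 ≤ 8 * (M ^ 3 * (s ^ 4 * q ^ 2)) := by
      have : s ^ 7 ≤ s ^ 4 := pow_le_pow_of_le_one hs0.le hs1 (by norm_num)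
      calc 8 * M ^ 3 * s ^ 7 * q ^ 2 ≤ 8 * M ^ 3 * s ^ 4 * q ^ 2 := by gcongr
        _ = _ := by ring
    have p1 : 0 ≤ M ^ 3 * (s ^ 5 * g * q) := by positivity
    have p2 : 0 ≤ M ^ 3 * (s ^ 9 * g ^ 2) := by positivity
    have p3 : 0 ≤ M ^ 3 * s ^ 7 := by positivity
    nlinarith
  · exact S.aesm_x.norm.mul (continuous_huber.comp_aestronglyMeasurable
      (AEStronglyMeasurable.norm ((aestronglyMeasurable_const.add S.aesm_z).sub
        (H.continuous_target.comp_aestronglyMeasurable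
          (aestronglyMeasurable_const.add S.aesm_x)))))
  · intro ω
    have hξ := S.noise_nonneg ω
    have hx := S.norm_x_le hb0 hb ω
    have hz := S.fast ω
    rw [← hq] at hx hz
    rw [← hg] at hx
    set p := ‖Δx ω‖ with hp
    set ζ := ‖Δz ω‖ with hζ
    have hp0 : 0 ≤ p := norm_nonneg _
    have hζ0 : 0 ≤ ζ := norm_nonneg _
    set t := q + ξ ω with ht
    have ht0 : 0 ≤ t := by positivity
    have hh : huber ‖z + Δz ω - target (x + Δx ω)‖ ≤ huber q + (ζ + M * p) := by
      have h1 := huber_le_add_abs_sub ‖z + Δz ω - target (x + Δx ω)‖ q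
      have h2 := abs_norm_sub_norm_le (z + Δz ω - target (x + Δx ω)) (z - target x)
      have h3 : z + Δz ω - target (x + Δx ω) - (z - target x)
        = Δz ω - (target (x + Δx ω) - target x) := by abel
      have h4 := H.target_lipschitz (x + Δx ω) x
      rw [add_sub_cancel_left] at h4
      rw [h3] at h2
      have h5 := norm_sub_le (Δz ω) (target (x + Δx ω) - target x)
      linarith
    have e1 : p * huber q ≤ M * s ^ 5 * g * huber q + M * s ^ 4 * q * huber q
        + M * s ^ 4 * huber q * ξ ω := by
      calc p * huber q ≤ (M * s ^ 5 * g + M * s ^ 4 * t) * huber q := by gcongr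
        _ = _ := by rw [ht]; ring
    have e2 : p * (ζ + M * p) ≤ M ^ 3 * (3 * s ^ 9 * g ^ 2 + 4 * s ^ 7 * t ^ 2) := by
      have a1 : p ≤ M * s ^ 4 * (s * g + t) := by linarith [hx]
      have a2 : ζ + M * p ≤ M ^ 2 * s ^ 3 * (s * g + 2 * t) := by
        have b1 : M * s ^ 3 * t ≤ M ^ 2 * s ^ 3 * t := by
          have : M ≤ M ^ 2 := by nlinarith
          gcongr
        have b2 : M * p ≤ M ^ 2 * s ^ 3 * (s * g + t) := by
          calc M * p ≤ M * (M * s ^ 4 * (s * g + t)) := by gcongr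
            _ = M ^ 2 * s ^ 4 * (s * g + t) := by ring
            _ ≤ _ := by
              have : s ^ 4 ≤ s ^ 3 := pow_le_pow_of_le_one hs0.le hs1 (by norm_num)
              gcongr
        linarith
      calc p * (ζ + M * p) ≤ (M * s ^ 4 * (s * g + t)) * (M ^ 2 * s ^ 3 * (s * g + 2 * t)) := by
            gcongr
        _ = M ^ 3 * (s ^ 7 * ((s * g + t) * (s * g + 2 * t))) := by ring
        _ ≤ M ^ 3 * (s ^ 7 * (3 * (s * g) ^ 2 + 4 * t ^ 2)) := by
          gcongr
          nlinarith [sq_nonneg (s * g - t), sq_nonneg t, sq_nonneg (s * g)]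
        _ = _ := by ring
    have e3 : t ^ 2 ≤ 2 * (q ^ 2 + ξ ω ^ 2) := add_sq_le
    have e4 : M ^ 3 * (4 * s ^ 7 * t ^ 2) ≤ M ^ 3 * (4 * s ^ 7 * (2 * (q ^ 2 + ξ ω ^ 2))) := by
      gcongr
    have e5 : p * huber ‖z + Δz ω - target (x + Δx ω)‖ ≤ p * (huber q + (ζ + M * p)) := by
      gcongr
    show p * huber ‖z + Δz ω - target (x + Δx ω)‖ ≤ _
    nlinarith

/-- The clipped observable moves, on average, like the observable itself. When the tracking error
is small the two increments differ only after a large jump, which the variance of the noise makes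
rare; when it is large the difference is charged to the tracking error. -/
lemma integral_clip_error_le (H : SlowFastData f grad target P D M)
    (S : SlowFastStep μ grad target P D M c s b β x z Δx Δz ξ)
    (hs0 : 0 < s) :
    Integrable (fun ω => ‖clip (D (z + Δz ω)) - clip (D z) - D (Δz ω)‖) μ ∧
    ∫ ω, ‖clip (D (z + Δz ω)) - clip (D z) - D (Δz ω)‖ ∂μ ≤
      45 * M ^ 4 * s ^ 3 * huber ‖z - target x‖ + 24 * M ^ 4 * s ^ 6 := by
  have hM := H.one_le
  set q := ‖z - target x‖ with hq
  have hq0 : 0 ≤ q := norm_nonneg _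
  have hh0 := huber_nonneg q
  have hm : AEStronglyMeasurable
      (fun ω => ‖clip (D (z + Δz ω)) - clip (D z) - D (Δz ω)‖) μ :=
    (((continuous_clip.comp (D.continuous.comp (by fun_prop :
      Continuous fun y : Z => z + y))).comp_aestronglyMeasurable S.aesm_z).sub
      aestronglyMeasurable_const |>.sub (D.continuous.comp_aestronglyMeasurable S.aesm_z)).norm
  have hD : ∀ ω, ‖D (Δz ω)‖ ≤ M * ‖Δz ω‖ := fun ω => D.le_of_opNorm_le H.norm_D_le _
  have hall : ∀ ω, ‖clip (D (z + Δz ω)) - clip (D z) - D (Δz ω)‖ ≤ 3 * M * ‖Δz ω‖ := by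
    intro ω
    have h1 := norm_clip_sub_clip_le (D (z + Δz ω)) (D z)
    rw [map_add, add_sub_cancel_left] at h1
    have h2 := norm_sub_le (clip (D (z + Δz ω)) - clip (D z)) (D (Δz ω))
    rw [map_add] at h2 ⊢
    linarith [hD ω]
  -- far from the target one pays `‖Δz‖`, close to it at most `‖Δz‖ ^ 2`
  rcases le_or_gt 1 (2 * M * q) with hbig | hsmall
  · have key := S.integral_le' (A₀ := 3 * M ^ 2 * s ^ 3 * q) (A₁ := 3 * M ^ 2 * s ^ 3) (A₂ := 0)
      hm (fun ω => norm_nonneg _) (by positivity) le_rfl ?_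
    · refine ⟨key.1, key.2.trans ?_⟩
      have h5 := le_five_mul_huber hM hbig
      calc 3 * M ^ 2 * s ^ 3 * q + 3 * M ^ 2 * s ^ 3 + 0
          ≤ 3 * M ^ 2 * s ^ 3 * (M * q) + 3 * M ^ 2 * s ^ 3 * (2 * M * q) := by
            have : q ≤ M * q := le_mul_of_one_le_left hq0 hM
            have h6 : 3 * M ^ 2 * s ^ 3 * 1 ≤ 3 * M ^ 2 * s ^ 3 * (2 * M * q) := by gcongr
            have h7 : 3 * M ^ 2 * s ^ 3 * q ≤ 3 * M ^ 2 * s ^ 3 * (M * q) := by gcongr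
            linarith
        _ = 9 * M ^ 3 * s ^ 3 * q := by ring
        _ ≤ 9 * M ^ 3 * s ^ 3 * (5 * M * huber q) := by gcongr
        _ = 45 * M ^ 4 * s ^ 3 * huber q := by ring
        _ ≤ _ := by linarith [show 0 ≤ 24 * M ^ 4 * s ^ 6 by positivity]
    · intro ω
      calc _ ≤ 3 * M * ‖Δz ω‖ := hall ω
        _ ≤ 3 * M * (M * s ^ 3 * (q + ξ ω)) := by gcongr; exact S.fast ω
        _ = _ := by ring
  · have hq1 : q ≤ 1 := by nlinarith
    have key := S.integral_le' (A₀ := 12 * M ^ 4 * s ^ 6 * q ^ 2) (A₁ := 0)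
      (A₂ := 12 * M ^ 4 * s ^ 6)
      hm (fun ω => norm_nonneg _) le_rfl (by positivity) ?_
    · refine ⟨key.1, key.2.trans ?_⟩
      have h1 : 12 * M ^ 4 * s ^ 6 * q ^ 2 ≤ 12 * M ^ 4 * s ^ 6 * 1 := by
        gcongr; exact pow_le_one₀ hq0 hq1
      linarith [show 0 ≤ 45 * M ^ 4 * s ^ 3 * huber q by positivity]
    · intro ω
      have hξ := S.noise_nonneg ω
      have hv : ‖D z‖ ≤ 1 / 2 := (H.norm_D_apply_le x z).trans (by linarith)
      -- `clip` is the identity at both points unless the observable makes a jump of fixed length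
      by_cases hjump : ‖D (Δz ω)‖ ≤ 1 / 2
      · have h1 : ‖D (z + Δz ω)‖ ≤ 1 := by
          rw [map_add]; exact (norm_add_le _ _).trans (by linarith)
        rw [clip_eq_self h1, clip_eq_self (by linarith), map_add, add_sub_cancel_left, sub_self,
          norm_zero]
        positivity
      · push Not at hjump
        have h1 : 1 ≤ 2 * (M * ‖Δz ω‖) := by linarith [hD ω]
        calc _ ≤ 3 * M * ‖Δz ω‖ := hall ω
          _ = 3 * (M * ‖Δz ω‖) * 1 := by ring
          _ ≤ 3 * (M * ‖Δz ω‖) * (2 * (M * ‖Δz ω‖)) := by gcongr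
          _ = 6 * M ^ 2 * ‖Δz ω‖ ^ 2 := by ring
          _ ≤ 6 * M ^ 2 * (M * s ^ 3 * (q + ξ ω)) ^ 2 := by gcongr; exact S.fast ω
          _ = 6 * M ^ 4 * s ^ 6 * (q + ξ ω) ^ 2 := by ring
          _ ≤ 6 * M ^ 4 * s ^ 6 * (2 * (q ^ 2 + ξ ω ^ 2)) := by gcongr; exact add_sq_le
          _ = _ := by ring

lemma integral_norm_mul_clip_le (H : SlowFastData f grad target P D M)
    (S : SlowFastStep μ grad target P D M c s b β x z Δx Δz ξ)
    (hs0 : 0 < s) (hs1 : s ≤ 1) (hb0 : 0 ≤ b) (hb : b ≤ M * s ^ 5) :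
    Integrable (fun ω => ‖Δx ω‖ * ‖clip (D (z + Δz ω))‖) μ ∧
    ∫ ω, ‖Δx ω‖ * ‖clip (D (z + Δz ω))‖ ∂μ ≤
      3 * M ^ 3 * (s ^ 5 * ‖grad x‖ + s ^ 4 * ‖z - target x‖ + s ^ 7) := by
  have hM := H.one_le
  set q := ‖z - target x‖ with hq
  set g := ‖grad x‖ with hg
  have hq0 : 0 ≤ q := norm_nonneg _
  have hg0 : 0 ≤ g := norm_nonneg _
  have hm : AEStronglyMeasurable (fun ω => ‖Δx ω‖ * ‖clip (D (z + Δz ω))‖) μ :=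
    S.aesm_x.norm.mul ((continuous_clip.comp (D.continuous.comp (by fun_prop :
      Continuous fun y : Z => z + y))).comp_aestronglyMeasurable S.aesm_z).norm
  have hM3 : M ≤ M ^ 3 := by
    calc M = M ^ 1 := (pow_one M).symm
      _ ≤ M ^ 3 := pow_le_pow_right₀ hM (by norm_num)
  have hM2 : M ^ 2 ≤ M ^ 3 := pow_le_pow_right₀ hM (by norm_num)
  have key := S.integral_le' (A₀ := M * s ^ 5 * g + M * s ^ 4 * q)
    (A₁ := M ^ 2 * s ^ 4 * q + M ^ 3 * s ^ 7 * q) (A₂ := M ^ 3 * s ^ 7)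
    hm (fun ω => by positivity) (by positivity) (by positivity) ?_
  · refine ⟨key.1, key.2.trans ?_⟩
    have e1 : M * s ^ 5 * g ≤ M ^ 3 * (s ^ 5 * g) := by
      calc M * s ^ 5 * g = M * (s ^ 5 * g) := by ring
        _ ≤ _ := by gcongr
    have e2 : M * s ^ 4 * q ≤ M ^ 3 * (s ^ 4 * q) := by
      calc M * s ^ 4 * q = M * (s ^ 4 * q) := by ring
        _ ≤ _ := by gcongr
    have e3 : M ^ 2 * s ^ 4 * q ≤ M ^ 3 * (s ^ 4 * q) := by
      calc M ^ 2 * s ^ 4 * q = M ^ 2 * (s ^ 4 * q) := by ring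
        _ ≤ _ := by gcongr
    have e4 : M ^ 3 * s ^ 7 * q ≤ M ^ 3 * (s ^ 4 * q) := by
      have : s ^ 7 ≤ s ^ 4 := pow_le_pow_of_le_one hs0.le hs1 (by norm_num)
      calc M ^ 3 * s ^ 7 * q = M ^ 3 * (s ^ 7 * q) := by ring
        _ ≤ _ := by gcongr
    have p1 : 0 ≤ M ^ 3 * (s ^ 5 * g) := by positivity
    have p2 : 0 ≤ M ^ 3 * s ^ 7 := by positivity
    linarith
  · intro ω
    have hξ := S.noise_nonneg ω
    have hx := S.norm_x_le hb0 hb ω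
    rw [← hq, ← hg] at hx
    have h1 := norm_clip_le_one (D (z + Δz ω))
    have h2 : ‖clip (D (z + Δz ω))‖ ≤ M * q + M * (M * s ^ 3 * (q + ξ ω)) := by
      refine (norm_clip_le _).trans ?_
      rw [map_add]
      refine (norm_add_le _ _).trans (add_le_add (H.norm_D_apply_le x z) ?_)
      refine (D.le_of_opNorm_le H.norm_D_le _).trans ?_
      gcongr
      exact S.fast ω
    set k := ‖clip (D (z + Δz ω))‖ with hk
    have hk0 : 0 ≤ k := norm_nonneg _
    calc ‖Δx ω‖ * k ≤ (M * s ^ 5 * g + M * s ^ 4 * (q + ξ ω)) * k := by gcongr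
      _ = (M * s ^ 5 * g + M * s ^ 4 * q) * k + M * s ^ 4 * ξ ω * k := by ring
      _ ≤ (M * s ^ 5 * g + M * s ^ 4 * q) * 1
          + M * s ^ 4 * ξ ω * (M * q + M * (M * s ^ 3 * (q + ξ ω))) := by gcongr
      _ = _ := by ring

end SlowFastStep

end OneStepDescent

section Lyapunov

variable {X Z Y : Type*} [NormedAddCommGroup X] [InnerProductSpace ℝ X]
  [NormedAddCommGroup Z] [InnerProductSpace ℝ Z] [NormedAddCommGroup Y] [NormedSpace ℝ Y]
  {f : X → ℝ} {grad : X → X} {target : X → Z} {P : X → Y →L[ℝ] X} {D : Z →L[ℝ] Y}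
  {M c s b β : ℝ} {x : X} {z : Z}
  {Ω : Type*} [MeasurableSpace Ω] {μ : Measure Ω}
  {Δx : Ω → X} {Δz : Ω → Z} {ξ : Ω → ℝ}

namespace SlowFastData

lemma continuous_shifted (H : SlowFastData f grad target P D M) (β : ℝ) :
    Continuous fun p : X × Z => shifted P D β p.1 p.2 := by
  unfold shifted
  refine continuous_fst.add (Continuous.const_smul ?_ β)
  exact (H.continuous_P.comp continuous_fst).clm_apply
    (continuous_clip.comp (D.continuous.comp continuous_snd))

end SlowFastData

namespace SlowFastStep

/-- Pointwise bound on the increment of the shifted slow variable. -/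
lemma sq_norm_shifted_sub_le
    (H : SlowFastData f grad target P D M)
    (S : SlowFastStep μ grad target P D M c s b β x z Δx Δz ξ)
    (hs0 : 0 < s) (hs1 : s ≤ 1) (hb0 : 0 ≤ b) (hb : b ≤ M * s ^ 5) (hβ0 : 0 ≤ β)
    (hβ : β ≤ M * s) (ω : Ω) :
    ‖shifted P D β (x + Δx ω) (z + Δz ω) - shifted P D β x z‖ ^ 2 ≤
      8 * M ^ 6 * s ^ 10 * ‖grad x‖ ^ 2
        + 64 * M ^ 8 * s ^ 8 * (‖z - target x‖ ^ 2 + ξ ω ^ 2) := by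
  have hM := H.one_le
  set q := ‖z - target x‖ with hq
  set g := ‖grad x‖ with hg
  have hq0 : 0 ≤ q := norm_nonneg _
  have hg0 : 0 ≤ g := norm_nonneg _
  have hPx : ‖P (x + Δx ω) - P x‖ ≤ M * ‖Δx ω‖ := by
    have := H.P_lipschitz (x + Δx ω) x
    rwa [add_sub_cancel_left] at this
  set Δh := shifted P D β (x + Δx ω) (z + Δz ω) - shifted P D β x z with hΔh
  have hξ := S.noise_nonneg ω
  have hx := S.norm_x_le hb0 hb ω
  have hz := S.fast ω
  rw [← hq] at hx hz
  rw [← hg] at hx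
  have h1 : ‖P (x + Δx ω) (clip (D (z + Δz ω))) - P x (clip (D z))‖ ≤
      M * ‖Δx ω‖ + 2 * M ^ 2 * ‖Δz ω‖ := by
    have : P (x + Δx ω) (clip (D (z + Δz ω))) - P x (clip (D z)) =
        (P (x + Δx ω) - P x) (clip (D (z + Δz ω)))
          + P x (clip (D (z + Δz ω)) - clip (D z)) := by
      simp only [sub_apply, map_sub]; abel
    rw [this]
    refine (norm_add_le _ _).trans (add_le_add ?_ ?_)
    · calc _ ≤ M * ‖Δx ω‖ * ‖clip (D (z + Δz ω))‖ :=
            ContinuousLinearMap.le_of_opNorm_le _ hPx _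
        _ ≤ M * ‖Δx ω‖ * 1 := by gcongr; exact norm_clip_le_one _
        _ = _ := mul_one _
    · have h2 := norm_clip_sub_clip_le (D (z + Δz ω)) (D z)
      rw [map_add, add_sub_cancel_left] at h2
      calc _ ≤ M * ‖clip (D (z + Δz ω)) - clip (D z)‖ :=
            (P x).le_of_opNorm_le (H.norm_P_le x) _
        _ ≤ M * (2 * (M * ‖Δz ω‖)) := by
          rw [map_add]
          gcongr
          exact h2.trans (by gcongr; exact D.le_of_opNorm_le H.norm_D_le _)
        _ = _ := by ring
  have h2 : ‖Δh‖ ≤ ‖Δx ω‖ + M * s * (M * ‖Δx ω‖ + 2 * M ^ 2 * ‖Δz ω‖) := by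
    have : Δh = Δx ω + β • (P (x + Δx ω) (clip (D (z + Δz ω))) - P x (clip (D z))) := by
      simp only [hΔh, shifted]; module
    rw [this]
    refine (norm_add_le _ _).trans (add_le_add le_rfl ?_)
    rw [norm_smul, Real.norm_of_nonneg hβ0]
    gcongr
  have h3 : ‖Δh‖ ≤ 2 * M ^ 3 * s ^ 5 * g + 4 * M ^ 4 * s ^ 4 * (q + ξ ω) := by
    have m2 : 1 ≤ M ^ 2 := one_le_pow₀ hM
    have a1 : ‖Δx ω‖ + M * s * (M * ‖Δx ω‖) ≤ 2 * M ^ 2 * ‖Δx ω‖ := by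
      have b1 : M * s * (M * ‖Δx ω‖) ≤ M * 1 * (M * ‖Δx ω‖) := by gcongr
      have b2 : 1 * ‖Δx ω‖ ≤ M ^ 2 * ‖Δx ω‖ := by gcongr
      linarith
    have a2 : 2 * M ^ 2 * ‖Δx ω‖ ≤ 2 * M ^ 3 * s ^ 5 * g + 2 * M ^ 4 * s ^ 4 * (q + ξ ω) := by
      have m3 : M ^ 3 ≤ M ^ 4 := pow_le_pow_right₀ hM (by norm_num)
      calc 2 * M ^ 2 * ‖Δx ω‖ ≤ 2 * M ^ 2 * (M * s ^ 5 * g + M * s ^ 4 * (q + ξ ω)) := by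
            gcongr
        _ = 2 * M ^ 3 * s ^ 5 * g + 2 * M ^ 3 * s ^ 4 * (q + ξ ω) := by ring
        _ ≤ _ := by gcongr
    have a3 : M * s * (2 * M ^ 2 * ‖Δz ω‖) ≤ 2 * M ^ 4 * s ^ 4 * (q + ξ ω) := by
      calc M * s * (2 * M ^ 2 * ‖Δz ω‖) ≤ M * s * (2 * M ^ 2 * (M * s ^ 3 * (q + ξ ω))) := by
            gcongr
        _ = _ := by ring
    linarith
  calc ‖Δh‖ ^ 2 ≤ (2 * M ^ 3 * s ^ 5 * g + 4 * M ^ 4 * s ^ 4 * (q + ξ ω)) ^ 2 := by gcongr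
    _ ≤ 2 * ((2 * M ^ 3 * s ^ 5 * g) ^ 2 + (4 * M ^ 4 * s ^ 4 * (q + ξ ω)) ^ 2) := add_sq_le
    _ = 8 * M ^ 6 * s ^ 10 * g ^ 2 + 32 * M ^ 8 * s ^ 8 * (q + ξ ω) ^ 2 := by ring
    _ ≤ 8 * M ^ 6 * s ^ 10 * g ^ 2 + 32 * M ^ 8 * s ^ 8 * (2 * (q ^ 2 + ξ ω ^ 2)) := by
      gcongr; exact add_sq_le
    _ = _ := by ring

variable [IsProbabilityMeasure μ]

/-- On average the shifted slow variable makes a gradient step, up to small errors: the mean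
motion of the observable, which dominates the bias of `Δx`, is compensated by the shift. -/
lemma norm_integral_shifted_sub_add_le [CompleteSpace X] [CompleteSpace Z] [CompleteSpace Y]
    (H : SlowFastData f grad target P D M)
    (S : SlowFastStep μ grad target P D M c s b β x z Δx Δz ξ)
    (hs0 : 0 < s) (hs1 : s ≤ 1) (hb0 : 0 ≤ b) (hb : b ≤ M * s ^ 5) (hβ0 : 0 ≤ β)
    (hβ : β ≤ M * s) :
    Integrable (fun ω => shifted P D β (x + Δx ω) (z + Δz ω) - shifted P D β x z) μ ∧
    ‖(∫ ω, (shifted P D β (x + Δx ω) (z + Δz ω) - shifted P D β x z) ∂μ) + b • grad x‖ ≤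
      76 * M ^ 6 * (s ^ 5 * ‖z - target x‖ + s ^ 4 * huber ‖z - target x‖ + s ^ 6 * ‖grad x‖
        + s ^ 7) := by
  have hM := H.one_le
  obtain ⟨iC, hC⟩ := S.integral_clip_error_le H hs0
  obtain ⟨iK, hK⟩ := S.integral_norm_mul_clip_le H hs0 hs1 hb0 hb
  set q := ‖z - target x‖ with hq
  set g := ‖grad x‖ with hg
  set h := huber q with hh
  have hq0 : 0 ≤ q := norm_nonneg _
  have hg0 : 0 ≤ g := norm_nonneg _
  have hh0 : 0 ≤ h := huber_nonneg q
  set xh := shifted P D β x z with hxh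
  set Δh := fun ω => shifted P D β (x + Δx ω) (z + Δz ω) - xh with hΔh
  set C := fun ω => clip (D (z + Δz ω)) - clip (D z) - D (Δz ω) with hCdef
  set E := fun ω => β • ((P (x + Δx ω) - P x) (clip (D (z + Δz ω))) + P x (C ω)) with hE
  have hmS : AEStronglyMeasurable (fun ω => shifted P D β (x + Δx ω) (z + Δz ω)) μ :=
    (H.continuous_shifted β).comp_aestronglyMeasurable
      ((aestronglyMeasurable_const.add S.aesm_x).prodMk (aestronglyMeasurable_const.add S.aesm_z))
  have hmΔh : AEStronglyMeasurable Δh μ := hmS.sub aestronglyMeasurable_const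
  have hdec : ∀ ω, Δh ω = Δx ω + β • P x (D (Δz ω)) + E ω := by
    intro ω
    simp only [hΔh, hE, hCdef, hxh, shifted, map_sub, sub_apply]
    module
  have hPx : ∀ ω, ‖P (x + Δx ω) - P x‖ ≤ M * ‖Δx ω‖ := fun ω => by
    have := H.P_lipschitz (x + Δx ω) x
    rwa [add_sub_cancel_left] at this
  -- size of the remainder `E`
  have hEn : ∀ ω, ‖E ω‖ ≤ M ^ 2 * s * (‖Δx ω‖ * ‖clip (D (z + Δz ω))‖) + M ^ 2 * s * ‖C ω‖ := by
    intro ω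
    have h1 : ‖(P (x + Δx ω) - P x) (clip (D (z + Δz ω))) + P x (C ω)‖ ≤
        M * ‖Δx ω‖ * ‖clip (D (z + Δz ω))‖ + M * ‖C ω‖ :=
      (norm_add_le _ _).trans (add_le_add (ContinuousLinearMap.le_of_opNorm_le _ (hPx ω) _)
        ((P x).le_of_opNorm_le (H.norm_P_le x) _))
    rw [hE, norm_smul, Real.norm_of_nonneg hβ0]
    calc _ ≤ M * s * (M * ‖Δx ω‖ * ‖clip (D (z + Δz ω))‖ + M * ‖C ω‖) := by gcongr
      _ = _ := by ring
  have iEb : Integrable (fun ω => M ^ 2 * s * (‖Δx ω‖ * ‖clip (D (z + Δz ω))‖)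
      + M ^ 2 * s * ‖C ω‖) μ := (iK.const_mul _).add (iC.const_mul _)
  have hPD : AEStronglyMeasurable (fun ω => β • P x (D (Δz ω))) μ :=
    (((P x).continuous.comp D.continuous).const_smul β).comp_aestronglyMeasurable S.aesm_z
  have iPD : Integrable (fun ω => β • P x (D (Δz ω))) μ :=
    ((P x).integrable_comp (D.integrable_comp S.integrable_z)).smul β
  have hmE : AEStronglyMeasurable E μ := by
    have : E = fun ω => Δh ω - (Δx ω + β • P x (D (Δz ω))) := by
      funext ω; rw [hdec]; abel
    rw [this]
    exact hmΔh.sub (S.aesm_x.add hPD)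
  have iE : Integrable E μ := iEb.mono' hmE (.of_forall hEn)
  have iΔh : Integrable Δh μ := by
    have : Δh = fun ω => Δx ω + β • P x (D (Δz ω)) + E ω := funext hdec
    rw [this]
    exact (S.integrable_x.add iPD).add iE
  refine ⟨iΔh, ?_⟩
  show ‖(∫ ω, Δh ω ∂μ) + b • grad x‖ ≤ _
  have e1 : ∫ ω, Δh ω ∂μ = (∫ ω, Δx ω ∂μ) + β • P x (D (∫ ω, Δz ω ∂μ)) + ∫ ω, E ω ∂μ := by
    rw [← D.integral_comp_comm S.integrable_z,
      ← (P x).integral_comp_comm (D.integrable_comp S.integrable_z), ← integral_smul,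
      ← integral_add S.integrable_x iPD]
    exact (integral_congr_ae (.of_forall hdec)).trans (integral_add (S.integrable_x.add iPD) iE)
  have e2 : ‖∫ ω, E ω ∂μ‖ ≤ M ^ 2 * s * (3 * M ^ 3 * (s ^ 5 * g + s ^ 4 * q + s ^ 7)) +
      M ^ 2 * s * (45 * M ^ 4 * s ^ 3 * h + 24 * M ^ 4 * s ^ 6) := by
    refine (norm_integral_le_of_norm_le iEb (.of_forall hEn)).trans ?_
    rw [integral_add (iK.const_mul _) (iC.const_mul _), integral_const_mul, integral_const_mul]
    gcongr
  have e3 : (∫ ω, Δh ω ∂μ) + b • grad x = ((∫ ω, Δx ω ∂μ) + b • grad x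
      + β • P x (D (∫ ω, Δz ω ∂μ))) + ∫ ω, E ω ∂μ := by rw [e1]; abel
  rw [e3]
  refine (norm_add_le _ _).trans ((add_le_add S.mean e2).trans ?_)
  rw [← hq, ← hh]
  have m1 : M ≤ M ^ 6 := by
    calc M = M ^ 1 := (pow_one M).symm
      _ ≤ M ^ 6 := pow_le_pow_right₀ hM (by norm_num)
  have m2 : M ^ 5 ≤ M ^ 6 := pow_le_pow_right₀ hM (by norm_num)
  have s8 : s ^ 8 ≤ s ^ 7 := pow_le_pow_of_le_one hs0.le hs1 (by norm_num)
  have a1 : M * (s ^ 5 * q + s ^ 4 * h) ≤ M ^ 6 * (s ^ 5 * q + s ^ 4 * h) := by gcongr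
  have a2 : M ^ 2 * s * (3 * M ^ 3 * (s ^ 5 * g + s ^ 4 * q + s ^ 7)) ≤
      3 * (M ^ 6 * (s ^ 6 * g + s ^ 5 * q + s ^ 7)) := by
    calc _ = 3 * (M ^ 5 * (s ^ 6 * g + s ^ 5 * q + s ^ 8)) := by ring
      _ ≤ _ := by gcongr
  have a3 : M ^ 2 * s * (45 * M ^ 4 * s ^ 3 * h + 24 * M ^ 4 * s ^ 6) =
      M ^ 6 * (45 * (s ^ 4 * h) + 24 * s ^ 7) := by ring
  have p1 : 0 ≤ M ^ 6 * (s ^ 5 * q) := by positivity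
  have p2 : 0 ≤ M ^ 6 * (s ^ 4 * h) := by positivity
  have p3 : 0 ≤ M ^ 6 * (s ^ 6 * g) := by positivity
  have p4 : 0 ≤ M ^ 6 * s ^ 7 := by positivity
  nlinarith

/-- The objective at the shifted slow variable decreases on average. -/
lemma integral_f_shifted_le [CompleteSpace X] [CompleteSpace Z] [CompleteSpace Y]
    (H : SlowFastData f grad target P D M)
    (S : SlowFastStep μ grad target P D M c s b β x z Δx Δz ξ)
    (hs0 : 0 < s) (hs1 : s ≤ 1) (hb0 : 0 ≤ b) (hb : b ≤ M * s ^ 5) (hβ0 : 0 ≤ β)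
    (hβ : β ≤ M * s) :
    Integrable (fun ω => f (shifted P D β (x + Δx ω) (z + Δz ω))) μ ∧
    ∫ ω, f (shifted P D β (x + Δx ω) (z + Δz ω)) ∂μ ≤
      f (shifted P D β x z) - b * ‖grad x‖ ^ 2 + 300 * M ^ 9 *
        (s ^ 4 * ‖grad x‖ * huber ‖z - target x‖ + s ^ 5 * ‖grad x‖ * ‖z - target x‖
          + s ^ 6 * ‖grad x‖ ^ 2 + s ^ 6 * ‖grad x‖ + s ^ 5 * ‖z - target x‖ ^ 2 + s ^ 7) := by
  have hM := H.one_le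
  obtain ⟨iΔh, hmean⟩ := S.norm_integral_shifted_sub_add_le H hs0 hs1 hb0 hb hβ0 hβ
  have hsq := S.sq_norm_shifted_sub_le H hs0 hs1 hb0 hb hβ0 hβ
  set q := ‖z - target x‖ with hq
  set g := ‖grad x‖ with hg
  set h := huber q with hh
  have hq0 : 0 ≤ q := norm_nonneg _
  have hg0 : 0 ≤ g := norm_nonneg _
  have hh0 : 0 ≤ h := huber_nonneg q
  have hhQ : h ≤ q ^ 2 := huber_le_sq q
  set xh := shifted P D β x z with hxh
  set Δh := fun ω => shifted P D β (x + Δx ω) (z + Δz ω) - xh with hΔh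
  have hmS : AEStronglyMeasurable (fun ω => shifted P D β (x + Δx ω) (z + Δz ω)) μ :=
    (H.continuous_shifted β).comp_aestronglyMeasurable
      ((aestronglyMeasurable_const.add S.aesm_x).prodMk (aestronglyMeasurable_const.add S.aesm_z))
  -- gradient at the shifted point
  have hshift : ‖xh - x‖ ≤ M ^ 2 * s * ‖clip (D z)‖ := by
    rw [hxh, shifted, add_sub_cancel_left, norm_smul, Real.norm_of_nonneg hβ0]
    calc β * ‖P x (clip (D z))‖ ≤ M * s * (M * ‖clip (D z)‖) := by
          gcongr; exact (P x).le_of_opNorm_le (H.norm_P_le x) _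
      _ = _ := by ring
  have hgd : ‖grad xh - grad x‖ ≤ M ^ 3 * s * ‖clip (D z)‖ := by
    calc _ ≤ M * ‖xh - x‖ := H.grad_lipschitz _ _
      _ ≤ M * (M ^ 2 * s * ‖clip (D z)‖) := by gcongr
      _ = _ := by ring
  have hgd1 : ‖grad xh - grad x‖ ≤ M ^ 4 * s * q := by
    calc _ ≤ M ^ 3 * s * ‖clip (D z)‖ := hgd
      _ ≤ M ^ 3 * s * (M * q) := by
        gcongr; exact (norm_clip_le _).trans (H.norm_D_apply_le x z)
      _ = _ := by ring
  have hgn : ‖grad xh‖ ≤ g + M ^ 3 * s := by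
    have h1 : ‖grad xh‖ ≤ ‖grad x‖ + ‖grad xh - grad x‖ := by
      have := norm_add_le (grad x) (grad xh - grad x)
      rwa [add_sub_cancel] at this
    have h2 : M ^ 3 * s * ‖clip (D z)‖ ≤ M ^ 3 * s * 1 := by
      gcongr; exact norm_clip_le_one _
    linarith
  have hinner : inner ℝ (grad xh) (∫ ω, Δh ω ∂μ) ≤ -(b * g ^ 2) + M ^ 5 * s ^ 6 * g * q
      + (g + M ^ 3 * s) * (76 * M ^ 6 * (s ^ 5 * q + s ^ 4 * h + s ^ 6 * g + s ^ 7)) := by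
    have e1 : inner ℝ (grad xh) (∫ ω, Δh ω ∂μ) =
        inner ℝ (grad xh) ((∫ ω, Δh ω ∂μ) + b • grad x)
          - b * (inner ℝ (grad xh - grad x) (grad x) + g ^ 2) := by
      rw [inner_add_right, inner_smul_right, inner_sub_left, real_inner_self_eq_norm_sq]; ring
    have e2 := (real_inner_le_norm (grad xh) ((∫ ω, Δh ω ∂μ) + b • grad x)).trans
      (mul_le_mul hgn hmean (norm_nonneg _) (by positivity))
    have e3 : -(b * inner ℝ (grad xh - grad x) (grad x)) ≤ M ^ 5 * s ^ 6 * g * q := by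
      have h1 := (abs_le.1 (abs_real_inner_le_norm (grad xh - grad x) (grad x))).1
      calc -(b * inner ℝ (grad xh - grad x) (grad x))
          = b * (-inner ℝ (grad xh - grad x) (grad x)) := by ring
        _ ≤ b * (‖grad xh - grad x‖ * g) := by gcongr; linarith
        _ ≤ M * s ^ 5 * (M ^ 4 * s * q * g) := by gcongr
        _ = _ := by ring
    rw [e1]; linarith
  have key := S.integral_le (φ := fun ω => f (shifted P D β (x + Δx ω) (z + Δz ω)))
    (Δ := Δh) (v := grad xh)
    (A₀ := f xh + M / 2 * (8 * M ^ 6 * s ^ 10 * g ^ 2 + 64 * M ^ 8 * s ^ 8 * q ^ 2)) (A₁ := 0)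
    (A₂ := M / 2 * (64 * M ^ 8 * s ^ 8)) (H.continuous.comp_aestronglyMeasurable hmS)
    (fun ω => H.nonneg _) le_rfl (by positivity) iΔh (fun ω => ?_)
  · refine ⟨key.1, key.2.trans ?_⟩
    have m7 : M ^ 7 ≤ M ^ 9 := pow_le_pow_right₀ hM (by norm_num)
    have m5 : M ^ 5 ≤ M ^ 9 := pow_le_pow_right₀ hM (by norm_num)
    have m6 : M ^ 6 ≤ M ^ 9 := pow_le_pow_right₀ hM (by norm_num)
    have s65 : s ^ 6 ≤ s ^ 5 := pow_le_pow_of_le_one hs0.le hs1 (by norm_num)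
    have s76 : s ^ 7 ≤ s ^ 6 := pow_le_pow_of_le_one hs0.le hs1 (by norm_num)
    have s87 : s ^ 8 ≤ s ^ 7 := pow_le_pow_of_le_one hs0.le hs1 (by norm_num)
    have s85 : s ^ 8 ≤ s ^ 5 := pow_le_pow_of_le_one hs0.le hs1 (by norm_num)
    have s106 : s ^ 10 ≤ s ^ 6 := pow_le_pow_of_le_one hs0.le hs1 (by norm_num)
    have a1 : M / 2 * (8 * M ^ 6 * s ^ 10 * g ^ 2) ≤ 4 * (M ^ 9 * (s ^ 6 * g ^ 2)) := by
      calc _ = 4 * (M ^ 7 * (s ^ 10 * g ^ 2)) := by ring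
        _ ≤ _ := by gcongr
    have a2 : M / 2 * (64 * M ^ 8 * s ^ 8 * q ^ 2) ≤ 32 * (M ^ 9 * (s ^ 5 * q ^ 2)) := by
      calc _ = 32 * (M ^ 9 * (s ^ 8 * q ^ 2)) := by ring
        _ ≤ _ := by gcongr
    have a3 : M / 2 * (64 * M ^ 8 * s ^ 8) ≤ 32 * (M ^ 9 * s ^ 7) := by
      calc _ = 32 * (M ^ 9 * s ^ 8) := by ring
        _ ≤ _ := by gcongr
    have a4 : M ^ 5 * s ^ 6 * g * q ≤ M ^ 9 * (s ^ 5 * g * q) := by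
      calc _ = M ^ 5 * (s ^ 6 * g * q) := by ring
        _ ≤ _ := by gcongr
    have a5 : g * (76 * M ^ 6 * (s ^ 5 * q + s ^ 4 * h + s ^ 6 * g + s ^ 7)) ≤
        76 * (M ^ 9 * (s ^ 5 * g * q + s ^ 4 * g * h + s ^ 6 * g ^ 2 + s ^ 6 * g)) := by
      calc _ = 76 * (M ^ 6 * (s ^ 5 * g * q + s ^ 4 * g * h + s ^ 6 * g ^ 2 + s ^ 7 * g)) := by ring
        _ ≤ _ := by gcongr
    have a6 : M ^ 3 * s * (76 * M ^ 6 * (s ^ 5 * q + s ^ 4 * h + s ^ 6 * g + s ^ 7)) ≤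
        76 * (M ^ 9 * ((s ^ 5 * q ^ 2 + s ^ 7) + s ^ 5 * q ^ 2 + s ^ 6 * g + s ^ 7)) := by
      have b1 : s ^ 6 * q ≤ s ^ 5 * q ^ 2 + s ^ 7 := by
        have h1 : s * q ≤ q ^ 2 + s ^ 2 := by nlinarith only [sq_nonneg (s - q), sq_nonneg (s + q)]
        calc s ^ 6 * q = s ^ 5 * (s * q) := by ring
          _ ≤ s ^ 5 * (q ^ 2 + s ^ 2) := by gcongr
          _ = _ := by ring
      calc _ = 76 * (M ^ 9 * (s ^ 6 * q + s ^ 5 * h + s ^ 7 * g + s ^ 8)) := by ring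
        _ ≤ _ := by gcongr
    have p1 : 0 ≤ M ^ 9 * (s ^ 4 * g * h) := by positivity
    have p2 : 0 ≤ M ^ 9 * (s ^ 5 * g * q) := by positivity
    have p3 : 0 ≤ M ^ 9 * (s ^ 6 * g ^ 2) := by positivity
    have p4 : 0 ≤ M ^ 9 * (s ^ 6 * g) := by positivity
    have p5 : 0 ≤ M ^ 9 * (s ^ 5 * q ^ 2) := by positivity
    have p6 : 0 ≤ M ^ 9 * s ^ 7 := by positivity
    linarith
  · have h1 := H.descent xh (shifted P D β (x + Δx ω) (z + Δz ω))
    have h2 : M / 2 * ‖Δh ω‖ ^ 2 ≤ M / 2 * (8 * M ^ 6 * s ^ 10 * g ^ 2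
        + 64 * M ^ 8 * s ^ 8 * (q ^ 2 + ξ ω ^ 2)) := by gcongr; exact hsq ω
    have h3 : shifted P D β (x + Δx ω) (z + Δz ω) - xh = Δh ω := rfl
    rw [h3] at h1
    show f (shifted P D β (x + Δx ω) (z + Δz ω)) ≤ _
    linarith

end SlowFastStep

end Lyapunov

/-! ### The Lyapunov function -/

/-- Weights for which the errors of the three parts of the Lyapunov function cancel: `g`, `q` and
`h` stand for the gradient norm, the tracking error and its Huber value, and the three summands
are the expected changes of the objective at the shifted point (without its descent term), of
`g * h` and of `q ^ 2`. -/
def LyapunovWeights (M c K C₁ C₂ C s₀ : ℝ) : Prop :=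
  ∀ s b g h q : ℝ, 0 < s → s ≤ s₀ → s ^ 5 ≤ M * b → 0 ≤ b → 0 ≤ g → 0 ≤ h → 0 ≤ q →
    K * (s ^ 4 * g * h + s ^ 5 * g * q + s ^ 6 * g ^ 2 + s ^ 6 * g + s ^ 5 * q ^ 2 + s ^ 7)
      + C₁ * s * (g * (-(c / 2 * s ^ 3 * h) + K * s ^ 5 + K * s ^ 5 * g)
        + K * (s ^ 5 * g * q + s ^ 4 * q ^ 2 + s ^ 9 * g ^ 2 + s ^ 7))
      + C₂ * s ^ 2 * (-(c / 2 * s ^ 3 * q ^ 2) + K * s ^ 5 + K * s ^ 7 * g ^ 2)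
    ≤ b / 2 * g ^ 2 + C * s ^ 7

lemma exists_lyapunovWeights {M c K : ℝ} (hM : 1 ≤ M) (hc0 : 0 < c) (hK : 0 < K) :
    ∃ C₁ C₂ C s₀ : ℝ, 0 ≤ C₁ ∧ 0 ≤ C₂ ∧ 0 ≤ C ∧ 0 < s₀ ∧ s₀ ≤ 1 ∧
      LyapunovWeights M c K C₁ C₂ C s₀ := by
  -- `C₁` cancels the term `s ^ 4 * g * h`, and `C₂` the terms `s ^ 5 * q ^ 2`, including those
  -- that the cross term `s ^ 5 * g * q` leaves; small `s` absorbs the terms `s ^ 6 * g ^ 2`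
  set C₁ := 2 * K / c with hC₁
  have hC₁0 : 0 ≤ C₁ := by positivity
  set N := K * (1 + C₁) with hN
  have hN0 : 0 < N := by positivity
  set C₂ := 2 * (N + 2 * N ^ 2 * M) / c with hC₂
  have hC₂0 : 0 ≤ C₂ := by positivity
  set R := 4 * M * (N + C₁ * K + C₂ * K) with hR
  have hR0 : 0 ≤ R := by positivity
  refine ⟨C₁, C₂, 2 * N ^ 2 * M + N + C₂ * K, 1 / (1 + R), hC₁0, hC₂0, by positivity,
    by positivity, by rw [div_le_one (by positivity)]; linarith, ?_⟩
  intro s b g h q hs hs₀ hb hb0 hg hh hq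
  have hsR : s * R ≤ 1 := by
    rw [le_div_iff₀ (by positivity)] at hs₀
    nlinarith
  have hs1 : s ≤ 1 := hs₀.trans (by rw [div_le_one (by positivity)]; linarith)
  have e1 : C₁ * c / 2 = K := by rw [hC₁]; field_simp
  have e2 : C₂ * c / 2 = N + 2 * N ^ 2 * M := by rw [hC₂]; field_simp
  have i1 : N * (s ^ 5 * g * q) ≤ b / 8 * g ^ 2 + 2 * N ^ 2 * M * (s ^ 5 * q ^ 2) := by
    -- `s ^ 5 ≤ M * b` turns the product into the square of `√b * g` and a multiple of `q ^ 2`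
    have h1 : N * (s ^ 5 * g * q) ≤ s ^ 5 * (g ^ 2 / (8 * M) + 2 * N ^ 2 * M * q ^ 2) := by
      have h2 : N * g * q ≤ g ^ 2 / (8 * M) + 2 * N ^ 2 * M * q ^ 2 := by
        have : g ^ 2 / (8 * M) + 2 * N ^ 2 * M * q ^ 2 - N * g * q
          = (g - 4 * N * M * q) ^ 2 / (8 * M) := by field_simp; ring
        have h3 : 0 ≤ (g - 4 * N * M * q) ^ 2 / (8 * M) := by positivity
        linarith
      calc N * (s ^ 5 * g * q) = s ^ 5 * (N * g * q) := by ring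
        _ ≤ _ := by gcongr
    have h4 : s ^ 5 * (g ^ 2 / (8 * M)) ≤ M * b * (g ^ 2 / (8 * M)) := by gcongr
    have h5 : M * b * (g ^ 2 / (8 * M)) = b / 8 * g ^ 2 := by field_simp
    linarith
  have i2 : N * (s ^ 6 * g) ≤ b / 8 * g ^ 2 + 2 * N ^ 2 * M * s ^ 7 := by
    have h1 : N * (s ^ 6 * g) ≤ s ^ 5 * (g ^ 2 / (8 * M) + 2 * N ^ 2 * M * s ^ 2) := by
      have h2 : N * g * s ≤ g ^ 2 / (8 * M) + 2 * N ^ 2 * M * s ^ 2 := by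
        have : g ^ 2 / (8 * M) + 2 * N ^ 2 * M * s ^ 2 - N * g * s
          = (g - 4 * N * M * s) ^ 2 / (8 * M) := by field_simp; ring
        have h3 : 0 ≤ (g - 4 * N * M * s) ^ 2 / (8 * M) := by positivity
        linarith
      calc N * (s ^ 6 * g) = s ^ 5 * (N * g * s) := by ring
        _ ≤ _ := by gcongr
    have h4 : s ^ 5 * (g ^ 2 / (8 * M)) ≤ M * b * (g ^ 2 / (8 * M)) := by gcongr
    have h5 : M * b * (g ^ 2 / (8 * M)) = b / 8 * g ^ 2 := by field_simp
    linarith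
  have i3 : (N + C₁ * K + C₂ * K) * (s ^ 6 * g ^ 2) ≤ b / 4 * g ^ 2 := by
    have h1 : s * (4 * (N + C₁ * K + C₂ * K)) * M ≤ 1 := by rw [hR] at hsR; linarith
    have h2 : (N + C₁ * K + C₂ * K) * s ^ 6 ≤ b / 4 := by
      calc (N + C₁ * K + C₂ * K) * s ^ 6 = (N + C₁ * K + C₂ * K) * s * s ^ 5 := by ring
        _ ≤ (N + C₁ * K + C₂ * K) * s * (M * b) := by gcongr
        _ = s * (4 * (N + C₁ * K + C₂ * K)) * M * (b / 4) := by ring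
        _ ≤ 1 * (b / 4) := by gcongr
        _ = _ := one_mul _
    calc _ = (N + C₁ * K + C₂ * K) * s ^ 6 * g ^ 2 := by ring
      _ ≤ _ := by gcongr
  have i4 : C₁ * K * (s ^ 6 * g * q) ≤ C₁ * K * (s ^ 5 * g * q) := by
    have : s ^ 6 ≤ s ^ 5 := pow_le_pow_of_le_one hs.le hs1 (by norm_num)
    gcongr
  have i5 : C₁ * K * (s ^ 10 * g ^ 2) ≤ C₁ * K * (s ^ 6 * g ^ 2) := by
    have : s ^ 10 ≤ s ^ 6 := pow_le_pow_of_le_one hs.le hs1 (by norm_num)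
    gcongr
  have i6 : C₂ * K * (s ^ 9 * g ^ 2) ≤ C₂ * K * (s ^ 6 * g ^ 2) := by
    have : s ^ 9 ≤ s ^ 6 := pow_le_pow_of_le_one hs.le hs1 (by norm_num)
    gcongr
  have i7 : C₁ * K * s ^ 8 ≤ C₁ * K * s ^ 7 := by
    have : s ^ 8 ≤ s ^ 7 := pow_le_pow_of_le_one hs.le hs1 (by norm_num)
    gcongr
  have eN : N = K + C₁ * K := by rw [hN]; ring
  have total : K * (s ^ 4 * g * h + s ^ 5 * g * q + s ^ 6 * g ^ 2 + s ^ 6 * g + s ^ 5 * q ^ 2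
        + s ^ 7)
      + C₁ * s * (g * (-(c / 2 * s ^ 3 * h) + K * s ^ 5 + K * s ^ 5 * g)
        + K * (s ^ 5 * g * q + s ^ 4 * q ^ 2 + s ^ 9 * g ^ 2 + s ^ 7))
      + C₂ * s ^ 2 * (-(c / 2 * s ^ 3 * q ^ 2) + K * s ^ 5 + K * s ^ 7 * g ^ 2)
      = (K - C₁ * c / 2) * (s ^ 4 * g * h) + K * (s ^ 5 * g * q) + C₁ * K * (s ^ 6 * g * q)
        + K * (s ^ 6 * g ^ 2) + C₁ * K * (s ^ 6 * g ^ 2) + C₁ * K * (s ^ 10 * g ^ 2)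
        + C₂ * K * (s ^ 9 * g ^ 2) + (K + C₁ * K) * (s ^ 6 * g)
        + (K + C₁ * K - C₂ * c / 2) * (s ^ 5 * q ^ 2)
        + K * s ^ 7 + C₁ * K * s ^ 8 + C₂ * K * s ^ 7 := by ring
  rw [total, e1, e2, ← eN, sub_self, zero_mul]
  have e3 : N * (s ^ 5 * g * q) = K * (s ^ 5 * g * q) + C₁ * K * (s ^ 5 * g * q) := by
    rw [eN]; ring
  have e4 : (N + C₁ * K + C₂ * K) * (s ^ 6 * g ^ 2) = K * (s ^ 6 * g ^ 2)
      + C₁ * K * (s ^ 6 * g ^ 2) + C₁ * K * (s ^ 6 * g ^ 2) + C₂ * K * (s ^ 6 * g ^ 2) := by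
    rw [eN]; ring
  have e5 : N * s ^ 7 = K * s ^ 7 + C₁ * K * s ^ 7 := by rw [eN]; ring
  have e6 : (N - (N + 2 * N ^ 2 * M)) * (s ^ 5 * q ^ 2) =
    -(2 * N ^ 2 * M * (s ^ 5 * q ^ 2)) := by ring
  have e7 : (2 * N ^ 2 * M + N + C₂ * K) * s ^ 7 =
    2 * N ^ 2 * M * s ^ 7 + N * s ^ 7 + C₂ * K * s ^ 7 := by ring
  rw [e6, e7]
  linarith

section Lyapunov

variable {X Z Y : Type*} [NormedAddCommGroup X] [InnerProductSpace ℝ X]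
  [NormedAddCommGroup Z] [InnerProductSpace ℝ Z] [NormedAddCommGroup Y] [NormedSpace ℝ Y]
  {f : X → ℝ} {grad : X → X} {target : X → Z} {P : X → Y →L[ℝ] X} {D : Z →L[ℝ] Y}
  {M c s b β : ℝ} {x : X} {z : Z}
  {Ω : Type*} [MeasurableSpace Ω] {μ : Measure Ω}
  {Δx : Ω → X} {Δz : Ω → Z} {ξ : Ω → ℝ}

/-- The Lyapunov function: the objective at the shifted slow variable, a Huber penalty of the
tracking error weighted by the gradient norm, and a small multiple of the squared error. -/
noncomputable def lyapunov (f : X → ℝ) (grad : X → X) (target : X → Z) (P : X → Y →L[ℝ] X)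
    (D : Z →L[ℝ] Y) (β s C₁ C₂ : ℝ) (x : X) (z : Z) : ℝ :=
  f (shifted P D β x z) + C₁ * s * (‖grad x‖ * huber ‖z - target x‖)
    + C₂ * s ^ 2 * ‖z - target x‖ ^ 2

/-- An energy that grows at most by a constant factor in each step, whatever the step size. -/
noncomputable def energy (f : X → ℝ) (grad : X → X) (target : X → Z) (x : X) (z : Z) : ℝ :=
  f x + ‖grad x‖ ^ 2 + ‖z - target x‖ ^ 2 + 1

namespace SlowFastData

lemma continuous_lyapunov (H : SlowFastData f grad target P D M) (β s C₁ C₂ : ℝ) :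
    Continuous fun p : X × Z => lyapunov f grad target P D β s C₁ C₂ p.1 p.2 := by
  have h1 := H.continuous.comp (H.continuous_shifted β)
  have h2 := H.continuous_grad
  have h3 := H.continuous_target
  have h4 := continuous_huber
  unfold lyapunov
  exact (h1.add (by fun_prop)).add (by fun_prop)

lemma continuous_energy (H : SlowFastData f grad target P D M) :
    Continuous fun p : X × Z => energy f grad target p.1 p.2 := by
  have h1 := H.continuous
  have h2 := H.continuous_grad
  have h3 := H.continuous_target
  unfold energy
  fun_prop

lemma one_le_energy (H : SlowFastData f grad target P D M) (x : X) (z : Z) :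
    1 ≤ energy f grad target x z := by
  have := H.nonneg x
  unfold energy
  nlinarith [sq_nonneg ‖grad x‖, sq_nonneg ‖z - target x‖]

lemma sq_norm_grad_le_energy (H : SlowFastData f grad target P D M) (x : X) (z : Z) :
    ‖grad x‖ ^ 2 ≤ energy f grad target x z := by
  have := H.nonneg x
  unfold energy
  nlinarith [sq_nonneg ‖z - target x‖]

lemma lyapunov_nonneg (H : SlowFastData f grad target P D M) (hs : 0 ≤ s) {C₁ C₂ : ℝ}
    (h1 : 0 ≤ C₁) (h2 : 0 ≤ C₂) (x : X) (z : Z) :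
    0 ≤ lyapunov f grad target P D β s C₁ C₂ x z := by
  have := H.nonneg (shifted P D β x z)
  have := huber_nonneg ‖z - target x‖
  unfold lyapunov
  positivity

lemma lyapunov_le_energy (H : SlowFastData f grad target P D M) (hs : 0 ≤ s) (hs1 : s ≤ 1)
    (hβ0 : 0 ≤ β) (hβ : β ≤ M * s) {C₁ C₂ : ℝ} (h1 : 0 ≤ C₁) (h2 : 0 ≤ C₂) (x : X) (z : Z) :
    lyapunov f grad target P D β s C₁ C₂ x z
      ≤ (M ^ 5 + C₁ + C₂) * energy f grad target x z := by
  have hM := H.one_le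
  have hf := H.nonneg x
  set q := ‖z - target x‖ with hq
  set g := ‖grad x‖ with hg
  have hq0 : 0 ≤ q := norm_nonneg _
  have hg0 : 0 ≤ g := norm_nonneg _
  have hd := H.descent x (shifted P D β x z)
  have hshift : ‖shifted P D β x z - x‖ ≤ M ^ 2 := by
    rw [shifted, add_sub_cancel_left, norm_smul, Real.norm_of_nonneg hβ0]
    calc β * ‖P x (clip (D z))‖ ≤ M * s * (M * ‖clip (D z)‖) := by
          gcongr; exact (P x).le_of_opNorm_le (H.norm_P_le x) _
      _ ≤ M * 1 * (M * 1) := by gcongr; exact norm_clip_le_one _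
      _ = _ := by ring
  set r := ‖shifted P D β x z - x‖ with hr
  have hr0 : 0 ≤ r := norm_nonneg _
  have hin := real_inner_le_norm (grad x) (shifted P D β x z - x)
  have m5 : 1 ≤ M ^ 5 := one_le_pow₀ hM
  have a1 : g * r ≤ g ^ 2 / 2 + M ^ 4 / 2 := by
    have : r ^ 2 ≤ (M ^ 2) ^ 2 := by gcongr
    nlinarith [sq_nonneg (g - r)]
  have a2 : M / 2 * r ^ 2 ≤ M ^ 5 / 2 := by
    calc M / 2 * r ^ 2 ≤ M / 2 * (M ^ 2) ^ 2 := by gcongr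
      _ = _ := by ring
  have a3 : M ^ 4 ≤ M ^ 5 := pow_le_pow_right₀ hM (by norm_num)
  have a4 : f (shifted P D β x z) ≤ M ^ 5 * (f x + g ^ 2 + q ^ 2 + 1) := by
    have b1 : f x ≤ M ^ 5 * f x := le_mul_of_one_le_left hf m5
    have b2 : g ^ 2 ≤ M ^ 5 * g ^ 2 := le_mul_of_one_le_left (sq_nonneg _) m5
    have b3 : 0 ≤ M ^ 5 * q ^ 2 := by positivity
    nlinarith
  have a5 : C₁ * s * (g * huber q) ≤ C₁ * (f x + g ^ 2 + q ^ 2 + 1) := by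
    have hh := huber_le_self hq0
    have hh0 := huber_nonneg q
    have b1 : g * huber q ≤ f x + g ^ 2 + q ^ 2 + 1 := by
      have : g * huber q ≤ g * q := by gcongr
      nlinarith [sq_nonneg (g - q)]
    calc C₁ * s * (g * huber q) ≤ C₁ * 1 * (g * huber q) := by gcongr
      _ = C₁ * (g * huber q) := by ring
      _ ≤ _ := by gcongr
  have a6 : C₂ * s ^ 2 * q ^ 2 ≤ C₂ * (f x + g ^ 2 + q ^ 2 + 1) := by
    have b1 : q ^ 2 ≤ f x + g ^ 2 + q ^ 2 + 1 := by nlinarith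
    calc C₂ * s ^ 2 * q ^ 2 ≤ C₂ * 1 * q ^ 2 := by gcongr; exact pow_le_one₀ hs hs1
      _ = C₂ * q ^ 2 := by ring
      _ ≤ _ := by gcongr
  show f (shifted P D β x z) + C₁ * s * (g * huber q) + C₂ * s ^ 2 * q ^ 2 ≤
    (M ^ 5 + C₁ + C₂) * (f x + g ^ 2 + q ^ 2 + 1)
  linarith

end SlowFastData

namespace SlowFastStep

/-- The energy grows at most by a constant factor. -/
lemma integral_energy_le [IsProbabilityMeasure μ] (H : SlowFastData f grad target P D M)
    (S : SlowFastStep μ grad target P D M c s b β x z Δx Δz ξ)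
    (hs0 : 0 < s) (hs1 : s ≤ 1) (hb0 : 0 ≤ b) (hb : b ≤ M * s ^ 5) :
    Integrable (fun ω => energy f grad target (x + Δx ω) (z + Δz ω)) μ ∧
    ∫ ω, energy f grad target (x + Δx ω) (z + Δz ω) ∂μ ≤
      60 * M ^ 4 * energy f grad target x z := by
  have hM := H.one_le
  have hf := H.nonneg x
  set q := ‖z - target x‖ with hq
  set g := ‖grad x‖ with hg
  have hq0 : 0 ≤ q := norm_nonneg _
  have hg0 : 0 ≤ g := norm_nonneg _
  have m4 : 1 ≤ M ^ 4 := one_le_pow₀ hM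
  have m2 : M ^ 2 ≤ M ^ 4 := pow_le_pow_right₀ hM (by norm_num)
  have key := S.integral_le' (φ := fun ω => energy f grad target (x + Δx ω) (z + Δz ω))
    (A₀ := 30 * M ^ 4 * (f x + g ^ 2 + q ^ 2 + 1)) (A₁ := 0) (A₂ := 30 * M ^ 4)
    (H.continuous_energy.comp_aestronglyMeasurable
      ((aestronglyMeasurable_const.add S.aesm_x).prodMk (aestronglyMeasurable_const.add S.aesm_z)))
    (fun ω => zero_le_one.trans (H.one_le_energy _ _)) le_rfl (by positivity) (fun ω => ?_)
  · refine ⟨key.1, key.2.trans ?_⟩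
    have : energy f grad target x z = f x + g ^ 2 + q ^ 2 + 1 := rfl
    rw [this]
    nlinarith [sq_nonneg g, sq_nonneg q]
  · have hξ := S.noise_nonneg ω
    have hx := S.norm_x_le hb0 hb ω
    have hz := S.fast ω
    rw [← hq] at hx hz
    rw [← hg] at hx
    set p := ‖Δx ω‖ with hp
    set ζ := ‖Δz ω‖ with hζ
    have hp0 : 0 ≤ p := norm_nonneg _
    have hζ0 : 0 ≤ ζ := norm_nonneg _
    have hp1 : p ≤ M * (g + (q + ξ ω)) := by
      calc p ≤ M * s ^ 5 * g + M * s ^ 4 * (q + ξ ω) := hx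
        _ ≤ M * 1 * g + M * 1 * (q + ξ ω) := by
          gcongr
          · exact pow_le_one₀ hs0.le hs1
          · exact pow_le_one₀ hs0.le hs1
        _ = _ := by ring
    have hζ1 : ζ ≤ M * (q + ξ ω) := by
      calc ζ ≤ M * s ^ 3 * (q + ξ ω) := hz
        _ ≤ M * 1 * (q + ξ ω) := by gcongr; exact pow_le_one₀ hs0.le hs1
        _ = _ := by ring
    have hp2 : p ^ 2 ≤ M ^ 2 * (3 * (g ^ 2 + q ^ 2 + ξ ω ^ 2)) := by
      calc p ^ 2 ≤ (M * (g + (q + ξ ω))) ^ 2 := by gcongr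
        _ = M ^ 2 * (g + (q + ξ ω)) ^ 2 := by ring
        _ ≤ _ := by
          gcongr
          nlinarith only [sq_nonneg (g - q), sq_nonneg (g - ξ ω), sq_nonneg (q - ξ ω)]
    have hζ2 : ζ ^ 2 ≤ M ^ 2 * (2 * (q ^ 2 + ξ ω ^ 2)) := by
      calc ζ ^ 2 ≤ (M * (q + ξ ω)) ^ 2 := by gcongr
        _ = M ^ 2 * (q + ξ ω) ^ 2 := by ring
        _ ≤ _ := by gcongr; exact add_sq_le
    have c1 : f (x + Δx ω) ≤ f x + (g ^ 2 / 2 + p ^ 2 / 2) + M / 2 * p ^ 2 := by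
      have h1 := H.descent x (x + Δx ω)
      rw [add_sub_cancel_left] at h1
      have h2 := real_inner_le_norm (grad x) (Δx ω)
      nlinarith only [h1, h2, sq_nonneg (g - p)]
    have c2 : ‖grad (x + Δx ω)‖ ^ 2 ≤ 2 * (g ^ 2 + (M * p) ^ 2) := by
      have h1 := H.grad_lipschitz (x + Δx ω) x
      rw [add_sub_cancel_left] at h1
      have h2 : ‖grad (x + Δx ω)‖ ≤ g + M * p := by
        have := norm_add_le (grad x) (grad (x + Δx ω) - grad x)
        rw [add_sub_cancel] at this
        linarith
      calc _ ≤ (g + M * p) ^ 2 := by gcongr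
        _ ≤ _ := add_sq_le
    have c3 : ‖z + Δz ω - target (x + Δx ω)‖ ^ 2 ≤ 3 * (q ^ 2 + ζ ^ 2 + (M * p) ^ 2) := by
      have h1 := H.target_lipschitz (x + Δx ω) x
      rw [add_sub_cancel_left] at h1
      have h2 : z + Δz ω - target (x + Δx ω)
        = (z - target x) + Δz ω - (target (x + Δx ω) - target x) := by abel
      have h3 : ‖z + Δz ω - target (x + Δx ω)‖ ≤ q + ζ + M * p := by
        rw [h2]
        exact (norm_sub_le _ _).trans (add_le_add (norm_add_le _ _) h1)
      calc _ ≤ (q + ζ + M * p) ^ 2 := by gcongr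
        _ ≤ _ := by
          nlinarith only [sq_nonneg (q - ζ), sq_nonneg (q - M * p), sq_nonneg (ζ - M * p)]
    have d1 : p ^ 2 / 2 + M / 2 * p ^ 2 + 5 * (M * p) ^ 2 ≤ 6 * (M ^ 2 * p ^ 2) := by
      have h1 : M ≤ M ^ 2 := by nlinarith
      have h2 : M * p ^ 2 ≤ M ^ 2 * p ^ 2 := by gcongr
      have h3 : 1 * p ^ 2 ≤ M ^ 2 * p ^ 2 := by gcongr; exact one_le_pow₀ hM
      linarith only [h2, h3, mul_pow M p 2]
    have d2 : 6 * (M ^ 2 * p ^ 2) ≤ 18 * (M ^ 4 * (g ^ 2 + q ^ 2 + ξ ω ^ 2)) := by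
      calc 6 * (M ^ 2 * p ^ 2) ≤ 6 * (M ^ 2 * (M ^ 2 * (3 * (g ^ 2 + q ^ 2 + ξ ω ^ 2)))) := by
            gcongr
        _ = _ := by ring
    have d3 : 3 * ζ ^ 2 ≤ 6 * (M ^ 4 * (q ^ 2 + ξ ω ^ 2)) := by
      calc 3 * ζ ^ 2 ≤ 3 * (M ^ 2 * (2 * (q ^ 2 + ξ ω ^ 2))) := by gcongr
        _ = 6 * (M ^ 2 * (q ^ 2 + ξ ω ^ 2)) := by ring
        _ ≤ _ := by gcongr
    have d4 : f x ≤ M ^ 4 * f x := le_mul_of_one_le_left hf m4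
    have d5 : g ^ 2 ≤ M ^ 4 * g ^ 2 := le_mul_of_one_le_left (sq_nonneg _) m4
    have d6 : q ^ 2 ≤ M ^ 4 * q ^ 2 := le_mul_of_one_le_left (sq_nonneg _) m4
    have d7 : 0 ≤ M ^ 4 * ξ ω ^ 2 := by positivity
    have d8 : 0 ≤ M ^ 4 * f x := by positivity
    have d9 : 0 ≤ M ^ 4 * g ^ 2 := by positivity
    have d10 : 0 ≤ M ^ 4 * q ^ 2 := by positivity
    show f (x + Δx ω) + ‖grad (x + Δx ω)‖ ^ 2 + ‖z + Δz ω - target (x + Δx ω)‖ ^ 2 + 1 ≤ _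
    linarith

/-- One step decreases the Lyapunov function by a multiple of the squared gradient norm. -/
theorem integral_lyapunov_le [IsProbabilityMeasure μ] [CompleteSpace X] [CompleteSpace Z]
    [CompleteSpace Y] (H : SlowFastData f grad target P D M)
    (S : SlowFastStep μ grad target P D M c s b β x z Δx Δz ξ) {K C₁ C₂ C s₀ : ℝ}
    (hc0 : 0 < c) (hc1 : c ≤ 1) (hs0 : 0 < s) (hs1 : 32 * M ^ 4 * s ≤ c) (hs : s ≤ s₀)
    (hb0 : 0 ≤ b) (hb : b ≤ M * s ^ 5) (hb' : s ^ 5 ≤ M * b)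
    (hβ0 : 0 ≤ β) (hβ : β ≤ M * s) (hK : 300 * M ^ 9 / c ≤ K)
    (hC₁ : 0 ≤ C₁) (hC₂ : 0 ≤ C₂) (hW : LyapunovWeights M c K C₁ C₂ C s₀) :
    ∫ ω, lyapunov f grad target P D β s C₁ C₂ (x + Δx ω) (z + Δz ω) ∂μ ≤
      lyapunov f grad target P D β s C₁ C₂ x z - b / 2 * ‖grad x‖ ^ 2 + C * s ^ 7 := by
  have hM := H.one_le
  have hs1' : s ≤ 1 := by
    have : 1 ≤ M ^ 4 := one_le_pow₀ hM
    nlinarith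
  obtain ⟨iF, hF⟩ := S.integral_f_shifted_le H hs0 hs1' hb0 hb hβ0 hβ
  obtain ⟨iQ, hQ⟩ := S.integral_sq_le H hc0 hc1 hs0 hs1 hb0 hb
  obtain ⟨iH, hH⟩ := S.integral_huber_le H hc0 hc1 hs0 hs1 hb0 hb
  obtain ⟨iX, hX⟩ := S.integral_norm_mul_huber_le H hs0 hs1' hb0 hb
  have hw := hW s b ‖grad x‖ (huber ‖z - target x‖) ‖z - target x‖ hs0 hs hb' hb0
    (norm_nonneg _) (huber_nonneg _) (norm_nonneg _)
  set q := ‖z - target x‖ with hq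
  set g := ‖grad x‖ with hg
  set h := huber q with hh
  have hq0 : 0 ≤ q := norm_nonneg _
  have hg0 : 0 ≤ g := norm_nonneg _
  have hh0 : 0 ≤ h := huber_nonneg q
  have k1 : 300 * M ^ 9 ≤ K := (le_div_self (by positivity) hc0 hc1).trans hK
  have k2 : 48 * M ^ 4 / c ≤ K := by
    refine le_trans ?_ hK
    have : M ^ 4 ≤ M ^ 9 := pow_le_pow_right₀ hM (by norm_num)
    gcongr
    norm_num
  have k3 : M * (10 * M ^ 3) ≤ K := by
    have : M ^ 4 ≤ M ^ 9 := pow_le_pow_right₀ hM (by norm_num)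
    nlinarith [pow_pos (one_pos.trans_le hM) 9]
  -- the weighted Huber term
  have hpt : ∀ ω, ‖grad (x + Δx ω)‖ * huber ‖z + Δz ω - target (x + Δx ω)‖ ≤
      g * huber ‖z + Δz ω - target (x + Δx ω)‖
        + M * (‖Δx ω‖ * huber ‖z + Δz ω - target (x + Δx ω)‖) := by
    intro ω
    have h1 := H.grad_lipschitz (x + Δx ω) x
    rw [add_sub_cancel_left] at h1
    have h2 : ‖grad (x + Δx ω)‖ ≤ g + M * ‖Δx ω‖ := by
      have := norm_add_le (grad x) (grad (x + Δx ω) - grad x)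
      rw [add_sub_cancel] at this
      linarith
    calc _ ≤ (g + M * ‖Δx ω‖) * huber ‖z + Δz ω - target (x + Δx ω)‖ := by
          gcongr; exact huber_nonneg _
      _ = _ := by ring
  have iB : Integrable (fun ω => g * huber ‖z + Δz ω - target (x + Δx ω)‖
      + M * (‖Δx ω‖ * huber ‖z + Δz ω - target (x + Δx ω)‖)) μ :=
    (iH.const_mul _).add (iX.const_mul _)
  have iG : Integrable (fun ω => ‖grad (x + Δx ω)‖ * huber ‖z + Δz ω - target (x + Δx ω)‖) μ := by
    refine iB.mono' ((H.continuous_grad.comp_aestronglyMeasurable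
      (aestronglyMeasurable_const.add S.aesm_x)).norm.mul iH.aestronglyMeasurable)
      (.of_forall fun ω => ?_)
    rw [Real.norm_of_nonneg (mul_nonneg (norm_nonneg _) (huber_nonneg _))]
    exact hpt ω
  have hG : ∫ ω, ‖grad (x + Δx ω)‖ * huber ‖z + Δz ω - target (x + Δx ω)‖ ∂μ ≤
      g * h + (g * (-(c / 2 * s ^ 3 * h) + K * s ^ 5 + K * s ^ 5 * g)
        + K * (s ^ 5 * g * q + s ^ 4 * q ^ 2 + s ^ 9 * g ^ 2 + s ^ 7)) := by
    refine (integral_mono iG iB hpt).trans ?_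
    rw [integral_add (iH.const_mul _) (iX.const_mul _), integral_const_mul, integral_const_mul]
    have a1 := mul_le_mul_of_nonneg_left hH hg0
    have a2 := mul_le_mul_of_nonneg_left hX (zero_le_one.trans hM)
    have a3 : g * (h - c / 2 * s ^ 3 * h + 48 * M ^ 4 / c * s ^ 5 + 48 * M ^ 4 / c * s ^ 5 * g)
        ≤ g * (h - c / 2 * s ^ 3 * h + K * s ^ 5 + K * s ^ 5 * g) := by gcongr
    have a4 : M * (10 * M ^ 3 * (s ^ 5 * g * q + s ^ 4 * q ^ 2 + s ^ 9 * g ^ 2 + s ^ 7)) ≤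
        K * (s ^ 5 * g * q + s ^ 4 * q ^ 2 + s ^ 9 * g ^ 2 + s ^ 7) := by
      rw [← mul_assoc]; gcongr
    linarith
  have hF' : ∫ ω, f (shifted P D β (x + Δx ω) (z + Δz ω)) ∂μ ≤
      f (shifted P D β x z) - b * g ^ 2 +
        K * (s ^ 4 * g * h + s ^ 5 * g * q + s ^ 6 * g ^ 2 + s ^ 6 * g + s ^ 5 * q ^ 2
          + s ^ 7) := by
    refine hF.trans ?_
    gcongr
  have hQ' : ∫ ω, ‖z + Δz ω - target (x + Δx ω)‖ ^ 2 ∂μ ≤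
      q ^ 2 + (-(c / 2 * s ^ 3 * q ^ 2) + K * s ^ 5 + K * s ^ 7 * g ^ 2) := by
    have a1 : 48 * M ^ 4 / c * s ^ 5 ≤ K * s ^ 5 := by gcongr
    have a2 : 48 * M ^ 4 / c * s ^ 7 * g ^ 2 ≤ K * s ^ 7 * g ^ 2 := by gcongr
    linarith
  have hsplit : ∫ ω, lyapunov f grad target P D β s C₁ C₂ (x + Δx ω) (z + Δz ω) ∂μ =
      ∫ ω, f (shifted P D β (x + Δx ω) (z + Δz ω)) ∂μ
        + C₁ * s * ∫ ω, ‖grad (x + Δx ω)‖ * huber ‖z + Δz ω - target (x + Δx ω)‖ ∂μ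
        + C₂ * s ^ 2 * ∫ ω, ‖z + Δz ω - target (x + Δx ω)‖ ^ 2 ∂μ := by
    have iFG : Integrable (fun ω => f (shifted P D β (x + Δx ω) (z + Δz ω))
        + C₁ * s * (‖grad (x + Δx ω)‖ * huber ‖z + Δz ω - target (x + Δx ω)‖)) μ :=
      iF.add (iG.const_mul _)
    unfold lyapunov
    rw [integral_add iFG (iQ.const_mul _), integral_add iF (iG.const_mul _),
      integral_const_mul, integral_const_mul]
  rw [hsplit]
  have b1 := mul_le_mul_of_nonneg_left hG (mul_nonneg hC₁ hs0.le)
  have b2 := mul_le_mul_of_nonneg_left hQ' (mul_nonneg hC₂ (sq_nonneg s))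
  have : lyapunov f grad target P D β s C₁ C₂ x z =
    f (shifted P D β x z) + C₁ * s * (g * h) + C₂ * s ^ 2 * q ^ 2 := rfl
  rw [this]
  linarith

end SlowFastStep

end Lyapunov

/-! ### Recursions with independent inputs -/

section Chain

variable {E S Ω : Type*} [MeasurableSpace E] [MeasurableSpace S] [MeasurableSpace Ω]
  {T : E → S → E} {x₀ : E}

/-- The iterates of a recursion driven by a sequence of inputs. -/
def iterateWith (T : E → S → E) (x₀ : E) (a : ℕ → S) : ℕ → E
  | 0 => x₀
  | k + 1 => T (iterateWith T x₀ a k) (a k)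

lemma measurable_iterateWith (hT : Measurable fun p : E × S => T p.1 p.2) (k : ℕ) :
    Measurable fun a : ℕ → S => iterateWith T x₀ a k := by
  induction k with
  | zero => exact measurable_const
  | succ k ih => exact hT.comp (ih.prodMk (measurable_pi_apply k))

/-- The `k`-th iterate depends only on the inputs with index below `k`. -/
lemma exists_iterateWith_eq (hT : Measurable fun p : E × S => T p.1 p.2) (k : ℕ) :
    ∃ φ : (Finset.range k → S) → E, Measurable φ ∧
      ∀ a : ℕ → S, iterateWith T x₀ a k = φ fun i => a i := by
  induction k with
  | zero => exact ⟨fun _ => x₀, measurable_const, fun _ => rfl⟩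
  | succ k ih =>
    obtain ⟨φ, hφ, h⟩ := ih
    refine ⟨fun a => T (φ fun i => a ⟨i, Finset.mem_range.2
      ((Finset.mem_range.1 i.2).trans k.lt_succ_self)⟩) (a ⟨k, Finset.self_mem_range_succ k⟩),
      ?_, fun a => ?_⟩
    · refine hT.comp (Measurable.prodMk (hφ.comp ?_) (measurable_pi_apply _))
      exact measurable_pi_lambda _ fun i => measurable_pi_apply _
    · rw [iterateWith, h]

variable {P : Measure Ω} {ζ : ℕ → Ω → S} {ν : Measure S}

lemma indepFun_iterateWith (hT : Measurable fun p : E × S => T p.1 p.2)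
    (hζ : ∀ k, Measurable (ζ k)) (hind : iIndepFun ζ P) (k : ℕ) :
    IndepFun (fun ω => iterateWith T x₀ (fun n => ζ n ω) k) (ζ k) P := by
  obtain ⟨φ, hφ, h⟩ := exists_iterateWith_eq (x₀ := x₀) hT k
  have h1 := hind.indepFun_finset (Finset.range k) {k} (by simp) hζ
  have h2 := h1.comp hφ (measurable_pi_apply (⟨k, Finset.mem_singleton_self k⟩ : ({k} : Finset ℕ)))
  have h3 : (fun ω => iterateWith T x₀ (fun n => ζ n ω) k) =
      φ ∘ fun ω (i : Finset.range k) => ζ i ω := by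
    funext ω; exact h _
  rw [h3]
  exact h2

/-- A bound on the conditional expectation of a nonnegative function of the next state integrates
to a bound on its expectation. -/
lemma integral_iterateWith_succ_le [IsProbabilityMeasure P] [IsProbabilityMeasure ν]
    (hT : Measurable fun p : E × S => T p.1 p.2)
    (hζ : ∀ k, Measurable (ζ k)) (hind : iIndepFun ζ P) (hlaw : ∀ k, P.map (ζ k) = ν) (k : ℕ)
    {φ ψ : E → ℝ} (hφ : Measurable φ) (hφ0 : ∀ x, 0 ≤ φ x) (hψ : Measurable ψ)
    (hi : ∀ x, Integrable (fun a => φ (T x a)) ν) (hle : ∀ x, ∫ a, φ (T x a) ∂ν ≤ ψ x)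
    (hψi : Integrable (fun ω => ψ (iterateWith T x₀ (fun n => ζ n ω) k)) P) :
    Integrable (fun ω => φ (iterateWith T x₀ (fun n => ζ n ω) (k + 1))) P ∧
    ∫ ω, φ (iterateWith T x₀ (fun n => ζ n ω) (k + 1)) ∂P ≤
      ∫ ω, ψ (iterateWith T x₀ (fun n => ζ n ω) k) ∂P := by
  set Xk := fun ω => iterateWith T x₀ (fun n => ζ n ω) k with hXk
  have hX : Measurable Xk :=
    (measurable_iterateWith hT k).comp (measurable_pi_lambda _ fun n => hζ n)
  have hpair : P.map (fun ω => (Xk ω, ζ k ω)) = (P.map Xk).prod ν := by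
    rw [← hlaw k]
    exact (indepFun_iff_map_prod_eq_prod_map_map hX.aemeasurable (hζ k).aemeasurable).1
      (indepFun_iterateWith hT hζ hind k)
  have : IsProbabilityMeasure (P.map Xk) := Measure.isProbabilityMeasure_map hX.aemeasurable
  have hXζ : Measurable fun ω => (Xk ω, ζ k ω) := hX.prodMk (hζ k)
  have hm : Measurable fun p : E × S => φ (T p.1 p.2) := hφ.comp hT
  have hψm : Integrable ψ (P.map Xk) :=
    (integrable_map_measure hψ.aestronglyMeasurable hX.aemeasurable).2 hψi
  have hI : Integrable (fun p : E × S => φ (T p.1 p.2)) ((P.map Xk).prod ν) := by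
    refine (integrable_prod_iff hm.aestronglyMeasurable).2 ⟨.of_forall hi, ?_⟩
    refine hψm.mono' ?_ (.of_forall fun x => ?_)
    · exact hm.aestronglyMeasurable.norm.integral_prod_right'
    · simp only [Real.norm_of_nonneg (hφ0 _)]
      rw [Real.norm_of_nonneg (integral_nonneg fun a => hφ0 _)]
      exact hle x
  have hIint : ∫ p, φ (T p.1 p.2) ∂((P.map Xk).prod ν) ≤ ∫ x, ψ x ∂(P.map Xk) := by
    rw [integral_prod _ hI]
    exact integral_mono hI.integral_prod_left hψm hle
  have e1 : ∀ ω, φ (iterateWith T x₀ (fun n => ζ n ω) (k + 1)) =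
      (fun p : E × S => φ (T p.1 p.2)) (Xk ω, ζ k ω) := fun ω => rfl
  rw [← hpair] at hI hIint
  refine ⟨(integrable_map_measure hm.aestronglyMeasurable hXζ.aemeasurable).1 hI, ?_⟩
  rw [integral_map hXζ.aemeasurable hm.aestronglyMeasurable,
    integral_map hX.aemeasurable hψ.aestronglyMeasurable] at hIint
  exact hIint

variable {Y V G : E → ℝ} {A A' γ e : ℝ}

lemma integral_energy_iterateWith_le [IsProbabilityMeasure P] [IsProbabilityMeasure ν]
    (hT : Measurable fun p : E × S => T p.1 p.2)
    (hζ : ∀ k, Measurable (ζ k)) (hind : iIndepFun ζ P) (hlaw : ∀ k, P.map (ζ k) = ν)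
    (hY : Measurable Y) (hY0 : ∀ x, 0 ≤ Y x) (hA : 0 ≤ A)
    (hi : ∀ x, Integrable (fun a => Y (T x a)) ν) (hle : ∀ x, ∫ a, Y (T x a) ∂ν ≤ A * Y x)
    (k : ℕ) :
    Integrable (fun ω => Y (iterateWith T x₀ (fun n => ζ n ω) k)) P ∧
    ∫ ω, Y (iterateWith T x₀ (fun n => ζ n ω) k) ∂P ≤ A ^ k * Y x₀ := by
  induction k with
  | zero => simp [iterateWith]
  | succ k ih =>
    obtain ⟨h1, h2⟩ := integral_iterateWith_succ_le (x₀ := x₀) hT hζ hind hlaw k hY hY0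
      (hY.const_mul A) hi hle (ih.1.const_mul A)
    refine ⟨h1, h2.trans ?_⟩
    rw [integral_const_mul, pow_succ', mul_assoc]
    exact mul_le_mul_of_nonneg_left ih.2 hA

/-- Telescoping of a Lyapunov inequality along the chain. -/
lemma sum_integral_iterateWith_le [IsProbabilityMeasure P] [IsProbabilityMeasure ν]
    (hT : Measurable fun p : E × S => T p.1 p.2)
    (hζ : ∀ k, Measurable (ζ k)) (hind : iIndepFun ζ P) (hlaw : ∀ k, P.map (ζ k) = ν)
    (hY : Measurable Y) (hY0 : ∀ x, 0 ≤ Y x) (hA : 0 ≤ A)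
    (hi : ∀ x, Integrable (fun a => Y (T x a)) ν) (hle : ∀ x, ∫ a, Y (T x a) ∂ν ≤ A * Y x)
    (hV : Measurable V) (hV0 : ∀ x, 0 ≤ V x) (hVY : ∀ x, V x ≤ A' * Y x)
    (hG : Measurable G) (hG0 : ∀ x, 0 ≤ G x) (hGY : ∀ x, G x ≤ Y x)
    (hstep : ∀ x, ∫ a, V (T x a) ∂ν ≤ V x - γ * G x + e) (n : ℕ) :
    γ * ∑ k ∈ Finset.range n, ∫ ω, G (iterateWith T x₀ (fun n => ζ n ω) k) ∂P ≤
      V x₀ + n * e := by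
  have hXm : ∀ k, Measurable fun ω => iterateWith T x₀ (fun n => ζ n ω) k := fun k =>
    (measurable_iterateWith hT k).comp (measurable_pi_lambda _ fun n => hζ n)
  have iY := fun k => (integral_energy_iterateWith_le (x₀ := x₀) hT hζ hind hlaw hY hY0 hA hi hle
    k).1
  have iV : ∀ k, Integrable (fun ω => V (iterateWith T x₀ (fun n => ζ n ω) k)) P := fun k =>
    ((iY k).const_mul A').mono' (hV.comp (hXm k)).aestronglyMeasurable
      (.of_forall fun ω => by rw [Real.norm_of_nonneg (hV0 _)]; exact hVY _)
  have iG : ∀ k, Integrable (fun ω => G (iterateWith T x₀ (fun n => ζ n ω) k)) P := fun k =>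
    (iY k).mono' (hG.comp (hXm k)).aestronglyMeasurable
      (.of_forall fun ω => by rw [Real.norm_of_nonneg (hG0 _)]; exact hGY _)
  have hVi : ∀ x, Integrable (fun a => V (T x a)) ν := fun x =>
    ((hi x).const_mul A').mono' (hV.comp (hT.comp measurable_prodMk_left)).aestronglyMeasurable
      (.of_forall fun ω => by rw [Real.norm_of_nonneg (hV0 _)]; exact hVY _)
  have key : ∀ n : ℕ, (∫ ω, V (iterateWith T x₀ (fun n => ζ n ω) n) ∂P)
      + γ * ∑ k ∈ Finset.range n, ∫ ω, G (iterateWith T x₀ (fun n => ζ n ω) k) ∂P ≤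
        V x₀ + n * e := by
    intro n
    induction n with
    | zero => simp [iterateWith]
    | succ n ih =>
      have i2 : Integrable (fun ω => V (iterateWith T x₀ (fun n => ζ n ω) n)
          - γ * G (iterateWith T x₀ (fun n => ζ n ω) n)) P := (iV n).sub ((iG n).const_mul γ)
      have h1 := (integral_iterateWith_succ_le (x₀ := x₀) hT hζ hind hlaw n hV hV0
        (ψ := fun x => V x - γ * G x + e) ((hV.sub (hG.const_mul γ)).add_const e) hVi hstep
        (i2.add (integrable_const e))).2
      rw [integral_add i2 (integrable_const e), integral_sub (iV n) ((iG n).const_mul γ),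
        integral_const_mul] at h1
      simp only [integral_const, probReal_univ, one_smul] at h1
      rw [Finset.sum_range_succ]
      push_cast
      linarith
  have h0 : 0 ≤ ∫ ω, V (iterateWith T x₀ (fun n => ζ n ω) n) ∂P := integral_nonneg fun ω => hV0 _
  linarith [key n]

/-- The expectation of a function of a state whose index is uniform on `{1, …, K}` and independent
of the inputs is the average of the expectations. -/
lemma integral_iterateWith_uniform [IsProbabilityMeasure P]
    (hT : Measurable fun p : E × S => T p.1 p.2)
    {N : Ω → ℕ} {K : ℕ} (hK : 1 ≤ K) (hN : Measurable N)
    (hlawN : P.map N = uniformOn (Set.Icc 1 K))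
    (hindN : IndepFun N (fun ω k => ζ k ω) P) (hG : Measurable G)
    (hi : ∀ k, Integrable (fun ω => G (iterateWith T x₀ (fun n => ζ n ω) k)) P) :
    Integrable (fun ω => G (iterateWith T x₀ (fun n => ζ n ω) (N ω))) P ∧
    ∫ ω, G (iterateWith T x₀ (fun n => ζ n ω) (N ω)) ∂P =
      (∑ k ∈ Finset.range K, ∫ ω, G (iterateWith T x₀ (fun n => ζ n ω) (k + 1)) ∂P) / K := by
  have hNk : ∀ k, MeasurableSet (N ⁻¹' {k}) := fun k => hN (measurableSet_singleton k)
  have hprob : ∀ k ∈ Finset.Icc 1 K, P.real (N ⁻¹' {k}) = (K : ℝ)⁻¹ := by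
    intro k hk
    rw [measureReal_def, ← Measure.map_apply hN (measurableSet_singleton k), hlawN]
    have : (Set.Icc 1 K : Set ℕ) = ((Finset.Icc 1 K : Finset ℕ) : Set ℕ) := by simp
    have h2 : ({k} : Set ℕ) = (({k} : Finset ℕ) : Set ℕ) := by simp
    rw [this, h2, uniformOn_apply_finset]
    simp [Finset.inter_singleton_of_mem hk]
  have hae : ∀ᵐ ω ∂P, N ω ∈ Finset.Icc 1 K := by
    have h1 : P.map N (Set.Icc 1 K) = 1 := by
      rw [hlawN]; exact uniformOn_self (Set.finite_Icc 1 K) ⟨1, by simp [hK]⟩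
    rw [Measure.map_apply hN measurableSet_Icc] at h1
    have h2 := (prob_compl_eq_zero_iff (hN measurableSet_Icc)).2 h1
    refine (measure_eq_zero_iff_ae_notMem.1 h2).mono fun ω hω => ?_
    simpa using hω
  set F := fun k ω => (N ⁻¹' {k}).indicator
    (fun ω => G (iterateWith T x₀ (fun n => ζ n ω) k)) ω with hF
  have hsum : (fun ω => G (iterateWith T x₀ (fun n => ζ n ω) (N ω))) =ᵐ[P]
      fun ω => ∑ k ∈ Finset.Icc 1 K, F k ω := by
    filter_upwards [hae] with ω hω
    rw [Finset.sum_eq_single_of_mem (N ω) hω]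
    · simp [hF]
    · intro k _ hk
      simp [hF, Set.indicator, Ne.symm hk]
  have iF : ∀ k ∈ Finset.Icc 1 K, Integrable (F k) P := fun k _ => (hi k).indicator (hNk k)
  refine ⟨(integrable_finsetSum _ iF).congr hsum.symm, ?_⟩
  rw [integral_congr_ae hsum, integral_finsetSum _ iF]
  have hterm : ∀ k ∈ Finset.Icc 1 K, ∫ ω, F k ω ∂P =
      (K : ℝ)⁻¹ * ∫ ω, G (iterateWith T x₀ (fun n => ζ n ω) k) ∂P := by
    intro k hk
    have hm1 : Measurable (({k} : Set ℕ).indicator fun _ => (1 : ℝ)) :=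
      measurable_const.indicator (measurableSet_singleton k)
    have hind := hindN.comp (φ := ({k} : Set ℕ).indicator fun _ => (1 : ℝ))
      (ψ := fun a : ℕ → S => G (iterateWith T x₀ a k))
      hm1 (hG.comp (measurable_iterateWith hT k))
    have h1 := hind.integral_mul_eq_mul_integral
      (hm1.comp hN).aestronglyMeasurable
      (hi k).aestronglyMeasurable
    have h2 : ∫ ω, (({k} : Set ℕ).indicator (fun _ => (1 : ℝ)) ∘ N) ω ∂P = (K : ℝ)⁻¹ := by
      have : (({k} : Set ℕ).indicator (fun _ => (1 : ℝ)) ∘ N) =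
          (N ⁻¹' {k}).indicator fun _ => (1 : ℝ) := by
        funext ω; simp [Set.indicator, Pi.single_apply]
      rw [this, integral_indicator_const _ (hNk k), hprob k hk]; simp
    rw [← h2]
    refine Eq.trans ?_ h1
    refine integral_congr_ae (.of_forall fun ω => ?_)
    simp [hF, Set.indicator, Pi.single_apply]
  rw [Finset.sum_congr rfl hterm, ← Finset.mul_sum, div_eq_inv_mul]
  congr 1
  rw [Finset.range_eq_Ico, Finset.sum_Ico_add' (fun k =>
    ∫ ω, G (iterateWith T x₀ (fun n => ζ n ω) k) ∂P) 0 K 1]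
  rfl

end Chain

/-! ### The joint space -/

section Joint

variable {m d : ℕ}

@[simp] lemma lamPart_pair (a : Vec m) (b : Vec d) : lamPart (pair a b) = a := rfl

@[simp] lemma wPart_pair (a : Vec m) (b : Vec d) : wPart (pair a b) = b := rfl

lemma pair_add (a a' : Vec m) (b b' : Vec d) : pair (a + a') (b + b') = pair a b + pair a' b' := by
  ext i; cases i <;> rfl

lemma pair_sub (a a' : Vec m) (b b' : Vec d) : pair (a - a') (b - b') = pair a b - pair a' b' := by
  ext i; cases i <;> rfl

lemma pair_smul (t : ℝ) (a : Vec m) (b : Vec d) : pair (t • a) (t • b) = t • pair a b := by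
  ext i; cases i <;> rfl

lemma inner_pair_left (a : Vec m) (b : Vec d) (z : Joint m d) :
    inner ℝ (pair a b) z = inner ℝ a (lamPart z) + inner ℝ b (wPart z) := by
  simp [PiLp.inner_apply, pair, lamPart, wPart]

lemma norm_sq_eq_lamPart_add_wPart (z : Joint m d) :
    ‖z‖ ^ 2 = ‖lamPart z‖ ^ 2 + ‖wPart z‖ ^ 2 := by
  simp [EuclideanSpace.norm_sq_eq, lamPart, wPart]

lemma norm_lamPart_le (z : Joint m d) : ‖lamPart z‖ ≤ ‖z‖ :=
  abs_le_of_sq_le_sq' (by nlinarith [norm_sq_eq_lamPart_add_wPart z, sq_nonneg ‖wPart z‖])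
    (norm_nonneg z) |>.2

lemma norm_wPart_le (z : Joint m d) : ‖wPart z‖ ≤ ‖z‖ :=
  abs_le_of_sq_le_sq' (by nlinarith [norm_sq_eq_lamPart_add_wPart z, sq_nonneg ‖lamPart z‖])
    (norm_nonneg z) |>.2

lemma norm_pair_le (a : Vec m) (b : Vec d) : ‖pair a b‖ ≤ ‖a‖ + ‖b‖ := by
  have h := norm_sq_eq_lamPart_add_wPart (pair a b)
  rw [lamPart_pair, wPart_pair] at h
  refine abs_le_of_sq_le_sq' ?_ (by positivity) |>.2
  nlinarith [mul_nonneg (norm_nonneg a) (norm_nonneg b)]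

/-- `lamPart` as a continuous linear map. -/
noncomputable def lamPartCLM (m d : ℕ) : Joint m d →L[ℝ] Vec m :=
  LinearMap.mkContinuous
    { toFun := lamPart, map_add' := fun _ _ => rfl, map_smul' := fun _ _ => rfl } 1
    fun z => by rw [one_mul]; exact norm_lamPart_le z

/-- `wPart` as a continuous linear map. -/
noncomputable def wPartCLM (m d : ℕ) : Joint m d →L[ℝ] Vec d :=
  LinearMap.mkContinuous
    { toFun := wPart, map_add' := fun _ _ => rfl, map_smul' := fun _ _ => rfl } 1
    fun z => by rw [one_mul]; exact norm_wPart_le z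

/-- `pair` as a continuous linear map on the product. -/
noncomputable def pairCLM (m d : ℕ) : Vec m × Vec d →L[ℝ] Joint m d :=
  LinearMap.mkContinuous
    { toFun := fun p => pair p.1 p.2
      map_add' := fun p q => pair_add _ _ _ _
      map_smul' := fun t p => pair_smul _ _ _ } 2
    fun p => by
      have h1 := norm_fst_le p
      have h2 := norm_snd_le p
      have h3 := norm_pair_le p.1 p.2
      simp only [LinearMap.coe_mk, AddHom.coe_mk]
      linarith

@[simp] lemma lamPartCLM_apply (z : Joint m d) : lamPartCLM m d z = lamPart z := rfl

@[simp] lemma wPartCLM_apply (z : Joint m d) : wPartCLM m d z = wPart z := rfl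

@[simp] lemma pairCLM_apply (p : Vec m × Vec d) : pairCLM m d p = pair p.1 p.2 := rfl

lemma lamPart_sub (y z : Joint m d) : lamPart (y - z) = lamPart y - lamPart z := rfl

lemma wPart_sub (y z : Joint m d) : wPart (y - z) = wPart y - wPart z := rfl

lemma lamPart_add (y z : Joint m d) : lamPart (y + z) = lamPart y + lamPart z := rfl

lemma wPart_add (y z : Joint m d) : wPart (y + z) = wPart y + wPart z := rfl

lemma pair_sub_pair_left (a a' : Vec m) (b : Vec d) : pair a b - pair a' b = pair (a - a') 0 := by
  rw [← pair_sub, sub_self]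

lemma pair_sub_pair_right (a : Vec m) (b b' : Vec d) : pair a b - pair a b' = pair 0 (b - b') := by
  rw [← pair_sub, sub_self]

lemma norm_pair_zero_left (b : Vec d) : ‖pair (0 : Vec m) b‖ ≤ ‖b‖ := by
  simpa using norm_pair_le (0 : Vec m) b

lemma norm_pair_zero_right (a : Vec m) : ‖pair a (0 : Vec d)‖ ≤ ‖a‖ := by
  simpa using norm_pair_le a (0 : Vec d)

lemma continuous_pair : Continuous fun p : Vec m × Vec d => pair p.1 p.2 :=
  (pairCLM m d).continuous

lemma hasFDerivAt_pair_right (lam : Vec m) (w : Vec d) :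
    HasFDerivAt (fun w : Vec d => pair lam w)
      ((pairCLM m d).comp (ContinuousLinearMap.inr ℝ (Vec m) (Vec d))) w := by
  have := (pairCLM m d).hasFDerivAt (x := (lam, w)) |>.comp w (hasFDerivAt_prodMk_right lam w)
  exact this

/-- The partial gradient in `w`. -/
lemma hasGradientAt_pair_right {L : Joint m d → ℝ} (hL : Differentiable ℝ L) (lam : Vec m)
    (w : Vec d) :
    HasGradientAt (fun w => L (pair lam w)) (wPart (∇ L (pair lam w))) w := by
  rw [hasGradientAt_iff_hasFDerivAt]
  have h := ((hL (pair lam w)).hasGradientAt.hasFDerivAt).comp w (hasFDerivAt_pair_right lam w)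
  refine h.congr_fderiv ?_
  ext v
  simp only [ContinuousLinearMap.comp_apply, InnerProductSpace.toDual_apply_apply,
    ContinuousLinearMap.inr_apply, pairCLM_apply]
  rw [real_inner_comm, inner_pair_left, inner_zero_left, zero_add, real_inner_comm]

end Joint

/-! ### Convexity and Taylor bounds -/

section Calculus

variable {E : Type*} [NormedAddCommGroup E] [InnerProductSpace ℝ E]

lemma StrongConvexOn.add_inner_add_sq_le [CompleteSpace E] {f : E → ℝ} {μ : ℝ}
    (hf : StrongConvexOn Set.univ μ f)
    {x g : E} (hg : HasGradientAt f g x) (y : E) :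
    f x + inner ℝ g (y - x) + μ / 2 * ‖y - x‖ ^ 2 ≤ f y := by
  have hc := strongConvexOn_iff_convex.1 hf
  set F := fun x => f x - μ / 2 * ‖x‖ ^ 2 with hF
  have hline : ConvexOn ℝ Set.univ (F ∘ AffineMap.lineMap (k := ℝ) x y) := by
    simpa using hc.comp_affineMap (AffineMap.lineMap (k := ℝ) x y)
  have hl : HasDerivAt (AffineMap.lineMap (k := ℝ) x y : ℝ → E) (y - x) 0 :=
    AffineMap.hasDerivAt_lineMap
  have hfx : HasFDerivAt f (InnerProductSpace.toDual ℝ E g)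
      ((AffineMap.lineMap x y : ℝ → E) 0) := by
    rw [AffineMap.lineMap_apply_zero]; exact hg.hasFDerivAt
  have h1 := hfx.comp_hasDerivAt (0 : ℝ) hl
  have h2 := (hl.norm_sq).const_mul (μ / 2)
  have hd := (h1.sub h2)
  have hs := hline.le_slope_of_hasDerivAt (Set.mem_univ 0) (Set.mem_univ 1) zero_lt_one hd
  rw [slope_def_field] at hs
  simp only [Function.comp_apply, AffineMap.lineMap_apply_one, AffineMap.lineMap_apply_zero,
    InnerProductSpace.toDual_apply_apply, hF, sub_zero, div_one] at hs
  have h3 := norm_sub_sq_real y x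
  have h4 : inner ℝ x (y - x) = inner ℝ y x - ‖x‖ ^ 2 := by
    rw [inner_sub_right, real_inner_self_eq_norm_sq, real_inner_comm]
  rw [h4] at hs
  rw [h3]
  linarith

lemma norm_sub_sub_fderiv_le {F : Type*} [NormedAddCommGroup F] [NormedSpace ℝ F] {φ : E → F}
    {l : ℝ≥0} (hφ : Differentiable ℝ φ) (hl : LipschitzWith l (fderiv ℝ φ)) (x y : E) :
    ‖φ y - φ x - fderiv ℝ φ x (y - x)‖ ≤ l * ‖y - x‖ ^ 2 := by
  have h := (convex_segment x y).norm_image_sub_le_of_norm_fderiv_le' (𝕜 := ℝ) (f := φ)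
    (φ := fderiv ℝ φ x) (C := l * ‖y - x‖) (fun z _ => hφ z) (fun z hz => ?_)
    (left_mem_segment ℝ x y) (right_mem_segment ℝ x y)
  · calc _ ≤ l * ‖y - x‖ * ‖y - x‖ := h
      _ = _ := by ring
  · refine (hl.norm_sub_le z x).trans ?_
    gcongr
    exact norm_sub_le_of_mem_segment hz

/-- The quadratic upper bound for functions with Lipschitz gradient. -/
lemma le_add_inner_add_sq_of_lipschitz_gradient [CompleteSpace E] {f : E → ℝ} {G : E → E} {l : ℝ}
    (hG : ∀ x, HasGradientAt f (G x) x) (hl : ∀ x y, ‖G x - G y‖ ≤ l * ‖x - y‖) (hl0 : 0 ≤ l)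
    (x y : E) : f y ≤ f x + inner ℝ (G x) (y - x) + l * ‖y - x‖ ^ 2 := by
  have h := (convex_segment x y).norm_image_sub_le_of_norm_hasFDerivWithin_le' (𝕜 := ℝ)
    (f := f) (f' := fun z => InnerProductSpace.toDual ℝ E (G z))
    (φ := InnerProductSpace.toDual ℝ E (G x)) (C := l * ‖y - x‖)
    (fun z _ => (hG z).hasFDerivAt.hasFDerivWithinAt) (fun z hz => ?_)
    (left_mem_segment ℝ x y) (right_mem_segment ℝ x y)
  · rw [InnerProductSpace.toDual_apply_apply] at h
    have h1 := (abs_le.1 (Real.norm_eq_abs _ ▸ h)).2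
    nlinarith
  · rw [← map_sub, LinearIsometryEquiv.norm_map]
    refine (hl z x).trans ?_
    gcongr
    exact norm_sub_le_of_mem_segment hz

end Calculus

/-! ### The lower-level solution map and the hypergradient -/

namespace BilevelRegularity

variable {m d : ℕ} {L₁ L₂ : Joint m d → ℝ} {l₁₀ l₁₁ l₂₁ l₂₂ : ℝ≥0} {μ₂ : ℝ}

lemma add_inner_add_sq_le (H : BilevelRegularity L₁ L₂ l₁₀ l₁₁ l₂₁ l₂₂ μ₂) (lam : Vec m)
    (w v : Vec d) :
    L₂ (pair lam w) + inner ℝ (wPart (∇ L₂ (pair lam w))) (v - w) + μ₂ / 2 * ‖v - w‖ ^ 2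
      ≤ L₂ (pair lam v) :=
  (H.lower_strongConvex lam).add_inner_add_sq_le
    (hasGradientAt_pair_right H.lower_differentiable lam w) v

lemma strongly_monotone (H : BilevelRegularity L₁ L₂ l₁₀ l₁₁ l₂₁ l₂₂ μ₂) (lam : Vec m)
    (w v : Vec d) :
    μ₂ * ‖w - v‖ ^ 2 ≤
      inner ℝ (wPart (∇ L₂ (pair lam w)) - wPart (∇ L₂ (pair lam v))) (w - v) := by
  have h1 := H.add_inner_add_sq_le lam w v
  have h2 := H.add_inner_add_sq_le lam v w
  rw [norm_sub_rev v w, ← neg_sub w v, inner_neg_right] at h1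
  rw [inner_sub_left]
  linarith

lemma lowerArgmin_spec (H : BilevelRegularity L₁ L₂ l₁₀ l₁₁ l₂₁ l₂₂ μ₂) (hμ : 0 < μ₂)
    (lam : Vec m) (v : Vec d) : L₂ (pair lam (lowerArgmin L₂ lam)) ≤ L₂ (pair lam v) := by
  have hex : ∃ w : Vec d, ∀ v, L₂ (pair lam w) ≤ L₂ (pair lam v) := by
    have hc : Continuous fun w : Vec d => L₂ (pair lam w) :=
      H.lower_differentiable.continuous.comp (continuous_pair.comp (Continuous.prodMk_right lam))
    refine hc.exists_forall_le' 0 ?_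
    set g := wPart (∇ L₂ (pair lam (0 : Vec d))) with hg
    refine Filter.mem_of_superset
      (isCompact_closedBall (0 : Vec d) (2 * ‖g‖ / μ₂)).compl_mem_cocompact fun v hv => ?_
    rw [Set.mem_compl_iff, Metric.mem_closedBall, dist_zero_right, not_le, div_lt_iff₀ hμ] at hv
    have h1 := H.add_inner_add_sq_le lam 0 v
    rw [sub_zero] at h1
    have h2 := (abs_le.1 (abs_real_inner_le_norm g v)).1
    have h3 : 0 ≤ ‖v‖ * (μ₂ / 2 * ‖v‖ - ‖g‖) := mul_nonneg (norm_nonneg _) (by linarith)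
    show L₂ (pair lam 0) ≤ L₂ (pair lam v)
    nlinarith
  exact Classical.epsilon_spec hex v

lemma wPart_gradient_lowerArgmin (H : BilevelRegularity L₁ L₂ l₁₀ l₁₁ l₂₁ l₂₂ μ₂) (hμ : 0 < μ₂)
    (lam : Vec m) : wPart (∇ L₂ (pair lam (lowerArgmin L₂ lam))) = 0 := by
  have hmin : IsLocalMin (fun w : Vec d => L₂ (pair lam w)) (lowerArgmin L₂ lam) :=
    Filter.Eventually.of_forall fun v => H.lowerArgmin_spec hμ lam v
  have h := hmin.hasFDerivAt_eq_zero
    (hasGradientAt_pair_right H.lower_differentiable lam (lowerArgmin L₂ lam)).hasFDerivAt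
  simpa using h

lemma norm_gradient_sub_le (H : BilevelRegularity L₁ L₂ l₁₀ l₁₁ l₂₁ l₂₂ μ₂) (y z : Joint m d) :
    ‖∇ L₂ y - ∇ L₂ z‖ ≤ l₂₁ * ‖y - z‖ := H.lower_gradient_lipschitz.norm_sub_le y z

/-- The lower-level solution map is Lipschitz. -/
lemma norm_lowerArgmin_sub_le (H : BilevelRegularity L₁ L₂ l₁₀ l₁₁ l₂₁ l₂₂ μ₂) (hμ : 0 < μ₂)
    (x y : Vec m) : ‖lowerArgmin L₂ x - lowerArgmin L₂ y‖ ≤ l₂₁ / μ₂ * ‖x - y‖ := by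
  set a := lowerArgmin L₂ x with ha
  set b := lowerArgmin L₂ y with hb
  have h1 := H.strongly_monotone x a b
  have h2 : wPart (∇ L₂ (pair x a)) = 0 := H.wPart_gradient_lowerArgmin hμ x
  have h3 : wPart (∇ L₂ (pair y b)) = 0 := H.wPart_gradient_lowerArgmin hμ y
  have h4 : ‖wPart (∇ L₂ (pair y b)) - wPart (∇ L₂ (pair x b))‖ ≤ l₂₁ * ‖x - y‖ := by
    rw [← wPart_sub]
    refine (norm_wPart_le _).trans ((H.norm_gradient_sub_le _ _).trans ?_)
    rw [pair_sub_pair_left, norm_sub_rev x y]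
    gcongr
    exact norm_pair_zero_right _
  rw [h2, ← h3] at h1
  have h5 := h1.trans ((real_inner_le_norm _ _).trans
    (mul_le_mul_of_nonneg_right h4 (norm_nonneg (a - b))))
  rcases (norm_nonneg (a - b)).eq_or_lt with h0 | h0
  · rw [← h0]; positivity
  · rw [div_mul_eq_mul_div, le_div_iff₀ hμ]
    nlinarith

lemma norm_gradient_taylor_le (H : BilevelRegularity L₁ L₂ l₁₀ l₁₁ l₂₁ l₂₂ μ₂)
    (y z : Joint m d) :
    ‖∇ L₂ z - ∇ L₂ y - fderiv ℝ (∇ L₂) y (z - y)‖ ≤ l₂₂ * ‖z - y‖ ^ 2 :=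
  norm_sub_sub_fderiv_le H.lower_gradient_differentiable H.lower_hessian_lipschitz y z

/-- The lower-level Hessian is bounded below by the strong convexity constant. -/
lemma hessian_coercive (H : BilevelRegularity L₁ L₂ l₁₀ l₁₁ l₂₁ l₂₂ μ₂) (lam : Vec m)
    (w v : Vec d) :
    μ₂ * ‖v‖ ^ 2 ≤ inner ℝ (wPart (fderiv ℝ (∇ L₂) (pair lam w) (pair 0 v))) v := by
  set Dz := fderiv ℝ (∇ L₂) (pair lam w) with hDz
  have key : ∀ t : ℝ, 0 < t →
      μ₂ * ‖v‖ ^ 2 ≤ inner ℝ (wPart (Dz (pair 0 v))) v + t * (l₂₂ * ‖v‖ ^ 3) := by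
    intro t ht
    have h1 := H.strongly_monotone lam (w + t • v) w
    have h2 := H.norm_gradient_taylor_le (pair lam w) (pair lam (w + t • v))
    have h3 : pair lam (w + t • v) - pair lam w = t • pair 0 v := by
      rw [pair_sub_pair_right, add_sub_cancel_left, ← pair_smul, smul_zero]
    rw [h3, map_smul, ← hDz] at h2
    set r := ∇ L₂ (pair lam (w + t • v)) - ∇ L₂ (pair lam w) - t • Dz (pair 0 v) with hr
    have h4 : wPart (∇ L₂ (pair lam (w + t • v))) - wPart (∇ L₂ (pair lam w)) =
        t • wPart (Dz (pair 0 v)) + wPart r := by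
      have : wPart (t • Dz (pair 0 v)) = t • wPart (Dz (pair 0 v)) := rfl
      rw [hr, wPart_sub, wPart_sub, this]; abel
    have h5 : ‖wPart r‖ ≤ l₂₂ * (t ^ 2 * ‖v‖ ^ 2) := by
      refine (norm_wPart_le _).trans (h2.trans ?_)
      rw [norm_smul, mul_pow, Real.norm_of_nonneg ht.le]
      gcongr
      exact norm_pair_zero_left v
    rw [add_sub_cancel_left, h4, norm_smul, Real.norm_of_nonneg ht.le, inner_smul_right,
      inner_add_left, inner_smul_left] at h1
    simp only [conj_trivial] at h1
    have h6 := real_inner_le_norm (wPart r) v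
    have h7 := mul_le_mul_of_nonneg_right h5 (norm_nonneg v)
    have h8 : t ^ 2 * (μ₂ * ‖v‖ ^ 2) ≤
        t ^ 2 * (inner ℝ (wPart (Dz (pair 0 v))) v + t * (l₂₂ * ‖v‖ ^ 3)) := by
      nlinarith
    exact le_of_mul_le_mul_left h8 (by positivity)
  by_contra hcon
  push Not at hcon
  set G := inner ℝ (wPart (Dz (pair 0 v))) v
  set R := (l₂₂ : ℝ) * ‖v‖ ^ 3 with hR
  have hR0 : 0 ≤ R := by positivity
  have h1 := key ((μ₂ * ‖v‖ ^ 2 - G) / (2 * (R + 1))) (div_pos (by linarith) (by positivity))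
  have h2 : (μ₂ * ‖v‖ ^ 2 - G) / (2 * (R + 1)) * R ≤ (μ₂ * ‖v‖ ^ 2 - G) / 2 := by
    rw [div_mul_eq_mul_div, div_le_div_iff₀ (by positivity) (by norm_num)]
    nlinarith
  linarith

/-- The linearized first-order condition of the lower level is solvable. -/
lemma exists_implicit_derivative (H : BilevelRegularity L₁ L₂ l₁₀ l₁₁ l₂₁ l₂₂ μ₂) (hμ : 0 < μ₂)
    (lam : Vec m) (w : Vec d) : ∃ W : Vec m →L[ℝ] Vec d, ∀ v,
      wPart (fderiv ℝ (∇ L₂) (pair lam w) (pair v (W v))) = 0 := by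
  set Dz := fderiv ℝ (∇ L₂) (pair lam w) with hDz
  set A : Vec d →L[ℝ] Vec d := (wPartCLM m d).comp (Dz.comp ((pairCLM m d).comp
    (ContinuousLinearMap.inr ℝ (Vec m) (Vec d)))) with hA
  set Bm : Vec m →L[ℝ] Vec d := (wPartCLM m d).comp (Dz.comp ((pairCLM m d).comp
    (ContinuousLinearMap.inl ℝ (Vec m) (Vec d)))) with hBm
  have hinj : Function.Injective A.toLinearMap := by
    rw [← LinearMap.ker_eq_bot, LinearMap.ker_eq_bot']
    intro v hv
    have h1 := H.hessian_coercive lam w v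
    have h2 : wPart (Dz (pair 0 v)) = 0 := hv
    rw [← hDz, h2, inner_zero_left] at h1
    have h3 : ‖v‖ ^ 2 ≤ 0 := nonpos_of_mul_nonpos_right h1 hμ
    exact norm_eq_zero.1 (pow_eq_zero_iff two_ne_zero |>.1 (le_antisymm h3 (sq_nonneg _)))
  set e := LinearEquiv.ofInjectiveEndo A.toLinearMap hinj with he
  refine ⟨LinearMap.toContinuousLinearMap (-(e.symm.toLinearMap ∘ₗ Bm.toLinearMap)), fun v => ?_⟩
  have h1 : A (e.symm (Bm v)) = Bm v := e.apply_symm_apply (Bm v)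
  have h2 : pair v (-(e.symm (Bm v))) = pair v 0 - pair 0 (e.symm (Bm v)) := by
    rw [← pair_sub, sub_zero, zero_sub]
  show wPart (Dz (pair v (-(e.symm (Bm v))))) = 0
  rw [h2, map_sub, wPart_sub]
  show Bm v - A (e.symm (Bm v)) = 0
  rw [h1, sub_self]

lemma hasFDerivAt_lowerArgmin (H : BilevelRegularity L₁ L₂ l₁₀ l₁₁ l₂₁ l₂₂ μ₂) (hμ : 0 < μ₂)
    {lam : Vec m} {W : Vec m →L[ℝ] Vec d}
    (hW : ∀ v, wPart (fderiv ℝ (∇ L₂) (pair lam (lowerArgmin L₂ lam)) (pair v (W v))) = 0) :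
    HasFDerivAt (lowerArgmin L₂) W lam := by
  set z := pair lam (lowerArgmin L₂ lam) with hz
  set Dz := fderiv ℝ (∇ L₂) z with hDz
  set p : ℝ := l₂₁ / μ₂ with hp
  have hp0 : 0 ≤ p := by positivity
  have key : ∀ x, ‖lowerArgmin L₂ x - lowerArgmin L₂ lam - W (x - lam)‖ ≤
      l₂₂ * (1 + p) ^ 2 / μ₂ * ‖x - lam‖ ^ 2 := by
    intro x
    set y := lowerArgmin L₂ x - lowerArgmin L₂ lam - W (x - lam) with hy
    have hzx : pair x (lowerArgmin L₂ x) - z = pair (x - lam) (W (x - lam)) + pair 0 y := by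
      rw [hz, ← pair_sub, ← pair_add, hy, add_zero, add_sub_cancel]
    have h1 := H.norm_gradient_taylor_le z (pair x (lowerArgmin L₂ x))
    rw [← hDz] at h1
    have h2 : wPart (∇ L₂ (pair x (lowerArgmin L₂ x)) - ∇ L₂ z
        - Dz (pair x (lowerArgmin L₂ x) - z)) = -wPart (Dz (pair 0 y)) := by
      rw [wPart_sub, wPart_sub, H.wPart_gradient_lowerArgmin hμ, hz,
        H.wPart_gradient_lowerArgmin hμ, ← hz, hzx, map_add, wPart_add, hW]
      simp
    have h3 : ‖wPart (Dz (pair 0 y))‖ ≤ l₂₂ * ((1 + p) ^ 2 * ‖x - lam‖ ^ 2) := by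
      rw [← norm_neg, ← h2]
      refine (norm_wPart_le _).trans (h1.trans ?_)
      have h4 : ‖pair x (lowerArgmin L₂ x) - z‖ ≤ (1 + p) * ‖x - lam‖ := by
        rw [hz, ← pair_sub]
        refine (norm_pair_le _ _).trans ?_
        linarith [H.norm_lowerArgmin_sub_le hμ x lam]
      rw [← mul_pow]
      gcongr
    have h5 := H.hessian_coercive lam (lowerArgmin L₂ lam) y
    rw [← hz, ← hDz] at h5
    have h6 := h5.trans ((real_inner_le_norm _ _).trans
      (mul_le_mul_of_nonneg_right h3 (norm_nonneg y)))
    rcases (norm_nonneg y).eq_or_lt with h0 | h0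
    · rw [← h0]; positivity
    · rw [div_mul_eq_mul_div, le_div_iff₀ hμ]
      nlinarith
  rw [hasFDerivAt_iff_isLittleO]
  refine Asymptotics.IsBigO.trans_isLittleO (g := fun x => ‖x - lam‖ ^ 2)
    (Asymptotics.IsBigO.of_bound (l₂₂ * (1 + p) ^ 2 / μ₂) (.of_forall fun x => ?_)) ?_
  · rw [Real.norm_of_nonneg (by positivity)]; exact key x
  · exact Asymptotics.isLittleO_pow_sub_sub lam one_lt_two

lemma differentiable_lowerArgmin (H : BilevelRegularity L₁ L₂ l₁₀ l₁₁ l₂₁ l₂₂ μ₂)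
    (hμ : 0 < μ₂) : Differentiable ℝ (lowerArgmin L₂) := fun lam => by
  obtain ⟨W, hW⟩ := H.exists_implicit_derivative hμ lam (lowerArgmin L₂ lam)
  exact (H.hasFDerivAt_lowerArgmin hμ hW).differentiableAt

/-- Implicit differentiation of the first-order condition of the lower level. -/
lemma wPart_hessian_fderiv_lowerArgmin (H : BilevelRegularity L₁ L₂ l₁₀ l₁₁ l₂₁ l₂₂ μ₂)
    (hμ : 0 < μ₂) (lam v : Vec m) :
    wPart (fderiv ℝ (∇ L₂) (pair lam (lowerArgmin L₂ lam))
      (pair v (fderiv ℝ (lowerArgmin L₂) lam v))) = 0 := by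
  obtain ⟨W, hW⟩ := H.exists_implicit_derivative hμ lam (lowerArgmin L₂ lam)
  rw [(H.hasFDerivAt_lowerArgmin hμ hW).fderiv]
  exact hW v

lemma norm_fderiv_lowerArgmin_le (H : BilevelRegularity L₁ L₂ l₁₀ l₁₁ l₂₁ l₂₂ μ₂)
    (hμ : 0 < μ₂) (lam : Vec m) : ‖fderiv ℝ (lowerArgmin L₂) lam‖ ≤ l₂₁ / μ₂ :=
  norm_fderiv_le_of_lip' ℝ (by positivity)
    (.of_forall fun x => H.norm_lowerArgmin_sub_le hμ x lam)

lemma norm_pair_lowerArgmin_sub_le (H : BilevelRegularity L₁ L₂ l₁₀ l₁₁ l₂₁ l₂₂ μ₂)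
    (hμ : 0 < μ₂) (x y : Vec m) :
    ‖pair x (lowerArgmin L₂ x) - pair y (lowerArgmin L₂ y)‖ ≤ (1 + l₂₁ / μ₂) * ‖x - y‖ := by
  rw [← pair_sub]
  refine (norm_pair_le _ _).trans ?_
  linarith [H.norm_lowerArgmin_sub_le hμ x y]

/-- The derivative of the lower-level solution map is Lipschitz. -/
lemma norm_fderiv_lowerArgmin_sub_le (H : BilevelRegularity L₁ L₂ l₁₀ l₁₁ l₂₁ l₂₂ μ₂)
    (hμ : 0 < μ₂) (x y : Vec m) :
    ‖fderiv ℝ (lowerArgmin L₂) x - fderiv ℝ (lowerArgmin L₂) y‖ ≤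
      l₂₂ * (1 + l₂₁ / μ₂) ^ 2 / μ₂ * ‖x - y‖ := by
  set p : ℝ := l₂₁ / μ₂ with hp
  have hp0 : 0 ≤ p := by positivity
  refine ContinuousLinearMap.opNorm_le_bound _ (by positivity) fun v => ?_
  set Dx := fderiv ℝ (∇ L₂) (pair x (lowerArgmin L₂ x)) with hDx
  set Dy := fderiv ℝ (∇ L₂) (pair y (lowerArgmin L₂ y)) with hDy
  set a := fderiv ℝ (lowerArgmin L₂) x v with ha
  set b := fderiv ℝ (lowerArgmin L₂) y v with hb
  have h1 : wPart (Dx (pair v a)) = 0 := H.wPart_hessian_fderiv_lowerArgmin hμ x v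
  have h2 : wPart (Dy (pair v b)) = 0 := H.wPart_hessian_fderiv_lowerArgmin hμ y v
  have h3 : wPart (Dx (pair 0 (a - b))) = wPart ((Dy - Dx) (pair v b)) := by
    rw [← pair_sub_pair_right v a b, map_sub, wPart_sub, h1, sub_apply, wPart_sub, h2]
  have h4 : ‖wPart ((Dy - Dx) (pair v b))‖ ≤
      l₂₂ * ((1 + p) * ‖x - y‖) * ((1 + p) * ‖v‖) := by
    refine (norm_wPart_le _).trans ((ContinuousLinearMap.le_opNorm _ _).trans ?_)
    have hb' : ‖b‖ ≤ p * ‖v‖ :=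
      ContinuousLinearMap.le_of_opNorm_le _ (H.norm_fderiv_lowerArgmin_le hμ y) v
    have h5 : ‖Dy - Dx‖ ≤ l₂₂ * ((1 + p) * ‖x - y‖) := by
      rw [norm_sub_rev]
      refine (H.lower_hessian_lipschitz.norm_sub_le _ _).trans ?_
      gcongr
      exact H.norm_pair_lowerArgmin_sub_le hμ x y
    have h6 : ‖pair v b‖ ≤ (1 + p) * ‖v‖ := (norm_pair_le _ _).trans (by linarith)
    gcongr
  have h5 := H.hessian_coercive x (lowerArgmin L₂ x) (a - b)
  rw [← hDx, h3] at h5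
  have h6 := h5.trans ((real_inner_le_norm _ _).trans
    (mul_le_mul_of_nonneg_right h4 (norm_nonneg (a - b))))
  rw [sub_apply, ← ha, ← hb]
  rcases (norm_nonneg (a - b)).eq_or_lt with h0 | h0
  · rw [← h0]; positivity
  · rw [div_mul_eq_mul_div, div_mul_eq_mul_div, le_div_iff₀ hμ]
    have h7 : ‖a - b‖ * (‖a - b‖ * μ₂) ≤
        ‖a - b‖ * (l₂₂ * (1 + p) ^ 2 * ‖x - y‖ * ‖v‖) := by nlinarith
    exact le_of_mul_le_mul_left h7 h0

/-- The Hessian of the lower-level objective is symmetric. -/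
lemma inner_hessian_comm (H : BilevelRegularity L₁ L₂ l₁₀ l₁₁ l₂₁ l₂₂ μ₂) (z u v : Joint m d) :
    inner ℝ (fderiv ℝ (∇ L₂) z u) v = inner ℝ (fderiv ℝ (∇ L₂) z v) u := by
  have hD : HasFDerivAt (fun y => InnerProductSpace.toDual ℝ (Joint m d) (∇ L₂ y))
      ((InnerProductSpace.toDual ℝ (Joint m d)).toContinuousLinearEquiv.toContinuousLinearMap.comp
        (fderiv ℝ (∇ L₂) z)) z :=
    (InnerProductSpace.toDual ℝ (Joint m d)).toContinuousLinearEquiv.toContinuousLinearMap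
      |>.hasFDerivAt.comp z (H.lower_gradient_differentiable z).hasFDerivAt
  have h := second_derivative_symmetric (𝕜 := ℝ) (f := L₂)
    (fun y => (H.lower_differentiable y).hasGradientAt.hasFDerivAt) hD u v
  simpa using h

/-- The adjoint of the derivative of the lower-level solution map. -/
noncomputable def _root_.solutionAdjoint (L₂ : Joint m d → ℝ) (lam : Vec m) : Vec d →L[ℝ] Vec m :=
  ContinuousLinearMap.adjoint (fderiv ℝ (lowerArgmin L₂) lam)

lemma norm_solutionAdjoint_le (H : BilevelRegularity L₁ L₂ l₁₀ l₁₁ l₂₁ l₂₂ μ₂)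
    (hμ : 0 < μ₂) (lam : Vec m) : ‖solutionAdjoint L₂ lam‖ ≤ l₂₁ / μ₂ := by
  rw [solutionAdjoint, LinearIsometryEquiv.norm_map]
  exact H.norm_fderiv_lowerArgmin_le hμ lam

lemma norm_solutionAdjoint_sub_le (H : BilevelRegularity L₁ L₂ l₁₀ l₁₁ l₂₁ l₂₂ μ₂)
    (hμ : 0 < μ₂) (x y : Vec m) : ‖solutionAdjoint L₂ x - solutionAdjoint L₂ y‖ ≤
      l₂₂ * (1 + l₂₁ / μ₂) ^ 2 / μ₂ * ‖x - y‖ := by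
  rw [solutionAdjoint, solutionAdjoint, ← map_sub, LinearIsometryEquiv.norm_map]
  exact H.norm_fderiv_lowerArgmin_sub_le hμ x y

/-- The gradient of the bilevel objective. -/
noncomputable def _root_.hypergradient (L₁ L₂ : Joint m d → ℝ) (lam : Vec m) : Vec m :=
  lamPart (∇ L₁ (pair lam (lowerArgmin L₂ lam)))
    + solutionAdjoint L₂ lam (wPart (∇ L₁ (pair lam (lowerArgmin L₂ lam))))

lemma upper_differentiable (H : BilevelRegularity L₁ L₂ l₁₀ l₁₁ l₂₁ l₂₂ μ₂) :
    Differentiable ℝ L₁ := H.upper_contDiff.differentiable (by norm_num)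

lemma hasGradientAt_bilevelObjective (H : BilevelRegularity L₁ L₂ l₁₀ l₁₁ l₂₁ l₂₂ μ₂)
    (hμ : 0 < μ₂) (lam : Vec m) :
    HasGradientAt (bilevelObjective L₁ L₂) (hypergradient L₁ L₂ lam) lam := by
  rw [hasGradientAt_iff_hasFDerivAt]
  have h1 : HasFDerivAt (fun x => pair x (lowerArgmin L₂ x)) ((pairCLM m d).comp
      ((ContinuousLinearMap.id ℝ (Vec m)).prod (fderiv ℝ (lowerArgmin L₂) lam))) lam :=
    (pairCLM m d).hasFDerivAt.comp lam
      ((hasFDerivAt_id lam).prodMk (H.differentiable_lowerArgmin hμ lam).hasFDerivAt)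
  have h2 := (H.upper_differentiable (pair lam (lowerArgmin L₂ lam))).hasGradientAt.hasFDerivAt
  refine (h2.comp lam h1).congr_fderiv ?_
  ext v
  simp only [ContinuousLinearMap.comp_apply, InnerProductSpace.toDual_apply_apply,
    ContinuousLinearMap.prod_apply, pairCLM_apply, ContinuousLinearMap.id_apply]
  rw [real_inner_comm, inner_pair_left, hypergradient, inner_add_left, solutionAdjoint,
    ContinuousLinearMap.adjoint_inner_left, real_inner_comm,
    real_inner_comm (wPart _) (fderiv ℝ (lowerArgmin L₂) lam v)]

lemma norm_wPart_upper_gradient_le (H : BilevelRegularity L₁ L₂ l₁₀ l₁₁ l₂₁ l₂₂ μ₂)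
    (lam : Vec m) (w : Vec d) : ‖wPart (∇ L₁ (pair lam w))‖ ≤ l₁₀ := by
  have h := (hasGradientAt_pair_right H.upper_differentiable lam w).hasFDerivAt
  rw [← (InnerProductSpace.toDual ℝ (Vec d)).norm_map, ← h.fderiv]
  exact norm_fderiv_le_of_lipschitz ℝ (H.upper_lipschitz lam)

lemma norm_upper_gradient_sub_le (H : BilevelRegularity L₁ L₂ l₁₀ l₁₁ l₂₁ l₂₂ μ₂)
    (y z : Joint m d) : ‖∇ L₁ y - ∇ L₁ z‖ ≤ l₁₁ * ‖y - z‖ :=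
  H.upper_gradient_lipschitz.norm_sub_le y z

lemma norm_hypergradient_sub_le (H : BilevelRegularity L₁ L₂ l₁₀ l₁₁ l₂₁ l₂₂ μ₂)
    (hμ : 0 < μ₂) (x y : Vec m) :
    ‖hypergradient L₁ L₂ x - hypergradient L₁ L₂ y‖ ≤
      (l₁₁ * (1 + l₂₁ / μ₂) ^ 2 + l₂₂ * (1 + l₂₁ / μ₂) ^ 2 / μ₂ * l₁₀) * ‖x - y‖ := by
  set p : ℝ := l₂₁ / μ₂ with hp
  have hp0 : 0 ≤ p := by positivity
  set gx := ∇ L₁ (pair x (lowerArgmin L₂ x)) with hgx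
  set gy := ∇ L₁ (pair y (lowerArgmin L₂ y)) with hgy
  have hg : ‖gx - gy‖ ≤ l₁₁ * ((1 + p) * ‖x - y‖) := by
    refine (H.norm_upper_gradient_sub_le _ _).trans ?_
    gcongr
    exact H.norm_pair_lowerArgmin_sub_le hμ x y
  have hdec : hypergradient L₁ L₂ x - hypergradient L₁ L₂ y = lamPart (gx - gy)
      + solutionAdjoint L₂ x (wPart (gx - gy))
      + (solutionAdjoint L₂ x - solutionAdjoint L₂ y) (wPart gy) := by
    rw [hypergradient, hypergradient, lamPart_sub, wPart_sub, map_sub, sub_apply]; abel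
  have h1 : ‖lamPart (gx - gy)‖ ≤ l₁₁ * ((1 + p) * ‖x - y‖) := (norm_lamPart_le _).trans hg
  have h2 : ‖solutionAdjoint L₂ x (wPart (gx - gy))‖ ≤ p * (l₁₁ * ((1 + p) * ‖x - y‖)) := by
    refine (ContinuousLinearMap.le_of_opNorm_le _ (H.norm_solutionAdjoint_le hμ x) _).trans ?_
    gcongr
    exact (norm_wPart_le _).trans hg
  have h3 : ‖(solutionAdjoint L₂ x - solutionAdjoint L₂ y) (wPart gy)‖ ≤
      l₂₂ * (1 + p) ^ 2 / μ₂ * ‖x - y‖ * l₁₀ := by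
    refine (ContinuousLinearMap.le_of_opNorm_le _ (H.norm_solutionAdjoint_sub_le hμ x y) _).trans ?_
    gcongr
    exact H.norm_wPart_upper_gradient_le _ _
  rw [hdec]
  refine (norm_add₃_le).trans ((add_le_add (add_le_add h1 h2) h3).trans_eq ?_)
  ring

/-- The combination of the partial gradients of the lower level that enters the mean motion of
the shifted upper-level variable. By implicit differentiation and the symmetry of the Hessian, its
derivative in `w` vanishes at the lower-level solution. -/
noncomputable def _root_.correctedGradient (L₂ : Joint m d → ℝ) (lam : Vec m) (w : Vec d) : Vec m :=
  lamPart (∇ L₂ (pair lam w)) + solutionAdjoint L₂ lam (wPart (∇ L₂ (pair lam w)))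

lemma correctedGradient_linear_part_eq_zero (H : BilevelRegularity L₁ L₂ l₁₀ l₁₁ l₂₁ l₂₂ μ₂)
    (hμ : 0 < μ₂) (lam : Vec m) (y : Vec d) :
    lamPart (fderiv ℝ (∇ L₂) (pair lam (lowerArgmin L₂ lam)) (pair 0 y))
      + solutionAdjoint L₂ lam
        (wPart (fderiv ℝ (∇ L₂) (pair lam (lowerArgmin L₂ lam)) (pair 0 y))) = 0 := by
  set Dz := fderiv ℝ (∇ L₂) (pair lam (lowerArgmin L₂ lam)) with hDz
  refine ext_inner_left ℝ fun v => ?_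
  rw [inner_add_right, solutionAdjoint, ContinuousLinearMap.adjoint_inner_right,
    ← inner_pair_left, real_inner_comm, hDz, H.inner_hessian_comm, real_inner_comm,
    inner_pair_left, inner_zero_left, H.wPart_hessian_fderiv_lowerArgmin hμ]
  simp

lemma norm_correctedGradient_sub_le (H : BilevelRegularity L₁ L₂ l₁₀ l₁₁ l₂₁ l₂₂ μ₂)
    (hμ : 0 < μ₂) (lam : Vec m) (w v : Vec d) :
    ‖correctedGradient L₂ lam w - correctedGradient L₂ lam v‖
      ≤ (1 + l₂₁ / μ₂) * l₂₁ * ‖w - v‖ := by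
  have h0 : ‖∇ L₂ (pair lam w) - ∇ L₂ (pair lam v)‖ ≤ l₂₁ * ‖w - v‖ := by
    refine (H.norm_gradient_sub_le _ _).trans ?_
    rw [pair_sub_pair_right]
    gcongr
    exact norm_pair_zero_left _
  set r := ∇ L₂ (pair lam w) - ∇ L₂ (pair lam v) with hr
  have hdec : correctedGradient L₂ lam w - correctedGradient L₂ lam v =
      lamPart r + solutionAdjoint L₂ lam (wPart r) := by
    rw [correctedGradient, correctedGradient, hr, lamPart_sub, wPart_sub, map_sub]; abel
  rw [hdec]
  refine (norm_add_le _ _).trans ?_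
  have h1 := (norm_lamPart_le r).trans h0
  have h2 : ‖solutionAdjoint L₂ lam (wPart r)‖ ≤ l₂₁ / μ₂ * (l₂₁ * ‖w - v‖) := by
    refine (ContinuousLinearMap.le_of_opNorm_le _ (H.norm_solutionAdjoint_le hμ lam) _).trans ?_
    gcongr
    exact (norm_wPart_le _).trans h0
  linarith

lemma norm_correctedGradient_sub_le_sq (H : BilevelRegularity L₁ L₂ l₁₀ l₁₁ l₂₁ l₂₂ μ₂)
    (hμ : 0 < μ₂) (lam : Vec m) (w : Vec d) :
    ‖correctedGradient L₂ lam w - correctedGradient L₂ lam (lowerArgmin L₂ lam)‖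
      ≤ (1 + l₂₁ / μ₂) * l₂₂ * ‖w - lowerArgmin L₂ lam‖ ^ 2 := by
  set b := lowerArgmin L₂ lam with hb
  set Dz := fderiv ℝ (∇ L₂) (pair lam b) with hDz
  have h0 : ‖∇ L₂ (pair lam w) - ∇ L₂ (pair lam b) - Dz (pair 0 (w - b))‖
      ≤ l₂₂ * ‖w - b‖ ^ 2 := by
    have := H.norm_gradient_taylor_le (pair lam b) (pair lam w)
    rw [pair_sub_pair_right] at this
    refine this.trans ?_
    gcongr
    exact norm_pair_zero_left _
  set r := ∇ L₂ (pair lam w) - ∇ L₂ (pair lam b) - Dz (pair 0 (w - b)) with hr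
  have hdec : correctedGradient L₂ lam w - correctedGradient L₂ lam b =
      lamPart r + solutionAdjoint L₂ lam (wPart r) := by
    have h := H.correctedGradient_linear_part_eq_zero hμ lam (w - b)
    rw [← hb, ← hDz] at h
    rw [correctedGradient, correctedGradient, hr, lamPart_sub, lamPart_sub, wPart_sub, wPart_sub,
      map_sub, map_sub]
    refine sub_eq_zero.1 (Eq.trans ?_ h)
    abel
  rw [hdec]
  refine (norm_add_le _ _).trans ?_
  have h1 := (norm_lamPart_le r).trans h0
  have h2 : ‖solutionAdjoint L₂ lam (wPart r)‖ ≤ l₂₁ / μ₂ * (l₂₂ * ‖w - b‖ ^ 2) := by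
    refine (ContinuousLinearMap.le_of_opNorm_le _ (H.norm_solutionAdjoint_le hμ lam) _).trans ?_
    gcongr
    exact (norm_wPart_le _).trans h0
  linarith

end BilevelRegularity

/-! ### Randomly selected blocks -/

section Blocks

variable {d J : ℕ} (blk : Fin d → Fin J)

lemma norm_blockPart_le (j : Fin J) (g : Vec d) : ‖blockPart blk j g‖ ≤ ‖g‖ := by
  rw [EuclideanSpace.norm_eq, EuclideanSpace.norm_eq]
  refine Real.sqrt_le_sqrt (Finset.sum_le_sum fun i _ => ?_)
  simp only [blockPart]
  split_ifs
  · exact le_rfl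
  · simpa using sq_nonneg (g i)

lemma blockPart_add (j : Fin J) (g h : Vec d) :
    blockPart blk j (g + h) = blockPart blk j g + blockPart blk j h := by
  ext i
  simp only [blockPart, PiLp.add_apply]
  split_ifs <;> simp

lemma blockPart_smul (j : Fin J) (t : ℝ) (g : Vec d) :
    blockPart blk j (t • g) = t • blockPart blk j g := by
  ext i
  simp [blockPart]

lemma sum_blockPart (g : Vec d) : ∑ j, blockPart blk j g = g := by
  ext i
  simp [blockPart]

lemma continuous_blockPart (j : Fin J) : Continuous (blockPart blk j) :=
  (LinearMap.mkContinuous (σ := RingHom.id ℝ)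
    { toFun := blockPart blk j, map_add' := blockPart_add blk j, map_smul' := blockPart_smul blk j }
    1 fun g => by rw [one_mul]; exact norm_blockPart_le blk j g).continuous

lemma measurable_blockPart : Measurable fun p : Vec d × Fin J => blockPart blk p.2 p.1 :=
  measurable_from_prod_countable_left fun j => (continuous_blockPart blk j).measurable

variable {A : Type*} [MeasurableSpace A] {μ : Measure A} [IsProbabilityMeasure μ]

lemma isProbabilityMeasure_uniformOn_fin (hJ : 0 < J) :
    IsProbabilityMeasure (uniformOn (Set.univ : Set (Fin J))) :=
  isProbabilityMeasure_uniformOn Set.finite_univ ⟨⟨0, hJ⟩, trivial⟩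

/-- A uniformly selected block contains on average the fraction `1 / J` of a vector. -/
lemma integral_blockPart (hJ : 0 < J) {g : A → Vec d} (hg : Measurable g) (hi : Integrable g μ) :
    Integrable (fun p : A × Fin J => blockPart blk p.2 (g p.1))
      (μ.prod (uniformOn Set.univ)) ∧
    ∫ p : A × Fin J, blockPart blk p.2 (g p.1) ∂(μ.prod (uniformOn Set.univ)) =
      (J : ℝ)⁻¹ • ∫ a, g a ∂μ := by
  have := isProbabilityMeasure_uniformOn_fin hJ
  have hI : Integrable (fun p : A × Fin J => blockPart blk p.2 (g p.1))
      (μ.prod (uniformOn Set.univ)) := by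
    refine (hi.comp_fst (uniformOn (Set.univ : Set (Fin J)))).mono
      ((measurable_blockPart blk).comp
        ((hg.comp measurable_fst).prodMk measurable_snd)).aestronglyMeasurable
      (.of_forall fun p => norm_blockPart_le blk p.2 (g p.1))
  refine ⟨hI, ?_⟩
  rw [integral_prod _ hI, ← integral_smul]
  refine integral_congr_ae (.of_forall fun a => ?_)
  have hr : ∀ j : Fin J, (uniformOn (Set.univ : Set (Fin J))).real {j} = (J : ℝ)⁻¹ := fun j => by
    rw [measureReal_def, uniformOn_univ]
    simp
  simp only
  rw [integral_fintype Integrable.of_finite]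
  simp only [hr]
  rw [← Finset.smul_sum, sum_blockPart]

end Blocks

lemma MeasureTheory.MeasurePreserving.integral_comp_of_aestronglyMeasurable {A A' E : Type*}
    [MeasurableSpace A] [MeasurableSpace A'] [NormedAddCommGroup E] [NormedSpace ℝ E]
    {μ : Measure A} {ν : Measure A'} {φ : A → A'} (hφ : MeasurePreserving φ μ ν) {g : A' → E}
    (hg : AEStronglyMeasurable g ν) : ∫ a, g (φ a) ∂μ = ∫ a, g a ∂ν := by
  rw [← hφ.map_eq] at hg ⊢
  rw [integral_map hφ.aemeasurable hg]

/-! ### The bilevel problem as a two-time-scale problem -/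

/-- The common target of the two copies of the lower-level variable. -/
noncomputable def doubledArgmin {m d : ℕ} (L₂ : Joint m d → ℝ) (lam : Vec m) : Joint d d :=
  pair (lowerArgmin L₂ lam) (lowerArgmin L₂ lam)

/-- The difference `w - u` of the two copies. -/
noncomputable def copyDiff (d : ℕ) : Joint d d →L[ℝ] Vec d := wPartCLM d d - lamPartCLM d d

/-- The increment of `lam` in one iteration, when `g₁`, `gw`, `gu` are the estimates of `∇L₁` at
`w` and of `∇L₂` at `w` and at `u`. -/
noncomputable def slowIncrement {m d : ℕ} (α ηlam : ℝ) (g₁ gw gu : Joint m d) : Vec m :=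
  -(ηlam • (lamPart g₁ + α • (lamPart gw - lamPart gu)))

/-- The increment of `(u, w)` in one iteration. -/
noncomputable def fastIncrement {m d J : ℕ} (blkU blkW : Fin d → Fin J) (α ηu ηw : ℝ)
    (g₁ gw gu : Joint m d) (j r : Fin J) : Joint d d :=
  pair (-((α * ηu) • blockPart blkU j (wPart gu)))
    (-(ηw • blockPart blkW r (wPart g₁ + α • wPart gw)))

/-- The requirements on a constant `M` that bounds all constants of the two-time-scale problem;
`κ` is the normalization of the noise and `p = l₂₁ / μ₂`. -/
structure StepConstants (l₁₀ l₁₁ l₂₁ l₂₂ μ₂ η₀ ηlam₀ κ J M : ℝ) : Prop where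
  one_le : 1 ≤ M
  hypergradient : 2 * (l₁₁ * (1 + l₂₁ / μ₂) ^ 2 + l₂₂ * (1 + l₂₁ / μ₂) ^ 2 / μ₂ * l₁₀) ≤ M
  target : 2 * (l₂₁ / μ₂) ≤ M
  adjoint : l₂₂ * (1 + l₂₁ / μ₂) ^ 2 / μ₂ ≤ M
  copies : 2 ≤ M
  slow : ηlam₀ * (l₁₁ + 2 * l₂₁) ≤ M
  slow_noise : ηlam₀ * (1 + l₂₁ / μ₂ * l₁₀) * κ ≤ M
  fast : η₀ * (2 * l₂₁) ≤ M
  fast_noise : η₀ * (1 + l₁₀) * κ ≤ M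
  drift : η₀ * l₁₀ ≤ M
  ratio : ηlam₀ * J / η₀ ≤ M
  step : ηlam₀ ≤ M
  step_inv : 1 ≤ M * ηlam₀
  mean : ηlam₀ * ((1 + l₂₁ / μ₂) * l₁₁) ≤ M
  mean_huber : ηlam₀ * (6 * ((1 + l₂₁ / μ₂) * (l₂₁ + l₂₂))) ≤ M

lemma exists_stepConstants {l₁₀ l₁₁ l₂₁ l₂₂ μ₂ η₀ ηlam₀ κ J : ℝ} (h10 : 0 ≤ l₁₀) (h11 : 0 ≤ l₁₁)
    (h21 : 0 ≤ l₂₁) (h22 : 0 ≤ l₂₂) (hμ : 0 < μ₂) (hη : 0 < η₀) (hηl : 0 < ηlam₀) (hκ : 0 ≤ κ)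
    (hJ : 0 ≤ J) : ∃ M, StepConstants l₁₀ l₁₁ l₂₁ l₂₂ μ₂ η₀ ηlam₀ κ J M := by
  have t1 : 0 ≤ 2 * (l₁₁ * (1 + l₂₁ / μ₂) ^ 2 + l₂₂ * (1 + l₂₁ / μ₂) ^ 2 / μ₂ * l₁₀) := by
    positivity
  have t2 : 0 ≤ 2 * (l₂₁ / μ₂) := by positivity
  have t3 : 0 ≤ l₂₂ * (1 + l₂₁ / μ₂) ^ 2 / μ₂ := by positivity
  have t4 : 0 ≤ ηlam₀ * (l₁₁ + 2 * l₂₁) := by positivity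
  have t5 : 0 ≤ ηlam₀ * (1 + l₂₁ / μ₂ * l₁₀) * κ := by positivity
  have t6 : 0 ≤ η₀ * (2 * l₂₁) := by positivity
  have t7 : 0 ≤ η₀ * (1 + l₁₀) * κ := by positivity
  have t8 : 0 ≤ η₀ * l₁₀ := by positivity
  have t9 : 0 ≤ ηlam₀ * J / η₀ := by positivity
  have t10 : 0 < ηlam₀⁻¹ := by positivity
  have t11 : 0 ≤ ηlam₀ * ((1 + l₂₁ / μ₂) * l₁₁) := by positivity
  have t12 : 0 ≤ ηlam₀ * (6 * ((1 + l₂₁ / μ₂) * (l₂₁ + l₂₂))) := by positivity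
  obtain ⟨M, hM⟩ : ∃ M, M = 2 + 2 * (l₁₁ * (1 + l₂₁ / μ₂) ^ 2
      + l₂₂ * (1 + l₂₁ / μ₂) ^ 2 / μ₂ * l₁₀) + 2 * (l₂₁ / μ₂) + l₂₂ * (1 + l₂₁ / μ₂) ^ 2 / μ₂
      + ηlam₀ * (l₁₁ + 2 * l₂₁) + ηlam₀ * (1 + l₂₁ / μ₂ * l₁₀) * κ + η₀ * (2 * l₂₁)
      + η₀ * (1 + l₁₀) * κ + η₀ * l₁₀ + ηlam₀ * J / η₀ + ηlam₀⁻¹ + ηlam₀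
      + ηlam₀ * ((1 + l₂₁ / μ₂) * l₁₁)
      + ηlam₀ * (6 * ((1 + l₂₁ / μ₂) * (l₂₁ + l₂₂))) := ⟨_, rfl⟩
  have hinv : ηlam₀⁻¹ ≤ M := by
    linarith only [hM, t1, t2, t3, t4, t5, t6, t7, t8, t9, hηl, t11, t12]
  refine ⟨M, by linarith, by linarith, by linarith, by linarith, by linarith, by linarith,
    by linarith, by linarith, by linarith, by linarith, by linarith, by linarith, ?_, by linarith,
    by linarith⟩
  calc (1 : ℝ) = ηlam₀⁻¹ * ηlam₀ := (inv_mul_cancel₀ hηl.ne').symm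
    _ ≤ M * ηlam₀ := mul_le_mul_of_nonneg_right hinv hηl.le

namespace BilevelRegularity

variable {m d : ℕ} {L₁ L₂ : Joint m d → ℝ} {l₁₀ l₁₁ l₂₁ l₂₂ : ℝ≥0} {μ₂ η₀ ηlam₀ κ M s : ℝ} {J : ℕ}

lemma continuous_bilevelObjective (H : BilevelRegularity L₁ L₂ l₁₀ l₁₁ l₂₁ l₂₂ μ₂) (hμ : 0 < μ₂) :
    Continuous (bilevelObjective L₁ L₂) := by
  refine Differentiable.continuous (𝕜 := ℝ) fun lam => ?_
  exact (H.hasGradientAt_bilevelObjective hμ lam).differentiableAt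

lemma slowFastData (H : BilevelRegularity L₁ L₂ l₁₀ l₁₁ l₂₁ l₂₂ μ₂) (hμ : 0 < μ₂)
    (hM : StepConstants l₁₀ l₁₁ l₂₁ l₂₂ μ₂ η₀ ηlam₀ κ J M) {a : ℝ}
    (ha : ∀ lam, a ≤ bilevelObjective L₁ L₂ lam) :
    SlowFastData (fun lam => bilevelObjective L₁ L₂ lam - a) (hypergradient L₁ L₂)
      (doubledArgmin L₂) (solutionAdjoint L₂) (copyDiff d) M where
  one_le := hM.one_le
  continuous := (H.continuous_bilevelObjective hμ).sub continuous_const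
  nonneg lam := sub_nonneg.2 (ha lam)
  descent x y := by
    have h := le_add_inner_add_sq_of_lipschitz_gradient (H.hasGradientAt_bilevelObjective hμ)
      (H.norm_hypergradient_sub_le hμ) (by positivity) x y
    have h2 := mul_le_mul_of_nonneg_right hM.hypergradient (sq_nonneg ‖y - x‖)
    linarith
  grad_lipschitz x y := by
    refine (H.norm_hypergradient_sub_le hμ x y).trans
      (mul_le_mul_of_nonneg_right ?_ (norm_nonneg _))
    have : (0 : ℝ) ≤ l₁₁ * (1 + l₂₁ / μ₂) ^ 2 + l₂₂ * (1 + l₂₁ / μ₂) ^ 2 / μ₂ * l₁₀ := by positivity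
    linarith [hM.hypergradient]
  target_lipschitz x y := by
    rw [doubledArgmin, doubledArgmin, ← pair_sub]
    refine (norm_pair_le _ _).trans ?_
    have h := H.norm_lowerArgmin_sub_le hμ x y
    have h2 := mul_le_mul_of_nonneg_right hM.target (norm_nonneg (x - y))
    linarith
  norm_P_le x := by
    have : (0 : ℝ) ≤ l₂₁ / μ₂ := by positivity
    linarith [H.norm_solutionAdjoint_le hμ x, hM.target]
  P_lipschitz x y := (H.norm_solutionAdjoint_sub_le hμ x y).trans
    (mul_le_mul_of_nonneg_right hM.adjoint (norm_nonneg _))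
  norm_D_le := by
    refine le_trans ?_ hM.copies
    refine ContinuousLinearMap.opNorm_le_bound _ zero_le_two fun z => ?_
    have := norm_sub_le (wPart z) (lamPart z)
    have h1 := norm_wPart_le z
    have h2 := norm_lamPart_le z
    change ‖wPart z - lamPart z‖ ≤ _
    linarith
  D_target x := by simp [copyDiff, doubledArgmin]

lemma norm_lamPart_sub_doubledArgmin_le (x : Vec m) (z : Joint d d) :
    ‖lamPart z - lowerArgmin L₂ x‖ ≤ ‖z - doubledArgmin L₂ x‖ := by
  have := norm_lamPart_le (z - doubledArgmin L₂ x)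
  rwa [lamPart_sub] at this

lemma norm_wPart_sub_doubledArgmin_le (x : Vec m) (z : Joint d d) :
    ‖wPart z - lowerArgmin L₂ x‖ ≤ ‖z - doubledArgmin L₂ x‖ := by
  have := norm_wPart_le (z - doubledArgmin L₂ x)
  rwa [wPart_sub] at this

lemma norm_gradient_pair_sub_le (H : BilevelRegularity L₁ L₂ l₁₀ l₁₁ l₂₁ l₂₂ μ₂) (x : Vec m)
    (w v : Vec d) : ‖∇ L₂ (pair x w) - ∇ L₂ (pair x v)‖ ≤ l₂₁ * ‖w - v‖ := by
  refine (H.norm_gradient_sub_le _ _).trans ?_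
  rw [pair_sub_pair_right]
  exact mul_le_mul_of_nonneg_left (norm_pair_zero_left _) l₂₁.2

lemma norm_upper_gradient_pair_sub_le (H : BilevelRegularity L₁ L₂ l₁₀ l₁₁ l₂₁ l₂₂ μ₂) (x : Vec m)
    (w v : Vec d) : ‖∇ L₁ (pair x w) - ∇ L₁ (pair x v)‖ ≤ l₁₁ * ‖w - v‖ := by
  refine (H.norm_upper_gradient_sub_le _ _).trans ?_
  rw [pair_sub_pair_right]
  exact mul_le_mul_of_nonneg_left (norm_pair_zero_left _) l₁₁.2

/-- The derivative of `correctedGradient` in `w` vanishes at the lower-level solution, so that its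
increment is quadratic near the solution; it is linear far from it. -/
lemma norm_correctedGradient_sub_le_huber (H : BilevelRegularity L₁ L₂ l₁₀ l₁₁ l₂₁ l₂₂ μ₂)
    (hμ : 0 < μ₂) (lam : Vec m) (w : Vec d) {q : ℝ} (hq : ‖w - lowerArgmin L₂ lam‖ ≤ q) :
    ‖correctedGradient L₂ lam w - correctedGradient L₂ lam (lowerArgmin L₂ lam)‖
      ≤ 3 * ((1 + l₂₁ / μ₂) * (l₂₁ + l₂₂)) * huber q := by
  set t := ‖w - lowerArgmin L₂ lam‖ with ht
  have ht0 : 0 ≤ t := norm_nonneg _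
  have hp : (0 : ℝ) ≤ 1 + l₂₁ / μ₂ := by positivity
  have h21 : (0 : ℝ) ≤ l₂₁ := l₂₁.2
  have h22 : (0 : ℝ) ≤ l₂₂ := l₂₂.2
  have hh := huber_nonneg t
  have key : ‖correctedGradient L₂ lam w - correctedGradient L₂ lam (lowerArgmin L₂ lam)‖
      ≤ 3 * ((1 + l₂₁ / μ₂) * (l₂₁ + l₂₂)) * huber t := by
    rcases le_total t 1 with h | h
    · refine (H.norm_correctedGradient_sub_le_sq hμ lam w).trans ?_
      have h1 := mul_le_mul_of_nonneg_left (sq_le_three_mul_huber ht0 h) (mul_nonneg hp h22)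
      have h2 : 0 ≤ (1 + l₂₁ / μ₂) * l₂₁ * huber t := by positivity
      linarith
    · refine (H.norm_correctedGradient_sub_le hμ lam w _).trans ?_
      have h1 := mul_le_mul_of_nonneg_left (le_three_mul_huber h) (mul_nonneg hp h21)
      have h2 : 0 ≤ (1 + l₂₁ / μ₂) * l₂₂ * huber t := by positivity
      linarith
  exact key.trans (mul_le_mul_of_nonneg_left (huber_le_huber ht0 hq) (by positivity))

lemma norm_slowIncrement_add_le (H : BilevelRegularity L₁ L₂ l₁₀ l₁₁ l₂₁ l₂₂ μ₂) (hμ : 0 < μ₂)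
    (hηl : 0 ≤ ηlam₀) (hs : 0 < s) (hs1 : s ≤ 1) (x : Vec m) (z : Joint d d)
    (g₁ gw gu : Joint m d) :
    ‖slowIncrement s⁻¹ (ηlam₀ * s ^ 5) g₁ gw gu + (ηlam₀ * s ^ 5) • hypergradient L₁ L₂ x‖ ≤
      ηlam₀ * s ^ 4 * ((l₁₁ + 2 * l₂₁) * ‖z - doubledArgmin L₂ x‖ + (1 + l₂₁ / μ₂ * l₁₀) *
        (1 + ‖g₁ - ∇ L₁ (pair x (wPart z))‖ + ‖gw - ∇ L₂ (pair x (wPart z))‖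
          + ‖gu - ∇ L₂ (pair x (lamPart z))‖)) := by
  set q := ‖z - doubledArgmin L₂ x‖ with hq
  set v := lowerArgmin L₂ x with hv
  set n₁ := g₁ - ∇ L₁ (pair x (wPart z)) with hn1
  set nw := gw - ∇ L₂ (pair x (wPart z)) with hnw
  set nu := gu - ∇ L₂ (pair x (lamPart z)) with hnu
  have hqu : ‖lamPart z - v‖ ≤ q := norm_lamPart_sub_doubledArgmin_le x z
  have hqw : ‖wPart z - v‖ ≤ q := norm_wPart_sub_doubledArgmin_le x z
  have hq0 : 0 ≤ q := norm_nonneg _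
  have h1 : ‖∇ L₁ (pair x (wPart z)) - ∇ L₁ (pair x v)‖ ≤ l₁₁ * q :=
    (H.norm_upper_gradient_pair_sub_le x _ _).trans (mul_le_mul_of_nonneg_left hqw l₁₁.2)
  have h2 : ‖∇ L₂ (pair x (wPart z)) - ∇ L₂ (pair x (lamPart z))‖ ≤ l₂₁ * (2 * q) := by
    refine (H.norm_gradient_pair_sub_le x _ _).trans (mul_le_mul_of_nonneg_left ?_ l₂₁.2)
    have := norm_sub_le (wPart z - v) (lamPart z - v)
    rw [sub_sub_sub_cancel_right] at this
    linarith
  have h3 : ‖solutionAdjoint L₂ x (wPart (∇ L₁ (pair x v)))‖ ≤ l₂₁ / μ₂ * l₁₀ :=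
    ((solutionAdjoint L₂ x).le_of_opNorm_le (H.norm_solutionAdjoint_le hμ x) _).trans
      (mul_le_mul_of_nonneg_left (H.norm_wPart_upper_gradient_le x v) (by positivity))
  -- the terms are grouped into noise, errors caused by the deviation of `w` and `u` from the
  -- solution, and the part of the hypergradient that only the penalty terms produce
  have e : slowIncrement s⁻¹ (ηlam₀ * s ^ 5) g₁ gw gu + (ηlam₀ * s ^ 5) • hypergradient L₁ L₂ x =
      -((ηlam₀ * s ^ 5) • (lamPart (n₁ + (∇ L₁ (pair x (wPart z)) - ∇ L₁ (pair x v)))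
        - solutionAdjoint L₂ x (wPart (∇ L₁ (pair x v)))
        + s⁻¹ • lamPart (nw - nu + (∇ L₂ (pair x (wPart z)) - ∇ L₂ (pair x (lamPart z)))))) := by
    simp only [slowIncrement, hypergradient, hn1, hnw, hnu, ← hv, lamPart_add, lamPart_sub,
      smul_sub, smul_add]
    abel
  rw [e, norm_neg, norm_smul, Real.norm_of_nonneg (by positivity)]
  have a1 : ‖lamPart (n₁ + (∇ L₁ (pair x (wPart z)) - ∇ L₁ (pair x v)))‖ ≤ ‖n₁‖ + l₁₁ * q :=
    (norm_lamPart_le _).trans ((norm_add_le _ _).trans (by linarith))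
  have a2 : ‖lamPart (nw - nu + (∇ L₂ (pair x (wPart z)) - ∇ L₂ (pair x (lamPart z))))‖ ≤
      ‖nw‖ + ‖nu‖ + l₂₁ * (2 * q) :=
    (norm_lamPart_le _).trans ((norm_add_le _ _).trans (add_le_add (norm_sub_le _ _) h2))
  have hs1' : 1 ≤ s⁻¹ := (one_le_inv₀ hs).2 hs1
  have hp : (0 : ℝ) ≤ l₂₁ / μ₂ * l₁₀ := by positivity
  have a3 : ‖lamPart (n₁ + (∇ L₁ (pair x (wPart z)) - ∇ L₁ (pair x v)))
        - solutionAdjoint L₂ x (wPart (∇ L₁ (pair x v)))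
        + s⁻¹ • lamPart (nw - nu + (∇ L₂ (pair x (wPart z)) - ∇ L₂ (pair x (lamPart z))))‖ ≤
      s⁻¹ * ((l₁₁ + 2 * l₂₁) * q + (1 + l₂₁ / μ₂ * l₁₀) * (1 + ‖n₁‖ + ‖nw‖ + ‖nu‖)) := by
    refine (norm_add_le _ _).trans ((add_le_add (norm_sub_le _ _) le_rfl).trans ?_)
    rw [norm_smul, Real.norm_of_nonneg (by positivity)]
    have b0 : 0 ≤ ‖n₁‖ + l₁₁ * q + l₂₁ / μ₂ * l₁₀ := by positivity
    have b1 : ‖n₁‖ + l₁₁ * q + l₂₁ / μ₂ * l₁₀ ≤ s⁻¹ * (‖n₁‖ + l₁₁ * q + l₂₁ / μ₂ * l₁₀) :=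
      le_mul_of_one_le_left b0 hs1'
    have b2 := mul_le_mul_of_nonneg_left a2 (zero_le_one.trans hs1')
    have b3 : 0 ≤ s⁻¹ * (1 + l₂₁ / μ₂ * l₁₀ * (‖n₁‖ + ‖nw‖ + ‖nu‖)) := by positivity
    linarith
  refine (mul_le_mul_of_nonneg_left a3 (by positivity)).trans (le_of_eq ?_)
  field_simp

lemma norm_fastIncrement_le (H : BilevelRegularity L₁ L₂ l₁₀ l₁₁ l₂₁ l₂₂ μ₂) (hμ : 0 < μ₂)
    (hη : 0 ≤ η₀) (hs : 0 < s) (hs1 : s ≤ 1) (blkU blkW : Fin d → Fin J) (j r : Fin J)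
    (x : Vec m) (z : Joint d d) (g₁ gw gu : Joint m d) :
    ‖fastIncrement blkU blkW s⁻¹ (η₀ * s ^ 4) (η₀ * s ^ 4) g₁ gw gu j r‖ ≤
      η₀ * s ^ 3 * (2 * l₂₁ * ‖z - doubledArgmin L₂ x‖ + (1 + l₁₀) *
        (1 + ‖g₁ - ∇ L₁ (pair x (wPart z))‖ + ‖gw - ∇ L₂ (pair x (wPart z))‖
          + ‖gu - ∇ L₂ (pair x (lamPart z))‖)) := by
  set q := ‖z - doubledArgmin L₂ x‖ with hq
  set v := lowerArgmin L₂ x with hv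
  set n₁ := g₁ - ∇ L₁ (pair x (wPart z)) with hn1
  set nw := gw - ∇ L₂ (pair x (wPart z)) with hnw
  set nu := gu - ∇ L₂ (pair x (lamPart z)) with hnu
  have hqu : ‖lamPart z - v‖ ≤ q := norm_lamPart_sub_doubledArgmin_le x z
  have hqw : ‖wPart z - v‖ ≤ q := norm_wPart_sub_doubledArgmin_le x z
  have h0 : wPart (∇ L₂ (pair x v)) = 0 := H.wPart_gradient_lowerArgmin hμ x
  have hL2 : ∀ y, ‖y - v‖ ≤ q → ‖wPart (∇ L₂ (pair x y))‖ ≤ l₂₁ * q := fun y hy => by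
    have := norm_wPart_le (∇ L₂ (pair x y) - ∇ L₂ (pair x v))
    rw [wPart_sub, h0, sub_zero] at this
    exact this.trans ((H.norm_gradient_pair_sub_le x _ _).trans
      (mul_le_mul_of_nonneg_left hy l₂₁.2))
  have ew : wPart gw = wPart nw + wPart (∇ L₂ (pair x (wPart z))) := by
    rw [← wPart_add, hnw, sub_add_cancel]
  have eu : wPart gu = wPart nu + wPart (∇ L₂ (pair x (lamPart z))) := by
    rw [← wPart_add, hnu, sub_add_cancel]
  have e1 : wPart g₁ = wPart n₁ + wPart (∇ L₁ (pair x (wPart z))) := by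
    rw [← wPart_add, hn1, sub_add_cancel]
  have b1 : ‖wPart g₁‖ ≤ ‖n₁‖ + l₁₀ := by
    rw [e1]
    exact (norm_add_le _ _).trans (add_le_add (norm_wPart_le _)
      (H.norm_wPart_upper_gradient_le x _))
  have bw : ‖wPart gw‖ ≤ ‖nw‖ + l₂₁ * q := by
    rw [ew]; exact (norm_add_le _ _).trans (add_le_add (norm_wPart_le _) (hL2 _ hqw))
  have bu : ‖wPart gu‖ ≤ ‖nu‖ + l₂₁ * q := by
    rw [eu]; exact (norm_add_le _ _).trans (add_le_add (norm_wPart_le _) (hL2 _ hqu))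
  have hs1' : 1 ≤ s⁻¹ := (one_le_inv₀ hs).2 hs1
  have hs0' : 0 ≤ s⁻¹ := zero_le_one.trans hs1'
  have c1 : ‖blockPart blkU j (wPart gu)‖ ≤ ‖nu‖ + l₂₁ * q := (norm_blockPart_le _ _ _).trans bu
  have c2 : ‖blockPart blkW r (wPart g₁ + s⁻¹ • wPart gw)‖ ≤
      s⁻¹ * (‖n₁‖ + l₁₀ + (‖nw‖ + l₂₁ * q)) := by
    refine (norm_blockPart_le _ _ _).trans ((norm_add_le _ _).trans ?_)
    rw [norm_smul, Real.norm_of_nonneg hs0']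
    have := mul_le_mul_of_nonneg_left bw hs0'
    have b0 : (0 : ℝ) ≤ ‖n₁‖ + l₁₀ := by positivity
    have := le_mul_of_one_le_left b0 hs1'
    linarith
  refine (norm_pair_le _ _).trans ?_
  rw [norm_neg, norm_neg, norm_smul, norm_smul, Real.norm_of_nonneg (by positivity),
    Real.norm_of_nonneg (by positivity)]
  have d1 := mul_le_mul_of_nonneg_left c1 (by positivity : 0 ≤ s⁻¹ * (η₀ * s ^ 4))
  have d2 := mul_le_mul_of_nonneg_left c2 (by positivity : 0 ≤ η₀ * s ^ 4)
  have e3 : s⁻¹ * (η₀ * s ^ 4) = η₀ * s ^ 3 := by field_simp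
  have e4 : η₀ * s ^ 4 * (s⁻¹ * (‖n₁‖ + l₁₀ + (‖nw‖ + l₂₁ * q))) =
      η₀ * s ^ 3 * (‖n₁‖ + l₁₀ + (‖nw‖ + l₂₁ * q)) := by field_simp
  rw [e3] at d1
  rw [e4] at d2
  rw [e3]
  have e5 : 0 ≤ η₀ * s ^ 3 * (1 + l₁₀ * (‖n₁‖ + ‖nw‖ + ‖nu‖)) := by positivity
  linarith

end BilevelRegularity

/-! ### The stochastic iteration -/

/-- The mean of `fastIncrement`, when `g₁`, `gw`, `gu` are the means of the gradient estimates. -/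
noncomputable def meanFastIncrement {m d : ℕ} (J : ℕ) (α ηu ηw : ℝ) (g₁ gw gu : Joint m d) :
    Joint d d :=
  pair (-((α * ηu) • (J : ℝ)⁻¹ • wPart gu)) (-(ηw • (J : ℝ)⁻¹ • (wPart g₁ + α • wPart gw)))

namespace BilevelRegularity

variable {m d : ℕ} {L₁ L₂ : Joint m d → ℝ} {l₁₀ l₁₁ l₂₁ l₂₂ : ℝ≥0} {μ₂ η₀ ηlam₀ κ M s : ℝ} {J : ℕ}

lemma inner_meanFastIncrement_le (H : BilevelRegularity L₁ L₂ l₁₀ l₁₁ l₂₁ l₂₂ μ₂) (hμ : 0 < μ₂)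
    (hη : 0 ≤ η₀) (hs : 0 < s) (hJ : 0 < J) {c : ℝ} (hc : c ≤ η₀ * μ₂ / J)
    (hM : η₀ * l₁₀ ≤ M) (x : Vec m) (z : Joint d d) :
    inner ℝ (z - doubledArgmin L₂ x) (meanFastIncrement J s⁻¹ (η₀ * s ^ 4) (η₀ * s ^ 4)
      (∇ L₁ (pair x (wPart z))) (∇ L₂ (pair x (wPart z))) (∇ L₂ (pair x (lamPart z)))) ≤
      -(c * s ^ 3 * ‖z - doubledArgmin L₂ x‖ ^ 2) + M * s ^ 4 * ‖z - doubledArgmin L₂ x‖ := by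
  set q := ‖z - doubledArgmin L₂ x‖ with hq
  set v := lowerArgmin L₂ x with hv
  have hqw : ‖wPart z - v‖ ≤ q := norm_wPart_sub_doubledArgmin_le x z
  have hq0 : 0 ≤ q := norm_nonneg _
  have h0 : wPart (∇ L₂ (pair x v)) = 0 := H.wPart_gradient_lowerArgmin hμ x
  have mu := H.strongly_monotone x (lamPart z) v
  have mw := H.strongly_monotone x (wPart z) v
  rw [h0, sub_zero] at mu mw
  have hq2 : q ^ 2 = ‖lamPart z - v‖ ^ 2 + ‖wPart z - v‖ ^ 2 := by
    rw [hq, norm_sq_eq_lamPart_add_wPart, lamPart_sub, wPart_sub]; rfl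
  have hi : -inner ℝ (wPart (∇ L₁ (pair x (wPart z)))) (wPart z - v) ≤ l₁₀ * q := by
    refine (neg_le_abs _).trans ((abs_real_inner_le_norm _ _).trans ?_)
    exact mul_le_mul (H.norm_wPart_upper_gradient_le x _) hqw (norm_nonneg _) l₁₀.2
  have hJ1 : (1 : ℝ) ≤ J := by exact_mod_cast hJ
  have hJi : (J : ℝ)⁻¹ ≤ 1 := inv_le_one_of_one_le₀ hJ1
  have hJi0 : (0 : ℝ) ≤ (J : ℝ)⁻¹ := by positivity
  rw [real_inner_comm, meanFastIncrement, inner_pair_left, lamPart_sub, wPart_sub]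
  change inner ℝ _ (lamPart z - v) + inner ℝ _ (wPart z - v) ≤ _
  simp only [inner_neg_left, inner_add_left, real_inner_smul_left]
  set iu := inner ℝ (wPart (∇ L₂ (pair x (lamPart z)))) (lamPart z - v)
  set iw := inner ℝ (wPart (∇ L₂ (pair x (wPart z)))) (wPart z - v)
  set i1 := inner ℝ (wPart (∇ L₁ (pair x (wPart z)))) (wPart z - v)
  have e : -(s⁻¹ * (η₀ * s ^ 4) * ((J : ℝ)⁻¹ * iu)) + -(η₀ * s ^ 4 * ((J : ℝ)⁻¹ * (i1 + s⁻¹ * iw)))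
      = η₀ * s ^ 3 * (J : ℝ)⁻¹ * (-(iu + iw)) + s ^ 4 * (η₀ * ((J : ℝ)⁻¹ * -i1)) := by
    field_simp
    ring
  rw [e]
  have a1 : η₀ * s ^ 3 * (J : ℝ)⁻¹ * (-(iu + iw)) ≤ η₀ * s ^ 3 * (J : ℝ)⁻¹ * (-(μ₂ * q ^ 2)) :=
    mul_le_mul_of_nonneg_left (by rw [hq2]; linarith) (by positivity)
  have a2 : c * (s ^ 3 * q ^ 2) ≤ η₀ * μ₂ / J * (s ^ 3 * q ^ 2) :=
    mul_le_mul_of_nonneg_right hc (by positivity)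
  have a3 : η₀ * s ^ 3 * (J : ℝ)⁻¹ * (-(μ₂ * q ^ 2)) = -(η₀ * μ₂ / J * (s ^ 3 * q ^ 2)) := by
    rw [div_eq_mul_inv]; ring
  have a4 : (J : ℝ)⁻¹ * -i1 ≤ l₁₀ * q := by
    refine (mul_le_mul_of_nonneg_left hi hJi0).trans ?_
    exact mul_le_of_le_one_left (mul_nonneg l₁₀.2 hq0) hJi
  have a5 : η₀ * ((J : ℝ)⁻¹ * -i1) ≤ M * q := by
    refine (mul_le_mul_of_nonneg_left a4 hη).trans ?_
    rw [← mul_assoc]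
    exact mul_le_mul_of_nonneg_right hM hq0
  have a6 := mul_le_mul_of_nonneg_left a5 (by positivity : 0 ≤ s ^ 4)
  linarith

/-- On average the correction removes the drift of the slow variable that is caused by the
deviation of the fast variable, up to terms of higher order. -/
lemma norm_mean_add_le (H : BilevelRegularity L₁ L₂ l₁₀ l₁₁ l₂₁ l₂₂ μ₂) (hμ : 0 < μ₂)
    (hη : 0 < η₀) (hηl : 0 ≤ ηlam₀) (hs : 0 < s) (hJ : 0 < J)
    (hM : ηlam₀ * ((1 + l₂₁ / μ₂) * l₁₁) ≤ M)
    (hM' : ηlam₀ * (6 * ((1 + l₂₁ / μ₂) * (l₂₁ + l₂₂))) ≤ M) (x : Vec m) (z : Joint d d) :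
    ‖slowIncrement s⁻¹ (ηlam₀ * s ^ 5) (∇ L₁ (pair x (wPart z))) (∇ L₂ (pair x (wPart z)))
        (∇ L₂ (pair x (lamPart z))) + (ηlam₀ * s ^ 5) • hypergradient L₁ L₂ x
      + (ηlam₀ * J / η₀ * s) • solutionAdjoint L₂ x (copyDiff d
        (meanFastIncrement J s⁻¹ (η₀ * s ^ 4) (η₀ * s ^ 4) (∇ L₁ (pair x (wPart z)))
          (∇ L₂ (pair x (wPart z))) (∇ L₂ (pair x (lamPart z)))))‖ ≤
      M * (s ^ 5 * ‖z - doubledArgmin L₂ x‖ + s ^ 4 * huber ‖z - doubledArgmin L₂ x‖) := by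
  set q := ‖z - doubledArgmin L₂ x‖ with hq
  set v := lowerArgmin L₂ x with hv
  have hqu : ‖lamPart z - v‖ ≤ q := norm_lamPart_sub_doubledArgmin_le x z
  have hqw : ‖wPart z - v‖ ≤ q := norm_wPart_sub_doubledArgmin_le x z
  have hq0 : 0 ≤ q := norm_nonneg _
  have hJ0 : (J : ℝ) ≠ 0 := by exact_mod_cast hJ.ne'
  have hη' := hη.ne'
  have hs' := hs.ne'
  set Pa := solutionAdjoint L₂ x with hPa
  have eD : copyDiff d (meanFastIncrement J s⁻¹ (η₀ * s ^ 4) (η₀ * s ^ 4)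
      (∇ L₁ (pair x (wPart z))) (∇ L₂ (pair x (wPart z))) (∇ L₂ (pair x (lamPart z)))) =
      -((η₀ * s ^ 4 * (J : ℝ)⁻¹) • (wPart (∇ L₁ (pair x (wPart z)))
        + s⁻¹ • (wPart (∇ L₂ (pair x (wPart z))) - wPart (∇ L₂ (pair x (lamPart z)))))) := by
    change wPart (meanFastIncrement _ _ _ _ _ _ _) - lamPart (meanFastIncrement _ _ _ _ _ _ _) = _
    simp only [meanFastIncrement, wPart_pair, lamPart_pair]
    module
  have e : slowIncrement s⁻¹ (ηlam₀ * s ^ 5) (∇ L₁ (pair x (wPart z))) (∇ L₂ (pair x (wPart z)))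
        (∇ L₂ (pair x (lamPart z))) + (ηlam₀ * s ^ 5) • hypergradient L₁ L₂ x
      + (ηlam₀ * J / η₀ * s) • Pa (copyDiff d
        (meanFastIncrement J s⁻¹ (η₀ * s ^ 4) (η₀ * s ^ 4) (∇ L₁ (pair x (wPart z)))
          (∇ L₂ (pair x (wPart z))) (∇ L₂ (pair x (lamPart z))))) =
      -((ηlam₀ * s ^ 5) • (lamPart (∇ L₁ (pair x (wPart z)) - ∇ L₁ (pair x v))
        + Pa (wPart (∇ L₁ (pair x (wPart z)) - ∇ L₁ (pair x v)))))
      - (ηlam₀ * s ^ 4) • ((correctedGradient L₂ x (wPart z) - correctedGradient L₂ x v)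
        - (correctedGradient L₂ x (lamPart z) - correctedGradient L₂ x v)) := by
    have c1 : ηlam₀ * J / η₀ * s * (η₀ * s ^ 4 * (J : ℝ)⁻¹) = ηlam₀ * s ^ 5 := by
      field_simp
    have c2 : ηlam₀ * s ^ 5 * s⁻¹ = ηlam₀ * s ^ 4 := by field_simp
    rw [eD, map_neg, map_smul, smul_neg, smul_smul, c1]
    simp only [slowIncrement, hypergradient, correctedGradient, ← hPa, ← hv, lamPart_sub,
      wPart_sub, map_add, map_sub, map_smul, smul_add, smul_sub, smul_smul, c2]
    abel
  rw [e]
  have h1 : ‖∇ L₁ (pair x (wPart z)) - ∇ L₁ (pair x v)‖ ≤ l₁₁ * q :=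
    (H.norm_upper_gradient_pair_sub_le x _ _).trans (mul_le_mul_of_nonneg_left hqw l₁₁.2)
  have h2 : ‖Pa (wPart (∇ L₁ (pair x (wPart z)) - ∇ L₁ (pair x v)))‖ ≤ l₂₁ / μ₂ * (l₁₁ * q) :=
    (Pa.le_of_opNorm_le (H.norm_solutionAdjoint_le hμ x) _).trans
      (mul_le_mul_of_nonneg_left ((norm_wPart_le _).trans h1) (by positivity))
  have h3 := H.norm_correctedGradient_sub_le_huber hμ x (wPart z) hqw
  have h4 := H.norm_correctedGradient_sub_le_huber hμ x (lamPart z) hqu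
  have h5 := huber_nonneg q
  refine (norm_sub_le _ _).trans ?_
  rw [norm_neg, norm_smul, norm_smul, Real.norm_of_nonneg (by positivity),
    Real.norm_of_nonneg (by positivity)]
  have h6 : ‖lamPart (∇ L₁ (pair x (wPart z)) - ∇ L₁ (pair x v))
        + Pa (wPart (∇ L₁ (pair x (wPart z)) - ∇ L₁ (pair x v)))‖ ≤
      (1 + l₂₁ / μ₂) * l₁₁ * q := by
    refine (norm_add_le _ _).trans ?_
    linarith [(norm_lamPart_le (∇ L₁ (pair x (wPart z)) - ∇ L₁ (pair x v))).trans h1]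
  have h7 : ‖(correctedGradient L₂ x (wPart z) - correctedGradient L₂ x v)
        - (correctedGradient L₂ x (lamPart z) - correctedGradient L₂ x v)‖ ≤
      6 * ((1 + l₂₁ / μ₂) * (l₂₁ + l₂₂)) * huber q := by
    refine (norm_sub_le _ _).trans ?_
    linarith
  have k1 := mul_le_mul_of_nonneg_left h6 (by positivity : 0 ≤ ηlam₀ * s ^ 5)
  have k2 := mul_le_mul_of_nonneg_left h7 (by positivity : 0 ≤ ηlam₀ * s ^ 4)
  have k3 := mul_le_mul_of_nonneg_right hM (by positivity : 0 ≤ s ^ 5 * q)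
  have k4 := mul_le_mul_of_nonneg_right hM' (by positivity : 0 ≤ s ^ 4 * huber q)
  linarith

end BilevelRegularity

section Sample

variable {m d J B : ℕ} {Sval Str : Type*}

/-- The random input of one iteration: the training and validation minibatches and the two
selected blocks. -/
abbrev Sample (B J : ℕ) (Str Sval : Type*) : Type _ :=
  (Fin B → Str) × (Fin B → Sval) × Fin J × Fin J

/-- The law of the input of one iteration. -/
noncomputable def sampleLaw [MeasurableSpace Sval] [MeasurableSpace Str] (J : ℕ)
    (νtr : Measure (Fin B → Str)) (νval : Measure (Fin B → Sval)) :
    Measure (Sample B J Str Sval) :=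
  νtr.prod (νval.prod ((uniformOn Set.univ).prod (uniformOn Set.univ)))

/-- One iteration in the variables `(lam, (u, w))`. -/
noncomputable def stateStep (f₁ : Joint m d → Sval → ℝ) (f₂ : Joint m d → Str → ℝ)
    (blkU blkW : Fin d → Fin J) (α ηu ηw ηlam : ℝ) (p : Vec m × Joint d d)
    (ζ : Sample B J Str Sval) : Vec m × Joint d d :=
  (p.1 + slowIncrement α ηlam (∇ (batchLoss f₁ ζ.2.1) (pair p.1 (wPart p.2)))
      (∇ (batchLoss f₂ ζ.1) (pair p.1 (wPart p.2)))
      (∇ (batchLoss f₂ ζ.1) (pair p.1 (lamPart p.2))),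
   p.2 + fastIncrement blkU blkW α ηu ηw (∇ (batchLoss f₁ ζ.2.1) (pair p.1 (wPart p.2)))
      (∇ (batchLoss f₂ ζ.1) (pair p.1 (wPart p.2)))
      (∇ (batchLoss f₂ ζ.1) (pair p.1 (lamPart p.2))) ζ.2.2.1 ζ.2.2.2)

lemma iterateWith_stateStep (f₁ : Joint m d → Sval → ℝ) (f₂ : Joint m d → Str → ℝ)
    (blkU blkW : Fin d → Fin J) (α ηu ηw ηlam : ℝ) (init : Iterate m d) (Dtr : ℕ → Fin B → Str)
    (Dval : ℕ → Fin B → Sval) (j r : ℕ → Fin J) (k : ℕ) :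
    iterateWith (stateStep f₁ f₂ blkU blkW α ηu ηw ηlam) (init.lam, pair init.u init.w)
        (fun n => (Dtr n, Dval n, j n, r n)) k =
      ((scaleBiO f₁ f₂ blkU blkW α ηu ηw ηlam init Dtr Dval j r k).lam,
        pair (scaleBiO f₁ f₂ blkU blkW α ηu ηw ηlam init Dtr Dval j r k).u
          (scaleBiO f₁ f₂ blkU blkW α ηu ηw ηlam init Dtr Dval j r k).w) := by
  induction k with
  | zero => rfl
  | succ k ih =>
    rw [iterateWith, ih]
    simp only [stateStep, scaleBiO, scaleBiOStep, slowIncrement, fastIncrement, wPart_pair,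
      lamPart_pair, ← pair_add, ← sub_eq_add_neg]

lemma measurable_lamPart : Measurable (lamPart : Joint m d → Vec m) := (lamPartCLM m d).measurable

lemma measurable_wPart : Measurable (wPart : Joint m d → Vec d) := (wPartCLM m d).measurable

variable {A : Type*} [MeasurableSpace A] {g₁ gw gu : A → Joint m d}

lemma measurable_slowIncrement (h₁ : Measurable g₁) (hw : Measurable gw) (hu : Measurable gu)
    (α ηlam : ℝ) : Measurable fun a => slowIncrement α ηlam (g₁ a) (gw a) (gu a) := by
  unfold slowIncrement
  have m1 := measurable_lamPart.comp h₁
  have m2 := measurable_lamPart.comp hw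
  have m3 := measurable_lamPart.comp hu
  exact ((m1.add ((m2.sub m3).const_smul α)).const_smul ηlam).neg

lemma measurable_fastIncrement (h₁ : Measurable g₁) (hw : Measurable gw) (hu : Measurable gu)
    {j r : A → Fin J} (hj : Measurable j) (hr : Measurable r) (blkU blkW : Fin d → Fin J)
    (α ηu ηw : ℝ) :
    Measurable fun a => fastIncrement blkU blkW α ηu ηw (g₁ a) (gw a) (gu a) (j a) (r a) := by
  unfold fastIncrement
  have m1 := measurable_wPart.comp h₁
  have m2 := measurable_wPart.comp hw
  have m3 := measurable_wPart.comp hu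
  have b1 := (measurable_blockPart blkU).comp (m3.prodMk hj)
  have b2 := (measurable_blockPart blkW).comp ((m1.add (m2.const_smul α)).prodMk hr)
  exact continuous_pair.measurable.comp
    ((b1.const_smul (α * ηu)).neg.prodMk (b2.const_smul ηw).neg)

lemma measurable_stateStep [MeasurableSpace Sval] [MeasurableSpace Str]
    {L₁ L₂ : Joint m d → ℝ} {f₁ : Joint m d → Sval → ℝ}
    {f₂ : Joint m d → Str → ℝ} {νval : Measure (Fin B → Sval)} {νtr : Measure (Fin B → Str)}
    {σ₁ σ₂ : ℝ} (h₁ : IsMinibatchGradient L₁ f₁ νval σ₁) (h₂ : IsMinibatchGradient L₂ f₂ νtr σ₂)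
    (blkU blkW : Fin d → Fin J) (α ηu ηw ηlam : ℝ) :
    Measurable fun q : (Vec m × Joint d d) × Sample B J Str Sval =>
      stateStep f₁ f₂ blkU blkW α ηu ηw ηlam q.1 q.2 := by
  have mx : Measurable fun q : (Vec m × Joint d d) × Sample B J Str Sval => q.1.1 :=
    measurable_fst.comp measurable_fst
  have mz : Measurable fun q : (Vec m × Joint d d) × Sample B J Str Sval => q.1.2 :=
    measurable_snd.comp measurable_fst
  have mtr : Measurable fun q : (Vec m × Joint d d) × Sample B J Str Sval => q.2.1 :=
    measurable_fst.comp measurable_snd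
  have mval : Measurable fun q : (Vec m × Joint d d) × Sample B J Str Sval => q.2.2.1 :=
    measurable_fst.comp (measurable_snd.comp measurable_snd)
  have mj : Measurable fun q : (Vec m × Joint d d) × Sample B J Str Sval => q.2.2.2.1 :=
    measurable_fst.comp (measurable_snd.comp (measurable_snd.comp measurable_snd))
  have mr : Measurable fun q : (Vec m × Joint d d) × Sample B J Str Sval => q.2.2.2.2 :=
    measurable_snd.comp (measurable_snd.comp (measurable_snd.comp measurable_snd))
  have mw' := continuous_pair.measurable.comp (mx.prodMk (measurable_wPart.comp mz))
  have mu' := continuous_pair.measurable.comp (mx.prodMk (measurable_lamPart.comp mz))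
  have m1 := h₁.measurable.comp (mw'.prodMk mval)
  have m2 := h₂.measurable.comp (mw'.prodMk mtr)
  have m3 := h₂.measurable.comp (mu'.prodMk mtr)
  exact (mx.add (measurable_slowIncrement m1 m2 m3 α ηlam)).prodMk
    (mz.add (measurable_fastIncrement m1 m2 m3 mj mr blkU blkW α ηu ηw))

end Sample

/-! ### Expectations over one sample -/

namespace IsMinibatchGradient

variable {m d B : ℕ} {S : Type*} [MeasurableSpace S] {L : Joint m d → ℝ} {f : Joint m d → S → ℝ}
  {ν : Measure (Fin B → S)} {σ : ℝ}

lemma measurable_gradient (h : IsMinibatchGradient L f ν σ) (z : Joint m d) :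
    Measurable fun D : Fin B → S => ∇ (batchLoss f D) z := by
  have hz : Measurable fun D : Fin B → S => (z, D) := measurable_prodMk_left
  have := h.measurable.comp hz
  simpa only [Function.comp_def] using this

lemma integrable_gradient [IsProbabilityMeasure ν] (h : IsMinibatchGradient L f ν σ)
    (z : Joint m d) : Integrable (fun D : Fin B → S => ∇ (batchLoss f D) z) ν := by
  have := ((h.memLp z).integrable one_le_two).add (integrable_const (∇ L z))
  refine this.congr (.of_forall fun D => ?_)
  simp

lemma integrable_sq (h : IsMinibatchGradient L f ν σ) (z : Joint m d) :
    Integrable (fun D => ‖∇ (batchLoss f D) z - ∇ L z‖ ^ 2) ν :=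
  (h.memLp z).integrable_norm_pow two_ne_zero

end IsMinibatchGradient

section Sample

variable {m d J B : ℕ} {Sval Str : Type*} [MeasurableSpace Sval] [MeasurableSpace Str]
  {νtr : Measure (Fin B → Str)} {νval : Measure (Fin B → Sval)}

variable (νtr νval) in
lemma measurePreserving_training [IsProbabilityMeasure νval] (hJ : 0 < J) :
    MeasurePreserving (fun ζ : Sample B J Str Sval => ζ.1) (sampleLaw J νtr νval) νtr := by
  have := isProbabilityMeasure_uniformOn_fin hJ
  exact measurePreserving_fst

variable {L₁ L₂ : Joint m d → ℝ} {f₁ : Joint m d → Sval → ℝ} {f₂ : Joint m d → Str → ℝ}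
  {σ₁ σ₂ : ℝ}

lemma integral_slowIncrement {A : Type*} [MeasurableSpace A] {μ : Measure A}
    {g₁ gw gu : A → Joint m d} (h₁ : Integrable g₁ μ) (hw : Integrable gw μ)
    (hu : Integrable gu μ) (α ηlam : ℝ) :
    ∫ a, slowIncrement α ηlam (g₁ a) (gw a) (gu a) ∂μ =
      slowIncrement α ηlam (∫ a, g₁ a ∂μ) (∫ a, gw a ∂μ) (∫ a, gu a ∂μ) := by
  set T : Joint m d → Vec m := lamPart with hT
  have i1 : Integrable (fun a => T (g₁ a)) μ := (lamPartCLM m d).integrable_comp h₁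
  have i2 : Integrable (fun a => T (gw a)) μ := (lamPartCLM m d).integrable_comp hw
  have i3 : Integrable (fun a => T (gu a)) μ := (lamPartCLM m d).integrable_comp hu
  have e1 : ∫ a, T (g₁ a) ∂μ = T (∫ a, g₁ a ∂μ) := (lamPartCLM m d).integral_comp_comm h₁
  have e2 : ∫ a, T (gw a) ∂μ = T (∫ a, gw a ∂μ) := (lamPartCLM m d).integral_comp_comm hw
  have e3 : ∫ a, T (gu a) ∂μ = T (∫ a, gu a ∂μ) := (lamPartCLM m d).integral_comp_comm hu
  simp only [slowIncrement, ← hT]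
  have i23 : Integrable (fun a => T (gw a) - T (gu a)) μ := i2.sub i3
  have i23' : Integrable (fun a => α • (T (gw a) - T (gu a))) μ := i23.smul α
  rw [integral_neg, integral_smul, integral_add i1 i23', integral_smul, integral_sub i2 i3,
    e1, e2, e3]

/-- The expectation of one selected block of a minibatch gradient. -/
lemma integral_blockPart_gradient {S : Type*} [MeasurableSpace S] {L : Joint m d → ℝ}
    {f : Joint m d → S → ℝ} {ν : Measure (Fin B → S)} [IsProbabilityMeasure ν] {σ : ℝ}
    (h : IsMinibatchGradient L f ν σ) (hJ : 0 < J) (blk : Fin d → Fin J) (z : Joint m d)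
    {φ : Sample B J Str Sval → (Fin B → S) × Fin J}
    (hφ : MeasurePreserving φ (sampleLaw J νtr νval) (ν.prod (uniformOn Set.univ))) :
    Integrable (fun ζ => blockPart blk (φ ζ).2 (wPart (∇ (batchLoss f (φ ζ).1) z)))
      (sampleLaw J νtr νval) ∧
    ∫ ζ, blockPart blk (φ ζ).2 (wPart (∇ (batchLoss f (φ ζ).1) z)) ∂(sampleLaw J νtr νval) =
      (J : ℝ)⁻¹ • wPart (∇ L z) := by
  have hm := measurable_wPart.comp (h.measurable_gradient z)
  have hi : Integrable (fun D => wPart (∇ (batchLoss f D) z)) ν :=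
    (wPartCLM m d).integrable_comp (h.integrable_gradient z)
  obtain ⟨i1, e1⟩ := integral_blockPart blk hJ hm hi
  refine ⟨hφ.integrable_comp_of_integrable i1, ?_⟩
  have e2 := hφ.integral_comp_of_aestronglyMeasurable i1.aestronglyMeasurable
  refine e2.trans (e1.trans ?_)
  congr 1
  rw [← h.unbiased z]
  exact (wPartCLM m d).integral_comp_comm (h.integrable_gradient z)

lemma integral_pair_neg_smul {A : Type*} [MeasurableSpace A] {μ : Measure A} {U W₁ W₂ : A → Vec d}
    (hU : Integrable U μ) (h₁ : Integrable W₁ μ) (h₂ : Integrable W₂ μ) (a b α : ℝ) :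
    ∫ ζ, pair (-(a • U ζ)) (-(b • (W₁ ζ + α • W₂ ζ))) ∂μ =
      pair (-(a • ∫ ζ, U ζ ∂μ)) (-(b • ((∫ ζ, W₁ ζ ∂μ) + α • ∫ ζ, W₂ ζ ∂μ))) := by
  have h₂' : Integrable (fun ζ => α • W₂ ζ) μ := h₂.smul α
  have h₁₂ : Integrable (fun ζ => W₁ ζ + α • W₂ ζ) μ := h₁.add h₂'
  have ia : Integrable (fun ζ => -(a • U ζ)) μ := (hU.smul a).neg
  have ib : Integrable (fun ζ => -(b • (W₁ ζ + α • W₂ ζ))) μ := (h₁₂.smul b).neg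
  refine ((pairCLM d d).integral_comp_comm (ia.prodMk ib)).trans ?_
  rw [integral_pair ia ib, pairCLM_apply, integral_neg, integral_neg, integral_smul, integral_smul,
    integral_add h₁ h₂', integral_smul]

variable [IsProbabilityMeasure νtr] [IsProbabilityMeasure νval]

lemma isProbabilityMeasure_sampleLaw (hJ : 0 < J) :
    IsProbabilityMeasure (sampleLaw J νtr νval) := by
  have := isProbabilityMeasure_uniformOn_fin hJ
  unfold sampleLaw
  infer_instance

variable (νtr νval) in
lemma measurePreserving_validation (hJ : 0 < J) :
    MeasurePreserving (fun ζ : Sample B J Str Sval => ζ.2.1) (sampleLaw J νtr νval) νval := by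
  have := isProbabilityMeasure_uniformOn_fin hJ
  exact measurePreserving_fst.comp measurePreserving_snd

variable (νtr νval) in
lemma measurePreserving_training_fst (hJ : 0 < J) :
    MeasurePreserving (fun ζ : Sample B J Str Sval => (ζ.1, ζ.2.2.1)) (sampleLaw J νtr νval)
      (νtr.prod (uniformOn Set.univ)) := by
  have := isProbabilityMeasure_uniformOn_fin hJ
  exact (MeasurePreserving.id νtr).prod (measurePreserving_fst.comp measurePreserving_snd)

variable (νtr νval) in
lemma measurePreserving_training_snd (hJ : 0 < J) :
    MeasurePreserving (fun ζ : Sample B J Str Sval => (ζ.1, ζ.2.2.2)) (sampleLaw J νtr νval)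
      (νtr.prod (uniformOn Set.univ)) := by
  have := isProbabilityMeasure_uniformOn_fin hJ
  exact (MeasurePreserving.id νtr).prod (measurePreserving_snd.comp measurePreserving_snd)

variable (νtr νval) in
lemma measurePreserving_validation_snd (hJ : 0 < J) :
    MeasurePreserving (fun ζ : Sample B J Str Sval => (ζ.2.1, ζ.2.2.2)) (sampleLaw J νtr νval)
      (νval.prod (uniformOn Set.univ)) := by
  have := isProbabilityMeasure_uniformOn_fin hJ
  exact ((MeasurePreserving.id νval).prod measurePreserving_snd).comp measurePreserving_snd

lemma integral_slowIncrement_gradient (h₁ : IsMinibatchGradient L₁ f₁ νval σ₁)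
    (h₂ : IsMinibatchGradient L₂ f₂ νtr σ₂) (hJ : 0 < J) (α ηlam : ℝ) (y y' : Joint m d) :
    ∫ ζ : Sample B J Str Sval, slowIncrement α ηlam (∇ (batchLoss f₁ ζ.2.1) y)
        (∇ (batchLoss f₂ ζ.1) y) (∇ (batchLoss f₂ ζ.1) y') ∂(sampleLaw J νtr νval) =
      slowIncrement α ηlam (∇ L₁ y) (∇ L₂ y) (∇ L₂ y') := by
  have p1 := measurePreserving_validation νtr νval hJ
  have p2 := measurePreserving_training νtr νval hJ
  have i1 := h₁.integrable_gradient y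
  have i2 := h₂.integrable_gradient y
  have i3 := h₂.integrable_gradient y'
  have e1 := p1.integral_comp_of_aestronglyMeasurable i1.aestronglyMeasurable
  have e2 := p2.integral_comp_of_aestronglyMeasurable i2.aestronglyMeasurable
  have e3 := p2.integral_comp_of_aestronglyMeasurable i3.aestronglyMeasurable
  rw [← h₁.unbiased y, ← h₂.unbiased y, ← h₂.unbiased y', ← e1, ← e2, ← e3]
  exact integral_slowIncrement (p1.integrable_comp_of_integrable i1)
    (p2.integrable_comp_of_integrable i2) (p2.integrable_comp_of_integrable i3) α ηlam

lemma integral_fastIncrement_gradient (h₁ : IsMinibatchGradient L₁ f₁ νval σ₁)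
    (h₂ : IsMinibatchGradient L₂ f₂ νtr σ₂) (hJ : 0 < J) (blkU blkW : Fin d → Fin J)
    (α ηu ηw : ℝ) (y y' : Joint m d) :
    ∫ ζ : Sample B J Str Sval, fastIncrement blkU blkW α ηu ηw (∇ (batchLoss f₁ ζ.2.1) y)
        (∇ (batchLoss f₂ ζ.1) y) (∇ (batchLoss f₂ ζ.1) y') ζ.2.2.1 ζ.2.2.2
          ∂(sampleLaw J νtr νval) =
      meanFastIncrement J α ηu ηw (∇ L₁ y) (∇ L₂ y) (∇ L₂ y') := by
  obtain ⟨iu, eu⟩ := integral_blockPart_gradient h₂ hJ blkU y'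
    (measurePreserving_training_fst νtr νval hJ)
  obtain ⟨i2, e2⟩ := integral_blockPart_gradient h₂ hJ blkW y
    (measurePreserving_training_snd νtr νval hJ)
  obtain ⟨i1, e1⟩ := integral_blockPart_gradient h₁ hJ blkW y
    (measurePreserving_validation_snd νtr νval hJ)
  have e := integral_pair_neg_smul iu i1 i2 (α * ηu) ηw α
  rw [eu, e1, e2] at e
  rw [meanFastIncrement, smul_add, smul_comm (J : ℝ)⁻¹ α]
  refine Eq.trans (integral_congr_ae (.of_forall fun ζ => ?_)) e
  simp only [fastIncrement, blockPart_add, blockPart_smul]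

/-- The total size of the noise of the gradient estimates in one iteration, normalized to have
second moment at most `1`; the summand `1` accounts for deterministic terms. -/
noncomputable def noiseSize (L₁ L₂ : Joint m d → ℝ) (f₁ : Joint m d → Sval → ℝ)
    (f₂ : Joint m d → Str → ℝ) (κ : ℝ) (y y' : Joint m d) (ζ : Sample B J Str Sval) : ℝ :=
  (1 + ‖∇ (batchLoss f₁ ζ.2.1) y - ∇ L₁ y‖ + ‖∇ (batchLoss f₂ ζ.1) y - ∇ L₂ y‖
    + ‖∇ (batchLoss f₂ ζ.1) y' - ∇ L₂ y'‖) / κ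

lemma integral_one_add_add_add {A : Type*} [MeasurableSpace A] {μ : Measure A}
    [IsProbabilityMeasure μ] {a b c : A → ℝ} (ha : Integrable a μ) (hb : Integrable b μ)
    (hc : Integrable c μ) : Integrable (fun ζ => 1 + a ζ + b ζ + c ζ) μ ∧
      ∫ ζ, (1 + a ζ + b ζ + c ζ) ∂μ = 1 + ∫ ζ, a ζ ∂μ + ∫ ζ, b ζ ∂μ + ∫ ζ, c ζ ∂μ := by
  have i1 : Integrable (fun ζ => 1 + a ζ) μ := (integrable_const _).add ha
  have i2 : Integrable (fun ζ => 1 + a ζ + b ζ) μ := i1.add hb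
  refine ⟨i2.add hc, ?_⟩
  rw [integral_add i2 hc, integral_add i1 hb, integral_add (integrable_const _) ha]
  simp

lemma integral_noiseSize_sq_le (h₁ : IsMinibatchGradient L₁ f₁ νval σ₁)
    (h₂ : IsMinibatchGradient L₂ f₂ νtr σ₂) (hJ : 0 < J) {κ : ℝ}
    (hκ : κ ^ 2 = 4 * (1 + σ₁ ^ 2 / B + 2 * (σ₂ ^ 2 / B))) (y y' : Joint m d) :
    AEStronglyMeasurable (noiseSize L₁ L₂ f₁ f₂ κ y y') (sampleLaw J νtr νval) ∧
    Integrable (fun ζ => noiseSize L₁ L₂ f₁ f₂ κ y y' ζ ^ 2) (sampleLaw J νtr νval) ∧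
    ∫ ζ, noiseSize L₁ L₂ f₁ f₂ κ y y' ζ ^ 2 ∂(sampleLaw J νtr νval) ≤ 1 := by
  have := isProbabilityMeasure_sampleLaw (νtr := νtr) (νval := νval) hJ
  have p1 := measurePreserving_validation νtr νval hJ
  have p2 := measurePreserving_training νtr νval hJ
  have hκ0 : 0 < κ ^ 2 := by rw [hκ]; positivity
  have m1 := ((h₁.measurable_gradient y).sub_const (∇ L₁ y)).norm.comp p1.measurable
  have m2 := ((h₂.measurable_gradient y).sub_const (∇ L₂ y)).norm.comp p2.measurable
  have m3 := ((h₂.measurable_gradient y').sub_const (∇ L₂ y')).norm.comp p2.measurable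
  have hm : Measurable (noiseSize L₁ L₂ f₁ f₂ κ y y' : Sample B J Str Sval → ℝ) :=
    (((m1.const_add 1).add m2).add m3).div_const κ
  have i1 := p1.integrable_comp_of_integrable (h₁.integrable_sq y)
  have i2 := p2.integrable_comp_of_integrable (h₂.integrable_sq y)
  have i3 := p2.integrable_comp_of_integrable (h₂.integrable_sq y')
  have e1 := (p1.integral_comp_of_aestronglyMeasurable
    (h₁.integrable_sq y).aestronglyMeasurable).trans_le (h₁.variance_le y)
  have e2 := (p2.integral_comp_of_aestronglyMeasurable
    (h₂.integrable_sq y).aestronglyMeasurable).trans_le (h₂.variance_le y)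
  have e3 := (p2.integral_comp_of_aestronglyMeasurable
    (h₂.integrable_sq y').aestronglyMeasurable).trans_le (h₂.variance_le y')
  obtain ⟨i0123, e⟩ := integral_one_add_add_add i1 i2 i3
  have iall := i0123.const_mul (4 / κ ^ 2)
  have hle : ∀ ζ : Sample B J Str Sval, noiseSize L₁ L₂ f₁ f₂ κ y y' ζ ^ 2 ≤
      4 / κ ^ 2 * (1 + ‖∇ (batchLoss f₁ ζ.2.1) y - ∇ L₁ y‖ ^ 2
        + ‖∇ (batchLoss f₂ ζ.1) y - ∇ L₂ y‖ ^ 2 + ‖∇ (batchLoss f₂ ζ.1) y' - ∇ L₂ y'‖ ^ 2) := by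
    intro ζ
    rw [noiseSize, div_pow, div_mul_eq_mul_div]
    refine div_le_div_of_nonneg_right ?_ hκ0.le
    set a := ‖∇ (batchLoss f₁ ζ.2.1) y - ∇ L₁ y‖
    set b := ‖∇ (batchLoss f₂ ζ.1) y - ∇ L₂ y‖
    set c := ‖∇ (batchLoss f₂ ζ.1) y' - ∇ L₂ y'‖
    nlinarith only [sq_nonneg (1 - a), sq_nonneg (1 - b), sq_nonneg (1 - c), sq_nonneg (a - b),
      sq_nonneg (a - c), sq_nonneg (b - c)]
  have hi : Integrable (fun ζ => noiseSize L₁ L₂ f₁ f₂ κ y y' ζ ^ 2) (sampleLaw J νtr νval) :=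
    iall.mono' (hm.pow_const 2).aestronglyMeasurable (.of_forall fun ζ => by
      rw [Real.norm_of_nonneg (sq_nonneg _)]; exact hle ζ)
  refine ⟨hm.aestronglyMeasurable, hi, (integral_mono hi iall hle).trans ?_⟩
  rw [integral_const_mul]
  have e4 := e.trans_le (add_le_add (add_le_add (add_le_add le_rfl e1) e2) e3)
  refine (mul_le_mul_of_nonneg_left e4 (by positivity)).trans ?_
  rw [div_mul_eq_mul_div, div_le_one hκ0, hκ]
  linarith

end Sample

/-- One iteration satisfies the hypotheses on the increments of a two-time-scale recursion. -/
lemma BilevelRegularity.slowFastStep {m d J B : ℕ} {Sval Str : Type*} [MeasurableSpace Sval]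
    [MeasurableSpace Str] {νtr : Measure (Fin B → Str)} {νval : Measure (Fin B → Sval)}
    [IsProbabilityMeasure νtr] [IsProbabilityMeasure νval]
    {L₁ L₂ : Joint m d → ℝ} {f₁ : Joint m d → Sval → ℝ} {f₂ : Joint m d → Str → ℝ}
    {σ₁ σ₂ μ₂ η₀ ηlam₀ κ M s c : ℝ} {l₁₀ l₁₁ l₂₁ l₂₂ : ℝ≥0}
    (H : BilevelRegularity L₁ L₂ l₁₀ l₁₁ l₂₁ l₂₂ μ₂) (hμ : 0 < μ₂)
    (h₁ : IsMinibatchGradient L₁ f₁ νval σ₁) (h₂ : IsMinibatchGradient L₂ f₂ νtr σ₂)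
    (hM : StepConstants l₁₀ l₁₁ l₂₁ l₂₂ μ₂ η₀ ηlam₀ κ J M) (hJ : 0 < J) (hη : 0 < η₀)
    (hηl : 0 < ηlam₀) (hκ0 : 0 < κ) (hκ : κ ^ 2 = 4 * (1 + σ₁ ^ 2 / B + 2 * (σ₂ ^ 2 / B)))
    (hs : 0 < s) (hs1 : s ≤ 1) (hc : c ≤ η₀ * μ₂ / J) (blkU blkW : Fin d → Fin J)
    (x : Vec m) (z : Joint d d) :
    SlowFastStep (sampleLaw J νtr νval) (hypergradient L₁ L₂) (doubledArgmin L₂)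
      (solutionAdjoint L₂) (copyDiff d) M c s (ηlam₀ * s ^ 5) (ηlam₀ * J / η₀ * s) x z
      (fun ζ => slowIncrement s⁻¹ (ηlam₀ * s ^ 5) (∇ (batchLoss f₁ ζ.2.1) (pair x (wPart z)))
        (∇ (batchLoss f₂ ζ.1) (pair x (wPart z))) (∇ (batchLoss f₂ ζ.1) (pair x (lamPart z))))
      (fun ζ => fastIncrement blkU blkW s⁻¹ (η₀ * s ^ 4) (η₀ * s ^ 4)
        (∇ (batchLoss f₁ ζ.2.1) (pair x (wPart z))) (∇ (batchLoss f₂ ζ.1) (pair x (wPart z)))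
        (∇ (batchLoss f₂ ζ.1) (pair x (lamPart z))) ζ.2.2.1 ζ.2.2.2)
      (noiseSize L₁ L₂ f₁ f₂ κ (pair x (wPart z)) (pair x (lamPart z))) := by
  have p1 := measurePreserving_validation νtr νval hJ
  have p2 := measurePreserving_training νtr νval hJ
  have m1 := (h₁.measurable_gradient (pair x (wPart z))).comp p1.measurable
  have m2 := (h₂.measurable_gradient (pair x (wPart z))).comp p2.measurable
  have m3 := (h₂.measurable_gradient (pair x (lamPart z))).comp p2.measurable
  have mj : Measurable fun ζ : Sample B J Str Sval => ζ.2.2.1 :=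
    measurable_fst.comp (measurable_snd.comp measurable_snd)
  have mr : Measurable fun ζ : Sample B J Str Sval => ζ.2.2.2 :=
    measurable_snd.comp (measurable_snd.comp measurable_snd)
  obtain ⟨n1, n2, n3⟩ := integral_noiseSize_sq_le h₁ h₂ hJ hκ (pair x (wPart z))
    (pair x (lamPart z))
  have hq0 : 0 ≤ ‖z - doubledArgmin L₂ x‖ := norm_nonneg _
  have hκξ : ∀ ζ : Sample B J Str Sval, (1 + ‖∇ (batchLoss f₁ ζ.2.1) (pair x (wPart z))
      - ∇ L₁ (pair x (wPart z))‖ + ‖∇ (batchLoss f₂ ζ.1) (pair x (wPart z))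
      - ∇ L₂ (pair x (wPart z))‖ + ‖∇ (batchLoss f₂ ζ.1) (pair x (lamPart z))
      - ∇ L₂ (pair x (lamPart z))‖) =
      κ * noiseSize L₁ L₂ f₁ f₂ κ (pair x (wPart z)) (pair x (lamPart z)) ζ := fun ζ => by
    rw [noiseSize, mul_div_cancel₀ _ hκ0.ne']
  have hξ0 : ∀ ζ : Sample B J Str Sval,
      0 ≤ noiseSize L₁ L₂ f₁ f₂ κ (pair x (wPart z)) (pair x (lamPart z)) ζ := fun ζ => by
    unfold noiseSize; positivity
  refine ⟨(measurable_slowIncrement m1 m2 m3 _ _).aestronglyMeasurable,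
    (measurable_fastIncrement m1 m2 m3 mj mr _ _ _ _ _).aestronglyMeasurable, n1, hξ0, n2, n3,
    fun ζ => ?_, fun ζ => ?_, ?_, ?_⟩
  · refine (H.norm_slowIncrement_add_le hμ hηl.le hs hs1 x z _ _ _).trans ?_
    rw [hκξ]
    have a1 := mul_le_mul_of_nonneg_right hM.slow (mul_nonneg (pow_nonneg hs.le 4) hq0)
    have a2 := mul_le_mul_of_nonneg_right hM.slow_noise
      (mul_nonneg (pow_nonneg hs.le 4) (hξ0 ζ))
    linarith only [a1, a2]
  · refine (H.norm_fastIncrement_le hμ hη.le hs hs1 blkU blkW _ _ x z _ _ _).trans ?_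
    rw [hκξ]
    have a1 := mul_le_mul_of_nonneg_right hM.fast (mul_nonneg (pow_nonneg hs.le 3) hq0)
    have a2 := mul_le_mul_of_nonneg_right hM.fast_noise
      (mul_nonneg (pow_nonneg hs.le 3) (hξ0 ζ))
    linarith only [a1, a2]
  · rw [integral_fastIncrement_gradient h₁ h₂ hJ]
    exact H.inner_meanFastIncrement_le hμ hη.le hs hJ hc hM.drift x z
  · rw [integral_fastIncrement_gradient h₁ h₂ hJ, integral_slowIncrement_gradient h₁ h₂ hJ]
    exact H.norm_mean_add_le hμ hη hηl.le hs hJ hM.mean hM.mean_huber x z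

/-! ### Convergence of the iteration -/

lemma SlowFastData.sq_norm_grad_le {X Z Y : Type*} [NormedAddCommGroup X] [InnerProductSpace ℝ X]
    [NormedAddCommGroup Z] [InnerProductSpace ℝ Z] [NormedAddCommGroup Y] [NormedSpace ℝ Y]
    {f : X → ℝ} {grad : X → X} {target : X → Z} {P : X → Y →L[ℝ] X} {D : Z →L[ℝ] Y} {M : ℝ}
    (H : SlowFastData f grad target P D M) (x : X) : ‖grad x‖ ^ 2 ≤ 2 * M * f x := by
  have hM : 0 < M := zero_lt_one.trans_le H.one_le
  -- one gradient step cannot decrease `f` below zero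
  have h := H.descent x (x - M⁻¹ • grad x)
  have h0 := H.nonneg (x - M⁻¹ • grad x)
  rw [sub_sub_cancel_left, inner_neg_right, norm_neg, norm_smul, real_inner_smul_right,
    real_inner_self_eq_norm_sq, Real.norm_of_nonneg (by positivity)] at h
  have e : M / 2 * (M⁻¹ * ‖grad x‖) ^ 2 = M⁻¹ * ‖grad x‖ ^ 2 / 2 := by field_simp
  have e2 : ‖grad x‖ ^ 2 = M * (M⁻¹ * ‖grad x‖ ^ 2) := by field_simp
  rw [e] at h
  rw [e2]
  nlinarith

namespace BilevelRegularity

variable {m d J B : ℕ} {Sval Str : Type*} [MeasurableSpace Sval]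
  [MeasurableSpace Str] {νtr : Measure (Fin B → Str)} {νval : Measure (Fin B → Sval)}
  [IsProbabilityMeasure νtr] [IsProbabilityMeasure νval]
  {L₁ L₂ : Joint m d → ℝ} {f₁ : Joint m d → Sval → ℝ} {f₂ : Joint m d → Str → ℝ}
  {σ₁ σ₂ μ₂ η₀ ηlam₀ κ M s c gap dist₀ : ℝ} {l₁₀ l₁₁ l₂₁ l₂₂ : ℝ≥0}

lemma energy_init_le (H : BilevelRegularity L₁ L₂ l₁₀ l₁₁ l₂₁ l₂₂ μ₂) (hμ : 0 < μ₂)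
    (hM : StepConstants l₁₀ l₁₁ l₂₁ l₂₂ μ₂ η₀ ηlam₀ κ J M) (init : Iterate m d)
    (hgap : ∀ lam, bilevelObjective L₁ L₂ init.lam - gap ≤ bilevelObjective L₁ L₂ lam)
    (hu : ‖init.u - lowerArgmin L₂ init.lam‖ ≤ dist₀)
    (hw : ‖init.w - lowerArgmin L₂ init.lam‖ ≤ dist₀) :
    energy (fun lam => bilevelObjective L₁ L₂ lam - (bilevelObjective L₁ L₂ init.lam - gap))
      (hypergradient L₁ L₂) (doubledArgmin L₂) init.lam (pair init.u init.w) ≤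
      (1 + 2 * M) * |gap| + 2 * dist₀ ^ 2 + 1 := by
  have h := (H.slowFastData hμ hM hgap).sq_norm_grad_le init.lam
  have h1 : ‖pair init.u init.w - doubledArgmin L₂ init.lam‖ ^ 2 ≤ 2 * dist₀ ^ 2 := by
    rw [doubledArgmin, ← pair_sub, norm_sq_eq_lamPart_add_wPart, lamPart_pair, wPart_pair]
    have a1 := pow_le_pow_left₀ (norm_nonneg _) hu 2
    have a2 := pow_le_pow_left₀ (norm_nonneg _) hw 2
    linarith
  simp only [sub_sub_cancel] at h
  have h2 := le_abs_self gap
  have hM1 := hM.one_le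
  simp only [energy, sub_sub_cancel]
  nlinarith

variable {Ω : Type*} [MeasurableSpace Ω] {P : Measure Ω} [IsProbabilityMeasure P]
  {ζ : ℕ → Ω → Sample B J Str Sval} {a : ℝ} {p₀ : Vec m × Joint d d} {K : ℕ}

/-- One iteration multiplies the mean energy at most by a constant. -/
lemma integral_energy_stateStep_le (H : BilevelRegularity L₁ L₂ l₁₀ l₁₁ l₂₁ l₂₂ μ₂) (hμ : 0 < μ₂)
    (h₁ : IsMinibatchGradient L₁ f₁ νval σ₁) (h₂ : IsMinibatchGradient L₂ f₂ νtr σ₂)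
    (hM : StepConstants l₁₀ l₁₁ l₂₁ l₂₂ μ₂ η₀ ηlam₀ κ J M) (hJ : 0 < J) (hη : 0 < η₀)
    (hηl : 0 < ηlam₀) (hκ0 : 0 < κ) (hκ : κ ^ 2 = 4 * (1 + σ₁ ^ 2 / B + 2 * (σ₂ ^ 2 / B)))
    (ha : ∀ lam, a ≤ bilevelObjective L₁ L₂ lam)
    (hs : 0 < s) (hs1 : s ≤ 1) (blkU blkW : Fin d → Fin J) (p : Vec m × Joint d d) :
    Integrable (fun b : Sample B J Str Sval =>
      (fun p : Vec m × Joint d d => energy (fun lam => bilevelObjective L₁ L₂ lam - a)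
        (hypergradient L₁ L₂) (doubledArgmin L₂) p.1 p.2)
        (stateStep f₁ f₂ blkU blkW s⁻¹ (η₀ * s ^ 4) (η₀ * s ^ 4) (ηlam₀ * s ^ 5) p b))
      (sampleLaw J νtr νval) ∧
    ∫ b : Sample B J Str Sval,
      (fun p : Vec m × Joint d d => energy (fun lam => bilevelObjective L₁ L₂ lam - a)
        (hypergradient L₁ L₂) (doubledArgmin L₂) p.1 p.2)
        (stateStep f₁ f₂ blkU blkW s⁻¹ (η₀ * s ^ 4) (η₀ * s ^ 4) (ηlam₀ * s ^ 5) p b)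
      ∂(sampleLaw J νtr νval) ≤
    60 * M ^ 4 * (fun p : Vec m × Joint d d => energy (fun lam => bilevelObjective L₁ L₂ lam - a)
        (hypergradient L₁ L₂) (doubledArgmin L₂) p.1 p.2) p := by
  have := isProbabilityMeasure_sampleLaw (νtr := νtr) (νval := νval) hJ
  exact (H.slowFastStep hμ h₁ h₂ hM hJ hη hηl hκ0 hκ hs hs1 le_rfl blkU blkW p.1
    p.2).integral_energy_le (H.slowFastData hμ hM ha) hs hs1 (by positivity)
    (mul_le_mul_of_nonneg_right hM.step (by positivity))

lemma integrable_sq_norm_hypergradient (H : BilevelRegularity L₁ L₂ l₁₀ l₁₁ l₂₁ l₂₂ μ₂)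
    (hμ : 0 < μ₂)
    (h₁ : IsMinibatchGradient L₁ f₁ νval σ₁) (h₂ : IsMinibatchGradient L₂ f₂ νtr σ₂)
    (hM : StepConstants l₁₀ l₁₁ l₂₁ l₂₂ μ₂ η₀ ηlam₀ κ J M) (hJ : 0 < J) (hη : 0 < η₀)
    (hηl : 0 < ηlam₀) (hκ0 : 0 < κ) (hκ : κ ^ 2 = 4 * (1 + σ₁ ^ 2 / B + 2 * (σ₂ ^ 2 / B)))
    (ha : ∀ lam, a ≤ bilevelObjective L₁ L₂ lam)
    (hs : 0 < s) (hs1 : s ≤ 1) (blkU blkW : Fin d → Fin J)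
    (hζ : ∀ k, Measurable (ζ k)) (hind : iIndepFun ζ P)
    (hlaw : ∀ k, P.map (ζ k) = sampleLaw J νtr νval) (k : ℕ) :
    Integrable (fun ω => ‖hypergradient L₁ L₂ (iterateWith (stateStep f₁ f₂ blkU blkW s⁻¹
      (η₀ * s ^ 4) (η₀ * s ^ 4) (ηlam₀ * s ^ 5)) p₀ (fun n => ζ n ω) k).1‖ ^ 2) P ∧
    ∫ ω, ‖hypergradient L₁ L₂ (iterateWith (stateStep f₁ f₂ blkU blkW s⁻¹
      (η₀ * s ^ 4) (η₀ * s ^ 4) (ηlam₀ * s ^ 5)) p₀ (fun n => ζ n ω) k).1‖ ^ 2 ∂P ≤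
      (60 * M ^ 4) ^ k * energy (fun lam => bilevelObjective L₁ L₂ lam - a)
        (hypergradient L₁ L₂) (doubledArgmin L₂) p₀.1 p₀.2 := by
  have := isProbabilityMeasure_sampleLaw (νtr := νtr) (νval := νval) hJ
  have D := H.slowFastData hμ hM ha
  have hT := measurable_stateStep (J := J) h₁ h₂ blkU blkW s⁻¹ (η₀ * s ^ 4) (η₀ * s ^ 4)
    (ηlam₀ * s ^ 5)
  have hE := fun p => H.integral_energy_stateStep_le hμ h₁ h₂ hM hJ hη hηl hκ0 hκ ha hs hs1 blkU
    blkW p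
  have hE0 : ∀ p : Vec m × Joint d d, 0 ≤ energy (fun lam => bilevelObjective L₁ L₂ lam - a)
      (hypergradient L₁ L₂) (doubledArgmin L₂) p.1 p.2 := fun p =>
    zero_le_one.trans (D.one_le_energy p.1 p.2)
  obtain ⟨i1, e1⟩ := integral_energy_iterateWith_le (x₀ := p₀) hT hζ hind hlaw
    D.continuous_energy.measurable hE0 (by positivity) (fun p => (hE p).1) (fun p => (hE p).2) k
  have hX := (measurable_iterateWith (x₀ := p₀) hT k).comp (measurable_pi_lambda _ fun n => hζ n)
  have hi := i1.mono' ((D.continuous_grad.measurable.comp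
    (measurable_fst.comp hX)).norm.pow_const 2).aestronglyMeasurable
    (.of_forall fun ω => by
      rw [Real.norm_of_nonneg (sq_nonneg _)]
      exact D.sq_norm_grad_le_energy _ _)
  exact ⟨hi, (integral_mono hi i1 fun ω => D.sq_norm_grad_le_energy _ _).trans e1⟩

lemma sum_integral_sq_norm_hypergradient_le (H : BilevelRegularity L₁ L₂ l₁₀ l₁₁ l₂₁ l₂₂ μ₂)
    (hμ : 0 < μ₂)
    (h₁ : IsMinibatchGradient L₁ f₁ νval σ₁) (h₂ : IsMinibatchGradient L₂ f₂ νtr σ₂)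
    (hM : StepConstants l₁₀ l₁₁ l₂₁ l₂₂ μ₂ η₀ ηlam₀ κ J M) (hJ : 0 < J) (hη : 0 < η₀)
    (hηl : 0 < ηlam₀) (hκ0 : 0 < κ) (hκ : κ ^ 2 = 4 * (1 + σ₁ ^ 2 / B + 2 * (σ₂ ^ 2 / B)))
    (ha : ∀ lam, a ≤ bilevelObjective L₁ L₂ lam)
    (hc0 : 0 < c) (hc1 : c ≤ 1) (hc : c ≤ η₀ * μ₂ / J) {C₁ C₂ C s₀ : ℝ} (hC₁ : 0 ≤ C₁)
    (hC₂ : 0 ≤ C₂) (hW : LyapunovWeights M c (300 * M ^ 9 / c) C₁ C₂ C s₀)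
    (hs : 0 < s) (hs1 : 32 * M ^ 4 * s ≤ c) (hs0 : s ≤ s₀) (blkU blkW : Fin d → Fin J)
    (hζ : ∀ k, Measurable (ζ k)) (hind : iIndepFun ζ P)
    (hlaw : ∀ k, P.map (ζ k) = sampleLaw J νtr νval) (n : ℕ) :
    ηlam₀ * s ^ 5 / 2 * ∑ k ∈ Finset.range n, ∫ ω, ‖hypergradient L₁ L₂ (iterateWith
      (stateStep f₁ f₂ blkU blkW s⁻¹ (η₀ * s ^ 4) (η₀ * s ^ 4) (ηlam₀ * s ^ 5)) p₀
        (fun n => ζ n ω) k).1‖ ^ 2 ∂P ≤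
      (M ^ 5 + C₁ + C₂) * energy (fun lam => bilevelObjective L₁ L₂ lam - a)
        (hypergradient L₁ L₂) (doubledArgmin L₂) p₀.1 p₀.2 + n * (C * s ^ 7) := by
  have := isProbabilityMeasure_sampleLaw (νtr := νtr) (νval := νval) hJ
  have D := H.slowFastData hμ hM ha
  have hs1' : s ≤ 1 := by
    have : 1 ≤ M ^ 4 := one_le_pow₀ hM.one_le
    nlinarith
  have hT := measurable_stateStep (J := J) h₁ h₂ blkU blkW s⁻¹ (η₀ * s ^ 4) (η₀ * s ^ 4)
    (ηlam₀ * s ^ 5)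
  have hE := fun p => H.integral_energy_stateStep_le hμ h₁ h₂ hM hJ hη hηl hκ0 hκ ha hs hs1' blkU
    blkW p
  have hE0 : ∀ p : Vec m × Joint d d, 0 ≤ energy (fun lam => bilevelObjective L₁ L₂ lam - a)
      (hypergradient L₁ L₂) (doubledArgmin L₂) p.1 p.2 := fun p =>
    zero_le_one.trans (D.one_le_energy p.1 p.2)
  have hβ0 : 0 ≤ ηlam₀ * J / η₀ * s := by positivity
  have hβ : ηlam₀ * J / η₀ * s ≤ M * s := mul_le_mul_of_nonneg_right hM.ratio hs.le
  have hb : ηlam₀ * s ^ 5 ≤ M * s ^ 5 := mul_le_mul_of_nonneg_right hM.step (by positivity)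
  have hb' : s ^ 5 ≤ M * (ηlam₀ * s ^ 5) := by
    have := mul_le_mul_of_nonneg_right hM.step_inv (pow_nonneg hs.le 5)
    linarith
  have hstep : ∀ p : Vec m × Joint d d, _ := fun p =>
    (H.slowFastStep hμ h₁ h₂ hM hJ hη hηl hκ0 hκ hs hs1' hc blkU blkW p.1
      p.2).integral_lyapunov_le D hc0 hc1 hs hs1 hs0 (by positivity) hb hb' hβ0 hβ le_rfl hC₁ hC₂ hW
  have hV : ∀ p : Vec m × Joint d d, _ := fun p =>
    D.lyapunov_le_energy hs.le hs1' hβ0 hβ hC₁ hC₂ p.1 p.2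
  have hG : Measurable fun p : Vec m × Joint d d => ‖hypergradient L₁ L₂ p.1‖ ^ 2 :=
    ((D.continuous_grad.measurable.comp measurable_fst).norm.pow_const 2)
  have h := sum_integral_iterateWith_le (x₀ := p₀) hT hζ hind hlaw
    D.continuous_energy.measurable hE0 (by positivity) (fun p => (hE p).1) (fun p => (hE p).2)
    (D.continuous_lyapunov (ηlam₀ * J / η₀ * s) s C₁ C₂).measurable
    (fun p => D.lyapunov_nonneg hs.le hC₁ hC₂ p.1 p.2) hV hG (fun p => sq_nonneg _)
    (fun p => D.sq_norm_grad_le_energy p.1 p.2) hstep n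
  exact h.trans (add_le_add (hV p₀) le_rfl)

end BilevelRegularity

/-! ### The uniformly chosen iterate -/

namespace BilevelRegularity

variable {m d J B : ℕ} {Sval Str : Type*} [MeasurableSpace Sval]
  [MeasurableSpace Str] {νtr : Measure (Fin B → Str)} {νval : Measure (Fin B → Sval)}
  [IsProbabilityMeasure νtr] [IsProbabilityMeasure νval]
  {L₁ L₂ : Joint m d → ℝ} {f₁ : Joint m d → Sval → ℝ} {f₂ : Joint m d → Str → ℝ}
  {σ₁ σ₂ μ₂ η₀ ηlam₀ κ M s c : ℝ} {l₁₀ l₁₁ l₂₁ l₂₂ : ℝ≥0}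
  {Ω : Type*} [MeasurableSpace Ω] {P : Measure Ω} [IsProbabilityMeasure P]
  {ζ : ℕ → Ω → Sample B J Str Sval} {a : ℝ} {p₀ : Vec m × Joint d d} {K : ℕ}

/-- The rate of convergence for all numbers `K = s ^ (-7)` of iterations: the Lyapunov bound
applies when `s` is small, and there are only finitely many other values of `K`. -/
lemma integral_sq_norm_hypergradient_uniform_le
    (H : BilevelRegularity L₁ L₂ l₁₀ l₁₁ l₂₁ l₂₂ μ₂) (hμ : 0 < μ₂)
    (h₁ : IsMinibatchGradient L₁ f₁ νval σ₁) (h₂ : IsMinibatchGradient L₂ f₂ νtr σ₂)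
    (hM : StepConstants l₁₀ l₁₁ l₂₁ l₂₂ μ₂ η₀ ηlam₀ κ J M) (hJ : 0 < J) (hη : 0 < η₀)
    (hηl : 0 < ηlam₀) (hκ0 : 0 < κ) (hκ : κ ^ 2 = 4 * (1 + σ₁ ^ 2 / B + 2 * (σ₂ ^ 2 / B)))
    (ha : ∀ lam, a ≤ bilevelObjective L₁ L₂ lam)
    (hc0 : 0 < c) (hc1 : c ≤ 1) (hc : c ≤ η₀ * μ₂ / J) {C₁ C₂ C s₀ s₁ E₀ : ℝ} (hC₁ : 0 ≤ C₁)
    (hC₂ : 0 ≤ C₂) (hC : 0 ≤ C) (hW : LyapunovWeights M c (300 * M ^ 9 / c) C₁ C₂ C s₀)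
    (hs₁ : 0 < s₁) (hs₁0 : s₁ ≤ s₀) (hs₁c : 32 * M ^ 4 * s₁ ≤ c)
    (hs : 0 < s) (hK : 1 ≤ K) (hsK : s ^ 7 * K = 1) (blkU blkW : Fin d → Fin J)
    (hζ : ∀ k, Measurable (ζ k)) (hind : iIndepFun ζ P)
    (hlaw : ∀ k, P.map (ζ k) = sampleLaw J νtr νval) {N : Ω → ℕ} (hN : Measurable N)
    (hlawN : P.map N = uniformOn (Set.Icc 1 K)) (hindN : IndepFun N (fun ω k => ζ k ω) P)
    (hE₀ : energy (fun lam => bilevelObjective L₁ L₂ lam - a) (hypergradient L₁ L₂)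
      (doubledArgmin L₂) p₀.1 p₀.2 ≤ E₀) :
    Integrable (fun ω => ‖hypergradient L₁ L₂ (iterateWith (stateStep f₁ f₂ blkU blkW s⁻¹
      (η₀ * s ^ 4) (η₀ * s ^ 4) (ηlam₀ * s ^ 5)) p₀ (fun n => ζ n ω) (N ω)).1‖ ^ 2) P ∧
    ∫ ω, ‖hypergradient L₁ L₂ (iterateWith (stateStep f₁ f₂ blkU blkW s⁻¹
      (η₀ * s ^ 4) (η₀ * s ^ 4) (ηlam₀ * s ^ 5)) p₀ (fun n => ζ n ω) (N ω)).1‖ ^ 2 ∂P ≤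
      (2 / ηlam₀ * ((M ^ 5 + C₁ + C₂) * E₀ + 2 * C)
        + (60 * M ^ 4) ^ ⌈(s₁⁻¹) ^ 7⌉₊ * E₀ / s₁ ^ 2) * s ^ 2 := by
  have D := H.slowFastData hμ hM ha
  have hM1 := hM.one_le
  have hK1 : (1 : ℝ) ≤ K := by exact_mod_cast hK
  have hK0 : (0 : ℝ) < K := by linarith
  have hE0 : 0 ≤ E₀ := zero_le_one.trans ((D.one_le_energy p₀.1 p₀.2).trans hE₀)
  have hs7 : s ^ 7 ≤ 1 := by
    rw [← hsK]; exact le_mul_of_one_le_right (by positivity) hK1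
  have hs1 : s ≤ 1 := (pow_le_one_iff_of_nonneg hs.le (by norm_num)).1 hs7
  have hT := measurable_stateStep (J := J) h₁ h₂ blkU blkW s⁻¹ (η₀ * s ^ 4) (η₀ * s ^ 4)
    (ηlam₀ * s ^ 5)
  have hG : Measurable fun p : Vec m × Joint d d => ‖hypergradient L₁ L₂ p.1‖ ^ 2 :=
    ((D.continuous_grad.measurable.comp measurable_fst).norm.pow_const 2)
  have hk := fun k => H.integrable_sq_norm_hypergradient (p₀ := p₀) hμ h₁ h₂ hM hJ hη hηl hκ0 hκ ha
    hs hs1 blkU blkW hζ hind hlaw k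
  obtain ⟨hi, he⟩ := integral_iterateWith_uniform (x₀ := p₀) hT hK hN hlawN hindN hG
    fun k => (hk k).1
  refine ⟨hi, ?_⟩
  rw [he]
  have hM60 : 1 ≤ 60 * M ^ 4 := by linarith [one_le_pow₀ hM1 (n := 4)]
  have t1 : 0 ≤ 2 / ηlam₀ * ((M ^ 5 + C₁ + C₂) * E₀ + 2 * C) := by positivity
  have t2 : 0 ≤ (60 * M ^ 4) ^ ⌈(s₁⁻¹) ^ 7⌉₊ * E₀ / s₁ ^ 2 := by positivity
  rw [add_mul]
  rcases le_total s s₁ with hle | hle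
  · refine le_add_of_le_of_nonneg ?_ (by positivity)
    have hs1c : 32 * M ^ 4 * s ≤ c :=
      (mul_le_mul_of_nonneg_left hle (by positivity)).trans hs₁c
    have hsum := H.sum_integral_sq_norm_hypergradient_le (p₀ := p₀) hμ h₁ h₂ hM hJ hη hηl hκ0 hκ ha
      hc0 hc1 hc hC₁ hC₂ hW hs hs1c (hle.trans hs₁0) blkU blkW hζ hind hlaw (K + 1)
    rw [Finset.sum_range_succ'] at hsum
    set S := ∑ k ∈ Finset.range K, ∫ ω, ‖hypergradient L₁ L₂ (iterateWith
      (stateStep f₁ f₂ blkU blkW s⁻¹ (η₀ * s ^ 4) (η₀ * s ^ 4) (ηlam₀ * s ^ 5)) p₀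
        (fun n => ζ n ω) (k + 1)).1‖ ^ 2 ∂P with hS
    have h0 : 0 ≤ ∫ ω, ‖hypergradient L₁ L₂ (iterateWith
      (stateStep f₁ f₂ blkU blkW s⁻¹ (η₀ * s ^ 4) (η₀ * s ^ 4) (ηlam₀ * s ^ 5)) p₀
        (fun n => ζ n ω) 0).1‖ ^ 2 ∂P := integral_nonneg fun _ => sq_nonneg _
    have hb0 : 0 ≤ ηlam₀ * s ^ 5 / 2 := by positivity
    have h3 := mul_nonneg hb0 h0
    have h4 := mul_le_mul_of_nonneg_left hE₀ (by positivity : 0 ≤ M ^ 5 + C₁ + C₂)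
    have h5 : ((K + 1 : ℕ) : ℝ) * (C * s ^ 7) ≤ 2 * C := by
      push_cast
      have : C * s ^ 7 ≤ C := mul_le_of_le_one_right hC hs7
      have e : ((K : ℝ) + 1) * (C * s ^ 7) = C * (s ^ 7 * K) + C * s ^ 7 := by ring
      rw [e, hsK]
      linarith
    have h6 : ηlam₀ * s ^ 5 / 2 * S ≤ (M ^ 5 + C₁ + C₂) * E₀ + 2 * C := by
      rw [mul_add] at hsum
      linarith
    rw [div_le_iff₀ hK0]
    have e1 : 2 / ηlam₀ * ((M ^ 5 + C₁ + C₂) * E₀ + 2 * C) * s ^ 2 * K =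
        ((M ^ 5 + C₁ + C₂) * E₀ + 2 * C) * (s ^ 7 * K) / (ηlam₀ * s ^ 5 / 2) := by
      field_simp
    rw [e1, hsK, mul_one, le_div_iff₀ (by positivity)]
    linarith
  · refine le_add_of_nonneg_of_le (by positivity) ?_
    have hKn : K ≤ ⌈(s₁⁻¹) ^ 7⌉₊ := by
      have h1 : (K : ℝ) ≤ (s₁⁻¹) ^ 7 := by
        rw [inv_pow, ← one_div, le_div_iff₀ (by positivity), mul_comm, ← hsK]
        exact mul_le_mul_of_nonneg_right (pow_le_pow_left₀ hs₁.le hle 7) hK0.le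
      exact_mod_cast h1.trans (Nat.le_ceil _)
    have hterm : ∀ k ∈ Finset.range K, ∫ ω, ‖hypergradient L₁ L₂ (iterateWith
        (stateStep f₁ f₂ blkU blkW s⁻¹ (η₀ * s ^ 4) (η₀ * s ^ 4) (ηlam₀ * s ^ 5)) p₀
          (fun n => ζ n ω) (k + 1)).1‖ ^ 2 ∂P ≤ (60 * M ^ 4) ^ ⌈(s₁⁻¹) ^ 7⌉₊ * E₀ := by
      intro k hkK
      refine (hk (k + 1)).2.trans (mul_le_mul ?_ hE₀ ?_ (by positivity))
      · exact pow_le_pow_right₀ hM60 ((Nat.succ_le_of_lt (Finset.mem_range.1 hkK)).trans hKn)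
      · exact zero_le_one.trans (D.one_le_energy p₀.1 p₀.2)
    have hS := Finset.sum_le_card_nsmul _ _ _ hterm
    rw [Finset.card_range, nsmul_eq_mul] at hS
    have h1 : 1 ≤ s ^ 2 / s₁ ^ 2 := by
      rw [one_le_div (by positivity)]
      exact pow_le_pow_left₀ hs₁.le hle 2
    have h2 : 0 ≤ (60 * M ^ 4) ^ ⌈(s₁⁻¹) ^ 7⌉₊ * E₀ := by positivity
    rw [div_le_iff₀ hK0]
    refine hS.trans ?_
    have h3 := mul_le_mul_of_nonneg_left h1 h2
    have e : (60 * M ^ 4) ^ ⌈(s₁⁻¹) ^ 7⌉₊ * E₀ / s₁ ^ 2 * s ^ 2 =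
        (60 * M ^ 4) ^ ⌈(s₁⁻¹) ^ 7⌉₊ * E₀ * (s ^ 2 / s₁ ^ 2) := by ring
    rw [e, mul_comm]
    exact mul_le_mul_of_nonneg_right (by linarith) hK0.le

end BilevelRegularity

/-- The number of iterations needed for a given accuracy. -/
lemma le_of_div_pow_le {C p ε s K : ℝ} (hC : 0 ≤ C) (hp : 0 ≤ p) (hs : 0 < s)
    (hsK : s ^ 7 * K = 1) (hε : 0 < ε) (hε1 : ε ≤ 1) (h : (p ^ 7 + (1 + C) ^ 7) / ε ^ 7 ≤ K) :
    p ≤ s⁻¹ ∧ C * s ^ 2 ≤ ε ^ 2 := by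
  rw [div_le_iff₀ (by positivity)] at h
  have h1 := mul_le_mul_of_nonneg_left h (pow_nonneg hs.le 7)
  rw [← mul_assoc, hsK, one_mul, mul_add] at h1
  have a1 : 0 ≤ s ^ 7 * p ^ 7 := by positivity
  have a2 : 0 ≤ s ^ 7 * (1 + C) ^ 7 := by positivity
  constructor
  · have h2 : (s * p) ^ 7 ≤ 1 ^ 7 := by
      rw [mul_pow, one_pow]
      linarith [pow_le_one₀ hε.le hε1 (n := 7)]
    have h3 : s * p ≤ 1 := le_of_pow_le_pow_left₀ (by norm_num) zero_le_one h2
    rwa [← one_div, le_div_iff₀ hs, mul_comm]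
  · have h2 : (s * (1 + C)) ^ 7 ≤ ε ^ 7 := by
      rw [mul_pow]
      linarith
    have h3 : s * (1 + C) ≤ ε := le_of_pow_le_pow_left₀ (by norm_num) hε.le h2
    have h4 := pow_le_pow_left₀ (by positivity) h3 2
    have h5 : C * s ^ 2 ≤ (1 + C) ^ 2 * s ^ 2 :=
      mul_le_mul_of_nonneg_right (by nlinarith) (by positivity)
    rw [mul_pow] at h4
    linarith

theorem theorem1
    (l₁₀ l₁₁ l₂₁ l₂₂ : ℝ≥0) (μ₂ σ₁ σ₂ η₀ ηlam₀ gap dist₀ : ℝ) (J B : ℕ)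
    (hμ₂ : 0 < μ₂) (hJ : 0 < J) (hB : 0 < B) (hη₀ : 0 < η₀) (hηlam₀ : 0 < ηlam₀)
    (hη₀_le : η₀ ≤ 8 * J / μ₂)
    (hratio : 6 * Real.sqrt 2 * conditionNumber l₁₀ l₁₁ l₂₁ l₂₂ μ₂ ^ 2 * J ≤ η₀ / ηlam₀) :
    ∃ C C' : ℝ, ∀ (m d : ℕ) (Sval Str Ω : Type*)
      [MeasurableSpace Sval] [MeasurableSpace Str] [MeasurableSpace Ω]
      (L₁ L₂ : Joint m d → ℝ) (f₁ : Joint m d → Sval → ℝ) (f₂ : Joint m d → Str → ℝ)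
      (νval : Measure (Fin B → Sval)) (νtr : Measure (Fin B → Str))
      [IsProbabilityMeasure νval] [IsProbabilityMeasure νtr]
      (blkU blkW : Fin d → Fin J) (init : Iterate m d) (K : ℕ)
      (P : Measure Ω) [IsProbabilityMeasure P]
      (Dtr : ℕ → Ω → Fin B → Str) (Dval : ℕ → Ω → Fin B → Sval) (j r : ℕ → Ω → Fin J)
      (N : Ω → ℕ),
      BilevelRegularity L₁ L₂ l₁₀ l₁₁ l₂₁ l₂₂ μ₂ →
      IsMinibatchGradient L₁ f₁ νval σ₁ →
      IsMinibatchGradient L₂ f₂ νtr σ₂ →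
      (∀ lam, bilevelObjective L₁ L₂ init.lam - gap ≤ bilevelObjective L₁ L₂ lam) →
      ‖init.u - lowerArgmin L₂ init.lam‖ ≤ dist₀ →
      ‖init.w - lowerArgmin L₂ init.lam‖ ≤ dist₀ →
      8 * penaltySmoothness L₁ L₂ (2 * l₁₁ / μ₂) * ηlam₀ ≤ 1 →
      1 ≤ K →
      ScaleBiORandomness P K νtr νval Dtr Dval j r N →
      Differentiable ℝ (bilevelObjective L₁ L₂) ∧
      Integrable (fun ω => ‖∇ (bilevelObjective L₁ L₂)
        (scaleBiOOutput f₁ f₂ blkU blkW η₀ ηlam₀ K init Dtr Dval j r N ω)‖ ^ 2) P ∧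
      (l₁₁ / μ₂ ≤ (K : ℝ) ^ (1 / 7 : ℝ) →
        ∫ ω, ‖∇ (bilevelObjective L₁ L₂)
          (scaleBiOOutput f₁ f₂ blkU blkW η₀ ηlam₀ K init Dtr Dval j r N ω)‖ ^ 2 ∂P
            ≤ C / (K : ℝ) ^ (2 / 7 : ℝ)) ∧
      (∀ ε : ℝ, 0 < ε → ε ≤ 1 → C' / ε ^ 7 ≤ K →
        l₁₁ / μ₂ ≤ (K : ℝ) ^ (1 / 7 : ℝ) ∧
        ∫ ω, ‖∇ (bilevelObjective L₁ L₂)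
          (scaleBiOOutput f₁ f₂ blkU blkW η₀ ηlam₀ K init Dtr Dval j r N ω)‖ ^ 2 ∂P ≤ ε ^ 2) := by
  -- `κ` normalizes the noise, `c` bounds the contraction rate of the fast variable from below
  obtain ⟨κ, hκ0, hκ⟩ : ∃ κ : ℝ, 0 < κ ∧ κ ^ 2 = 4 * (1 + σ₁ ^ 2 / B + 2 * (σ₂ ^ 2 / B)) :=
    ⟨√(4 * (1 + σ₁ ^ 2 / B + 2 * (σ₂ ^ 2 / B))), by positivity, Real.sq_sqrt (by positivity)⟩
  obtain ⟨M, hM⟩ := exists_stepConstants l₁₀.2 l₁₁.2 l₂₁.2 l₂₂.2 hμ₂ hη₀ hηlam₀ hκ0.le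
    (Nat.cast_nonneg (α := ℝ) J)
  have hM1 : 1 ≤ M := hM.one_le
  have hJ0 : (0 : ℝ) < J := by exact_mod_cast hJ
  obtain ⟨c, hc0, hc1, hc⟩ : ∃ c : ℝ, 0 < c ∧ c ≤ 1 ∧ c ≤ η₀ * μ₂ / J :=
    ⟨min 1 (η₀ * μ₂ / J), by positivity, min_le_left _ _, min_le_right _ _⟩
  obtain ⟨C₁, C₂, C, s₀, hC₁, hC₂, hC, hs₀, -, hW⟩ :=
    exists_lyapunovWeights hM1 hc0 (by positivity : 0 < 300 * M ^ 9 / c)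
  obtain ⟨s₁, hs₁, hs₁0, hs₁c⟩ : ∃ s₁ : ℝ, 0 < s₁ ∧ s₁ ≤ s₀ ∧ 32 * M ^ 4 * s₁ ≤ c := by
    refine ⟨min s₀ (c / (32 * M ^ 4)), by positivity, min_le_left _ _, ?_⟩
    calc 32 * M ^ 4 * min s₀ (c / (32 * M ^ 4)) ≤ 32 * M ^ 4 * (c / (32 * M ^ 4)) :=
          mul_le_mul_of_nonneg_left (min_le_right _ _) (by positivity)
      _ = c := by field_simp
  set E₀ : ℝ := (1 + 2 * M) * |gap| + 2 * dist₀ ^ 2 + 1 with hE₀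
  have hE0 : 0 ≤ E₀ := by positivity
  obtain ⟨R, hR⟩ : ∃ R : ℝ, R = 2 / ηlam₀ * ((M ^ 5 + C₁ + C₂) * E₀ + 2 * C)
        + (60 * M ^ 4) ^ ⌈(s₁⁻¹) ^ 7⌉₊ * E₀ / s₁ ^ 2 := ⟨_, rfl⟩
  have hR0 : 0 ≤ R := by rw [hR]; positivity
  refine ⟨R, ((l₁₁ : ℝ) / μ₂) ^ 7 + (1 + R) ^ 7, ?_⟩
  intro m d Sval Str Ω _ _ _ L₁ L₂ f₁ f₂ νval νtr _ _ blkU blkW init K P _ Dtr Dval j r N H h₁ h₂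
    hgap hu hw _ hK hrand
  have hK0 : (0 : ℝ) < K := by exact_mod_cast hK
  -- the small parameter `s = K ^ (-1/7)`
  obtain ⟨t, ht⟩ : ∃ t : ℝ, t = (K : ℝ) ^ (1 / 7 : ℝ) := ⟨_, rfl⟩
  have ht0 : 0 < t := by rw [ht]; positivity
  have hpow : ∀ n : ℕ, (K : ℝ) ^ ((n : ℝ) / 7) = t ^ n := fun n => by
    rw [ht, ← Real.rpow_natCast, ← Real.rpow_mul hK0.le]
    congr 1
    ring
  have hp2 : (K : ℝ) ^ (2 / 7 : ℝ) = t ^ 2 := by exact_mod_cast hpow 2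
  have hp4 : (K : ℝ) ^ (4 / 7 : ℝ) = t ^ 4 := by exact_mod_cast hpow 4
  have hp5 : (K : ℝ) ^ (5 / 7 : ℝ) = t ^ 5 := by exact_mod_cast hpow 5
  have hp7 : (K : ℝ) = t ^ 7 := by
    have := hpow 7
    rwa [show ((7 : ℕ) : ℝ) / 7 = 1 by norm_num, Real.rpow_one] at this
  have hsK : t⁻¹ ^ 7 * (K : ℝ) = 1 := by
    rw [hp7, inv_pow]
    exact inv_mul_cancel₀ (by positivity)
  have hgrad : ∀ lam, ∇ (bilevelObjective L₁ L₂) lam = hypergradient L₁ L₂ lam := fun lam =>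
    (H.hasGradientAt_bilevelObjective hμ₂ lam).gradient
  have hout : ∀ ω, scaleBiOOutput f₁ f₂ blkU blkW η₀ ηlam₀ K init Dtr Dval j r N ω =
      (iterateWith (stateStep f₁ f₂ blkU blkW t⁻¹⁻¹ (η₀ * t⁻¹ ^ 4) (η₀ * t⁻¹ ^ 4)
        (ηlam₀ * t⁻¹ ^ 5)) (init.lam, pair init.u init.w)
        (fun n => (Dtr n ω, Dval n ω, j n ω, r n ω)) (N ω)).1 := fun ω => by
    rw [iterateWith_stateStep, scaleBiOOutput, ← ht, hp4, hp5, inv_inv, inv_pow, inv_pow,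
      div_eq_mul_inv, div_eq_mul_inv]
  obtain ⟨hi, he⟩ := H.integral_sq_norm_hypergradient_uniform_le
    (p₀ := (init.lam, pair init.u init.w)) hμ₂ h₁ h₂ hM hJ hη₀ hηlam₀ hκ0 hκ hgap hc0 hc1 hc hC₁
    hC₂ hC hW hs₁ hs₁0 hs₁c (inv_pos.2 ht0) hK hsK blkU blkW
    (fun k => (hrand.measurable_Dtr k).prodMk ((hrand.measurable_Dval k).prodMk
      ((hrand.measurable_j k).prodMk (hrand.measurable_r k))))
    hrand.indep hrand.law hrand.measurable_N hrand.law_N hrand.indep_N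
    (H.energy_init_le hμ₂ hM init hgap hu hw)
  rw [← hE₀, ← hR] at he
  simp only [hgrad, hout]
  refine ⟨fun lam => (H.hasGradientAt_bilevelObjective hμ₂ lam).differentiableAt, hi,
    fun _ => ?_, fun ε hε hε1 hεK => ?_⟩
  · rwa [hp2, div_eq_mul_inv, ← inv_pow]
  · obtain ⟨e1, e2⟩ := le_of_div_pow_le hR0 (by positivity) (inv_pos.2 ht0) hsK hε hε1 hεK
    rw [inv_inv] at e1
    rw [← ht]
    exact ⟨e1, he.trans e2⟩
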